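/- Let $\mathbb F$ be any field. Let $\mathcal H^B_n(0)$ be the 0-Hecke algebra over $\mathbb F$ of the Coxeter system $(\mathfrak S^B_n,S)$ of type $B_n$, where $\mathfrak S^B_n$ is the group of signed permutations of $\{\pm1,\dots,\pm n\}$, $S=\{s_0,\dots,s_{n-1}\}$, $s_0$ negates $\pm1$, and $s_i$ $(i\ge1)$ interchanges $i,i+1$ and $-i,-(i+1)$. It is generated by $\pi_0,\dots,\pi_{n-1}$ with $\pi_i^2=\pi_i$ and the braid relations of $\mathfrak S^B_n$. Put $\overline\pi_i=\pi_i-1$. For $w=s_{i_1}\cdots s_{i_k}$ reduced put $\pi_w=\pi_{i_1}\cdots\pi_{i_k}$, $\overline\pi_w=\overline\pi_{i_1}\cdots\overline\pi_{i_k}$. Let $w_0(I)$ be the longest element of the parabolic subgroup generated by $I\subseteq S$. Define the left ideals $\mathcal P^S_{I,J}=\mathcal H^B_n(0)\,\overline\pi_{w_0(I)}\pi_{w_0(J\setminus I)}$ for $I,J\subseteq S$, and $\mathcal P^S_I=\mathcal P^S_{I,S}$. Let $\mathcal H_m(0)$ be the 0-Hecke algebra of the symmetric group $\mathfrak S_m$,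 with generators $\pi_1,\dots,\pi_{m-1}$. A pseudo-composition of $n$, written $\alpha\models^B n$, is a sequence $(\alpha_1,\dots,\alpha_\ell)$, $\ell\ge1$, of integers with sum $n$, $\alpha_1\ge0$ and $\alpha_2,\dots,\alpha_\ell>0$; a composition has $\alpha_1>0$ too. Put $D(\alpha)=\{\alpha_1,\alpha_1+\alpha_2,\dots,\alpha_1+\cdots+\alpha_{\ell-1}\}$, $\alpha\cdot\beta=(\alpha_1,\dots,\alpha_\ell,\beta_1,\dots,\beta_k)$ and $\alpha\rhd\beta=(\alpha_1,\dots,\alpha_{\ell-1},\alpha_\ell+\beta_1,\beta_2,\dots,\beta_k)$. A composition is identified with the ribbon diagram that has rows of lengths $\alpha_1,\alpha_2,\dots$ from bottom to top, each row starting in the column in which the row below it ends. A pseudo-composition gives a pseudo-ribbon: the ribbon of $(\alpha_1+1,\alpha_2,\dots,\alpha_\ell)$, whose first box is an extra box containing $0$. A generalized pseudo-ribbon $\alpha=\alpha^1\oplus\cdots\oplus\alpha^k$ of size $n$ consists of a pseudo-ribbon $\alpha^1\models^B n_1$ and ribbons $\alpha^i\models n_i$ $(i\ge2)$, $n_1+\cdots+n_k=n$,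 with $\alpha^{i+1}$ placed strictly to the northeast of $\alpha^i$. Put $[\alpha^1]=\{\alpha^1\}$ and $[\alpha]=\{\beta\cdot\alpha^k,\ \beta\rhd\alpha^k:\beta\in[\alpha^1\oplus\cdots\oplus\alpha^{k-1}]\}$. A type B standard tableau of shape $\alpha$ is a filling of the boxes of $\alpha$ other than the 0-box with integers, increasing from left to right in rows and from top to bottom in columns (the 0-box included), whose reading word (rows from bottom to top, each from left to right, the $0$ omitted) is a signed permutation. Let $\mathbf P^B_\alpha$ be the vector space over $\mathbb F$ with these tableaux as a basis. Call $0$ a descent of $\tau$ if $-1$ appears in $\tau$; call $i\in\{1,\dots,n-1\}$ a descent of $\tau$ if $i,i+1$ appear with $i$ in a higher row than $i+1$, or $-i,-(i+1)$ appear with $-i$ in a lower row than $-(i+1)$, or $i$ and $-(i+1)$ appear. Let $s_i(\tau)$ be obtained from $\tau$ by applying $s_i$ to every entry. Put $$\overline\pi_i(\tau)=\begin{cases}-\tau,& i\text{ is a descent of }\tau,\\ 0,& i\text{ is not a descent of }\tau\text{ and }s_i(\tau)\text{ is not standard},\\ s_i(\tau),& i\text{ is not a descent of }\tau\text{ and }s_i(\tau)\text{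 is standard}.\end{cases}\tag{1}$$ For a composition $\beta\models m$, let $\mathbf P_\beta$ have as a basis the standard tableaux of ribbon shape $\beta$ (entries $1,\dots,m$, each once; rows increase from left to right, columns from top to bottom), with $\overline\pi_i(\tau)=-\tau$, $0$, $s_i(\tau)$ according as $i$ is in a higher row than, in the same row as, or in a lower row than $i+1$, where $s_i(\tau)$ is obtained from $\tau$ by exchanging $i$ and $i+1$. **Theorem.** These formulas make every $\mathbf P_\beta$ an $\mathcal H_m(0)$-module and every $\mathbf P^B_\alpha$ an $\mathcal H^B_n(0)$-module, and the following holds. (i) If $\alpha\models^B n$ is a pseudo-composition, then $\mathbf P^B_\alpha\cong\mathcal P^S_I$ with $I=\{s_i:i\in D(\alpha)\}$, and this module is projective and indecomposable. (ii) Let $\alpha=\alpha^1\oplus\cdots\oplus\alpha^k$ be a generalized pseudo-ribbon of size $n$ with $\alpha^1\models^B n_1$ and $\alpha^i\models n_i$ for $i=2,\dots,k$. Put $$I=\{s_i:i\in D(\alpha^1\rhd\cdots\rhd\alpha^k)\},\qquad J=\{s_j:j\in D((0\cdot1^{n_1})\rhd1^{n_2}\rhd\cdots\rhd1^{n_k})\}.$$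 Then $\mathbf P^B_\alpha\cong\mathcal P^S_{I,J}$, and $$\mathbf P^B_\alpha\;\cong\;\left(\mathbf P^B_{\alpha^1}\otimes\mathbf P_{\alpha^2}\otimes\cdots\otimes\mathbf P_{\alpha^k}\right)\Big\uparrow_{\mathcal H^B_{n_1,\dots,n_k}(0)}^{\mathcal H^B_n(0)}\;\cong\;\bigoplus_{\beta\in[\alpha]}\mathbf P^B_\beta$$ as $\mathcal H^B_n(0)$-modules. Here $\mathcal H^B_{n_1,\dots,n_k}(0)\cong\mathcal H^B_{n_1}(0)\otimes\mathcal H_{n_2}(0)\otimes\cdots\otimes\mathcal H_{n_k}(0)$ is the parabolic subalgebra of $\mathcal H^B_n(0)$ in which the generator $\pi_j$ of $\mathcal H^B_{n_1}(0)$ is $\pi_j$ and the generator $\pi_j$ of $\mathcal H_{n_i}(0)$ is $\pi_{n_1+\cdots+n_{i-1}+j}$, and $N\uparrow_{B}^{A}=A\otimes_{B}N$. -/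

import Mathlib

open scoped TensorProduct DirectSum

noncomputable section

/-! ### 0-Hecke algebras -/

namespace ZeroHecke

/-- Defining relations of the 0-Hecke algebra attached to a Coxeter matrix: the quadratic relations
`π_s ^ 2 = π_s`, and the braid relations, which equate the two alternating products of `π_s` and
`π_t` with `M s t` factors. -/
inductive Rel (F : Type*) [Field F] {B : Type*} (M : CoxeterMatrix B) :
    FreeAlgebra F B → FreeAlgebra F B → Prop
  | idem (s : B) : Rel F M (FreeAlgebra.ι F s * FreeAlgebra.ι F s) (FreeAlgebra.ι F s)
  | braid (s t : B) : Rel F M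
      ((CoxeterSystem.alternatingWord s t (M s t)).map (FreeAlgebra.ι F)).prod
      ((CoxeterSystem.alternatingWord t s (M s t)).map (FreeAlgebra.ι F)).prod

end ZeroHecke

/-- The 0-Hecke algebra over the field `F` of the Coxeter matrix `M`, by generators `π_s` and
relations. -/
def ZeroHecke (F : Type*) [Field F] {B : Type*} (M : CoxeterMatrix B) : Type _ :=
  RingQuot (ZeroHecke.Rel F M)

namespace ZeroHecke

instance {F : Type*} [Field F] {B : Type*} (M : CoxeterMatrix B) : Ring (ZeroHecke F M) :=
  inferInstanceAs (Ring (RingQuot (ZeroHecke.Rel F M)))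

instance {F : Type*} [Field F] {B : Type*} (M : CoxeterMatrix B) : Algebra F (ZeroHecke F M) :=
  inferInstanceAs (Algebra F (RingQuot (ZeroHecke.Rel F M)))

/-- The generator `π_s`. -/
def pi (F : Type*) [Field F] {B : Type*} (M : CoxeterMatrix B) (s : B) : ZeroHecke F M :=
  RingQuot.mkAlgHom F (Rel F M) (FreeAlgebra.ι F s)

/-- The generator `π̄_s = π_s - 1`. -/
def pibar (F : Type*) [Field F] {B : Type*} (M : CoxeterMatrix B) (s : B) : ZeroHecke F M :=
  pi F M s - 1

theorem pi_mul_self (F : Type*) [Field F] {B : Type*} (M : CoxeterMatrix B) (s : B) :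
    pi F M s * pi F M s = pi F M s := by
  have h := RingQuot.mkAlgHom_rel F (Rel.idem (F := F) (M := M) s)
  rw [map_mul] at h
  exact h

theorem pi_braid (F : Type*) [Field F] {B : Type*} (M : CoxeterMatrix B) (s t : B) :
    ((CoxeterSystem.alternatingWord s t (M s t)).map (pi F M)).prod =
      ((CoxeterSystem.alternatingWord t s (M s t)).map (pi F M)).prod := by
  have h := RingQuot.mkAlgHom_rel F (Rel.braid (F := F) (M := M) s t)
  rw [map_list_prod, map_list_prod, List.map_map, List.map_map] at h
  exact h

theorem pi_comm (F : Type*) [Field F] {B : Type*} (M : CoxeterMatrix B) {s t : B}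
    (h : M s t = 2) : Commute (pi F M s) (pi F M t) := by
  have := pi_braid F M s t
  rw [h] at this
  simp only [CoxeterSystem.alternatingWord, List.concat_eq_append, List.nil_append,
    List.cons_append, List.map_cons, List.map_nil, List.prod_cons, List.prod_nil, mul_one] at this
  exact this

/-- The universal property: elements of an algebra that satisfy the defining relations determine a
homomorphism. -/
def lift {F : Type*} [Field F] {B : Type*} (M : CoxeterMatrix B) {A : Type*} [Ring A] [Algebra F A]
    (f : B → A) (hidem : ∀ s, f s * f s = f s)
    (hbraid : ∀ s t, ((CoxeterSystem.alternatingWord s t (M s t)).map f).prod =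
      ((CoxeterSystem.alternatingWord t s (M s t)).map f).prod) : ZeroHecke F M →ₐ[F] A :=
  RingQuot.liftAlgHom F ⟨FreeAlgebra.lift F f, by
    intro x y h
    induction h with
    | idem s => simpa using hidem s
    | braid s t =>
      rw [map_list_prod, map_list_prod, List.map_map, List.map_map]
      simpa [Function.comp_def] using hbraid s t⟩

theorem lift_pi {F : Type*} [Field F] {B : Type*} (M : CoxeterMatrix B) {A : Type*} [Ring A]
    [Algebra F A] (f : B → A) (hidem) (hbraid) (s : B) :
    lift M f hidem hbraid (pi F M s) = f s := by
  have h := RingQuot.liftAlgHom_mkAlgHom_apply F (FreeAlgebra.lift F f) (s := Rel F M) (by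
    intro x y h
    induction h with
    | idem s => simpa using hidem s
    | braid s t =>
      rw [map_list_prod, map_list_prod, List.map_map, List.map_map]
      simpa [Function.comp_def] using hbraid s t) (FreeAlgebra.ι F s)
  rw [FreeAlgebra.lift_ι_apply] at h
  exact h

theorem map_alternatingWord {B B' : Type*} (f : B → B') (s t : B) (m : ℕ) :
    (CoxeterSystem.alternatingWord s t m).map f =
      CoxeterSystem.alternatingWord (f s) (f t) m := by
  induction m generalizing s t with
  | zero => rfl
  | succ m ih => simp [CoxeterSystem.alternatingWord, ih]

/-- The homomorphism `π_s ↦ π_{f s}` for a map `f` that preserves the entries of the Coxeter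
matrices. -/
def map (F : Type*) [Field F] {B B' : Type*} (M : CoxeterMatrix B) (M' : CoxeterMatrix B')
    (f : B → B') (hf : ∀ s t, M' (f s) (f t) = M s t) : ZeroHecke F M →ₐ[F] ZeroHecke F M' :=
  lift M (fun s => pi F M' (f s)) (fun s => pi_mul_self F M' (f s)) (fun s t => by
    have h := pi_braid F M' (f s) (f t)
    rw [hf, ← map_alternatingWord, ← map_alternatingWord, List.map_map, List.map_map] at h
    exact h)

theorem map_pi (F : Type*) [Field F] {B B' : Type*} (M : CoxeterMatrix B) (M' : CoxeterMatrix B')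
    (f : B → B') (hf) (s : B) : map F M M' f hf (pi F M s) = pi F M' (f s) :=
  lift_pi _ _ _ _ _

theorem commute_of_pi {F : Type*} [Field F] {B : Type*} (M : CoxeterMatrix B) {A : Type*} [Ring A]
    [Algebra F A] (φ : ZeroHecke F M →ₐ[F] A) (x : A) (h : ∀ s, Commute (φ (pi F M s)) x)
    (a : ZeroHecke F M) : Commute (φ a) x := by
  let q : FreeAlgebra F B →ₐ[F] ZeroHecke F M := RingQuot.mkAlgHom F (Rel F M)
  obtain ⟨b, hb⟩ : ∃ b, q b = a := RingQuot.mkAlgHom_surjective F (Rel F M) a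
  rw [← hb]
  clear hb
  induction b using FreeAlgebra.induction with
  | grade0 r =>
    rw [AlgHom.commutes, AlgHom.commutes]
    exact Algebra.commutes r x
  | grade1 s => exact h s
  | mul a b ha hb =>
    rw [map_mul, map_mul]
    exact ha.mul_left hb
  | add a b ha hb =>
    rw [map_add, map_add]
    exact ha.add_left hb

end ZeroHecke

/-- The Coxeter matrix of type `B_n` on the generators `s_0, …, s_{n-1}`, the double bond being
between `s_0` and `s_1`. -/
def coxeterB (n : ℕ) : CoxeterMatrix (Fin n) where
  M := Matrix.of fun i j : Fin n =>
    if i = j then 1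
    else if (i : ℕ) + 1 = j ∨ (j : ℕ) + 1 = i then (if (i : ℕ) = 0 ∨ (j : ℕ) = 0 then 4 else 3)
    else 2
  isSymm := by
    ext i j
    simp only [Matrix.transpose_apply, Matrix.of_apply]
    split_ifs <;> first | rfl | omega
  diagonal := by simp
  off_diagonal := by
    intro i j h
    simp only [Matrix.of_apply, if_neg h]
    split_ifs <;> omega

/-- The 0-Hecke algebra `H_m(0)` of the symmetric group on `m` letters. The index `j : Fin (m - 1)`
stands for the generator number `j + 1`. -/
abbrev HeckeA (F : Type*) [Field F] (m : ℕ) : Type _ := ZeroHecke F (CoxeterMatrix.A (m - 1))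

/-- The 0-Hecke algebra `H^B_n(0)` of the hyperoctahedral group. -/
abbrev HeckeB (F : Type*) [Field F] (n : ℕ) : Type _ := ZeroHecke F (coxeterB n)

/-! ### Signed permutations and the modules `P_{I,J}^S` -/

/-- The hyperoctahedral group on `{±1, …, ±n}`, as a group of permutations of `ℤ` that fix `0` and
every integer of absolute value larger than `n`. -/
def signedPerm (n : ℕ) : Subgroup (Equiv.Perm ℤ) where
  carrier := {w | (∀ x, w (-x) = -w x) ∧ ∀ x, (n : ℤ) < |x| → w x = x}
  mul_mem' := by
    rintro a b ⟨ha, ha'⟩ ⟨hb, hb'⟩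
    exact ⟨fun x => by simp [ha, hb], fun x hx => by simp [hb' x hx, ha' x hx]⟩
  one_mem' := by simp
  inv_mem' := by
    rintro a ⟨ha, ha'⟩
    refine ⟨fun x => ?_, fun x hx => ?_⟩
    · rw [Equiv.Perm.inv_eq_iff_eq, ha]
      simp
    · rw [Equiv.Perm.inv_eq_iff_eq, ha' x hx]

/-- The symmetric group on `{1, …, m}`, as a group of permutations of `ℤ`. -/
def symPerm (m : ℕ) : Subgroup (Equiv.Perm ℤ) where
  carrier := {w | ∀ x, ¬ (1 ≤ x ∧ x ≤ (m : ℤ)) → w x = x}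
  mul_mem' := by
    intro a b ha hb x hx
    simp [hb x hx, ha x hx]
  one_mem' := by simp
  inv_mem' := by
    intro a ha x hx
    rw [Equiv.Perm.inv_eq_iff_eq, ha x hx]

/-- The generators of the hyperoctahedral group: `s_0` negates `±1`, and `s_i` with `i ≥ 1`
interchanges `i` with `i + 1` and `-i` with `-(i + 1)`. -/
def genB (i : ℕ) : Equiv.Perm ℤ :=
  if i = 0 then Equiv.swap 1 (-1)
  else Equiv.swap (i : ℤ) (i + 1) * Equiv.swap (-(i : ℤ)) (-(i + 1))

/-- The product `s_{i_1} ⋯ s_{i_k}`. -/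
def wordProd (n : ℕ) (u : List (Fin n)) : Equiv.Perm ℤ := (u.map fun i : Fin n => genB (i : ℕ)).prod

/-- The length of `w`: the least number of factors in an expression as a product of generators. -/
def lengthB (n : ℕ) (w : Equiv.Perm ℤ) : ℕ :=
  sInf {k | ∃ u : List (Fin n), u.length = k ∧ wordProd n u = w}

/-- The parabolic subgroup `W_I` generated by `{s_i : i ∈ I}`. -/
def parabolic (n : ℕ) (I : Finset (Fin n)) : Subgroup (Equiv.Perm ℤ) :=
  Subgroup.closure ((fun i : Fin n => genB i) '' (I : Set (Fin n)))

theorem genB_mem (n : ℕ) (i : Fin n) : genB i ∈ signedPerm n := by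
  have hi := i.isLt
  unfold genB
  split_ifs with h
  · refine ⟨fun x => ?_, fun x hx => ?_⟩
    · simp only [Equiv.swap_apply_def]
      split_ifs <;> omega
    · rw [Equiv.swap_apply_of_ne_of_ne] <;> rintro rfl <;> simp at hx <;> omega
  · refine ⟨fun x => ?_, fun x hx => ?_⟩
    · simp only [Equiv.Perm.mul_apply, Equiv.swap_apply_def]
      split_ifs <;> omega
    · rw [lt_abs] at hx
      simp only [Equiv.Perm.mul_apply, Equiv.swap_apply_def]
      split_ifs <;> omega

theorem signedPerm_finite (n : ℕ) : (signedPerm n : Set (Equiv.Perm ℤ)).Finite := by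
  have hb : ∀ w ∈ signedPerm n, ∀ x : ℤ, |x| ≤ n → |w x| ≤ n := by
    intro w hw x hx
    by_contra h
    have := w.injective (hw.2 (w x) (not_le.mp h))
    rw [this] at h
    exact h hx
  let f : signedPerm n → (Set.Icc (-(n : ℤ)) n → Set.Icc (-(n : ℤ)) n) :=
    fun w x => ⟨w.1 x, abs_le.mp (hb w.1 w.2 x (abs_le.mpr x.2))⟩
  have hf : Function.Injective f := by
    intro v w h
    apply Subtype.ext
    ext x
    by_cases hx : (n : ℤ) < |x|
    · rw [v.2.2 x hx, w.2.2 x hx]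
    · exact congrArg Subtype.val (congrFun h ⟨x, abs_le.mp (not_lt.mp hx)⟩)
  exact @Set.toFinite _ _ (Finite.of_injective f hf)

theorem exists_longest (n : ℕ) (I : Finset (Fin n)) :
    ∃ w ∈ parabolic n I, ∀ v ∈ parabolic n I, lengthB n v ≤ lengthB n w := by
  have hle : parabolic n I ≤ signedPerm n := by
    rw [parabolic, Subgroup.closure_le]
    rintro _ ⟨i, -, rfl⟩
    exact genB_mem n i
  obtain ⟨w, hw, hmax⟩ := Set.exists_max_image (parabolic n I : Set (Equiv.Perm ℤ)) (lengthB n)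
    ((signedPerm_finite n).subset hle) ⟨1, one_mem _⟩
  exact ⟨w, hw, hmax⟩

theorem exists_reduced (n : ℕ) (I : Finset (Fin n)) (w : Equiv.Perm ℤ) (hw : w ∈ parabolic n I) :
    ∃ u : List (Fin n), wordProd n u = w ∧ u.length = lengthB n w := by
  have hex : ∃ u : List (Fin n), wordProd n u = w := by
    induction hw using Subgroup.closure_induction with
    | mem x hx => obtain ⟨i, -, rfl⟩ := hx; exact ⟨[i], by simp [wordProd]⟩
    | one => exact ⟨[], by simp [wordProd]⟩
    | mul x y _ _ hx hy =>
      obtain ⟨u, rfl⟩ := hx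
      obtain ⟨v, rfl⟩ := hy
      exact ⟨u ++ v, by simp [wordProd]⟩
    | inv x _ hx =>
      obtain ⟨u, rfl⟩ := hx
      refine ⟨u.reverse, ?_⟩
      have hinv : ∀ i : ℕ, (genB i)⁻¹ = genB i := by
        intro i
        unfold genB
        split_ifs with h
        · exact Equiv.swap_inv _ _
        · rw [mul_inv_rev, Equiv.swap_inv, Equiv.swap_inv]
          ext x
          simp only [Equiv.Perm.mul_apply, Equiv.swap_apply_def]
          split_ifs <;> omega
      simp [wordProd, List.prod_inv_reverse, Function.comp_def, hinv]
  obtain ⟨u, hu⟩ := hex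
  obtain ⟨v, hv, hv'⟩ := Nat.sInf_mem
    (s := {k | ∃ u : List (Fin n), u.length = k ∧ wordProd n u = w}) ⟨_, u, rfl, hu⟩
  exact ⟨v, hv', hv⟩

/-- The longest element `w_0(I)` of the parabolic subgroup `W_I`. -/
def longest (n : ℕ) (I : Finset (Fin n)) : Equiv.Perm ℤ := (exists_longest n I).choose

/-- A reduced expression of `w_0(I)`. -/
def longestWord (n : ℕ) (I : Finset (Fin n)) : List (Fin n) :=
  (exists_reduced n I (longest n I) (exists_longest n I).choose_spec.1).choose

/-- `π_w` for `w = w_0(I)`: the product of the `π_i` along a reduced expression of `w`. -/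
def piLongest (F : Type*) [Field F] (n : ℕ) (I : Finset (Fin n)) : HeckeB F n :=
  ((longestWord n I).map (ZeroHecke.pi F (coxeterB n))).prod

/-- `π̄_w` for `w = w_0(I)`: the product of the `π̄_i` along a reduced expression of `w`. -/
def pibarLongest (F : Type*) [Field F] (n : ℕ) (I : Finset (Fin n)) : HeckeB F n :=
  ((longestWord n I).map (ZeroHecke.pibar F (coxeterB n))).prod

/-- The left ideal `P_{I,J}^S = H^B_n(0) · π̄_{w_0(I)} π_{w_0(J \ I)}`. -/
def moduleIJ (F : Type*) [Field F] (n : ℕ) (I J : Finset (Fin n)) :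
    Submodule (HeckeB F n) (HeckeB F n) :=
  Submodule.span (HeckeB F n) {pibarLongest F n I * piLongest F n (J \ I)}

/-- The left ideal `P_I^S = H^B_n(0) · π̄_{w_0(I)} π_{w_0(Iᶜ)}`. -/
def moduleI (F : Type*) [Field F] (n : ℕ) (I : Finset (Fin n)) :
    Submodule (HeckeB F n) (HeckeB F n) :=
  Submodule.span (HeckeB F n) {pibarLongest F n I * piLongest F n Iᶜ}

/-! ### Pseudo-compositions and generalized pseudo-ribbons -/

/-- `D(α) = {α_1, α_1 + α_2, …, α_1 + ⋯ + α_{ℓ-1}}`. -/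
def descentSet (α : List ℕ) : Finset ℕ :=
  (Finset.Ico 1 α.length).image fun k => (α.take k).sum

/-- `α ▷ β = (α_1, …, α_{ℓ-1}, α_ℓ + β_1, β_2, …, β_k)`, for nonempty sequences. -/
def nearConcat (α β : List ℕ) : List ℕ :=
  α.dropLast ++ (α.getLastD 0 + β.headD 0) :: β.tail

/-- Pseudo-compositions of `n`: sequences `(α_1, …, α_ℓ)`, `ℓ ≥ 1`, of natural numbers with sum `n`
in which `α_2, …, α_ℓ` are positive. -/
structure PseudoComp (n : ℕ) where
  blocks : List ℕ
  blocks_ne_nil : blocks ≠ []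
  tail_pos : ∀ a ∈ blocks.tail, 0 < a
  blocks_sum : blocks.sum = n

/-- Generalized pseudo-ribbons `α^1 ⊕ ⋯ ⊕ α^k` of size `n`: the first component `α^1` is a
pseudo-composition of some `n_1`, the others (`tail`) are nonempty compositions of their sizes, and
the sizes add up to `n`. -/
structure GenPseudoRibbon (n : ℕ) where
  headSize : ℕ
  head : PseudoComp headSize
  tail : List ((m : ℕ) × Composition m)
  tail_pos : ∀ β ∈ tail, 0 < β.1
  size_eq : headSize + (tail.map Sigma.fst).sum = n

/-- A pseudo-ribbon, as a generalized pseudo-ribbon with one component. -/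
def PseudoComp.toGen {n : ℕ} (α : PseudoComp n) : GenPseudoRibbon n :=
  ⟨n, α, [], by simp, by simp⟩

namespace GenPseudoRibbon

variable {n : ℕ} (α : GenPseudoRibbon n)

/-- The number of components after the first one. -/
abbrev numTail : ℕ := α.tail.length

/-- The size of the component number `i` after the first one. -/
abbrev tailSize (i : Fin α.numTail) : ℕ := (α.tail.get i).1

/-- The component number `i` after the first one, a composition of its size. -/
abbrev tailComp (i : Fin α.numTail) : Composition (α.tailSize i) := (α.tail.get i).2

/-- The total size of the components that precede the component number `i` after the first one. -/
def offset (i : ℕ) : ℕ := α.headSize + ((α.tail.take i).map Sigma.fst).sum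

/-- The lengths of all rows from bottom to top (not counting the extra 0-box). -/
def rows : List ℕ := α.head.blocks ++ α.tail.flatMap fun β => β.2.blocks

/-- `α^1 ▷ ⋯ ▷ α^k`. -/
def nearConcatAll : List ℕ :=
  α.tail.foldl (fun γ β => nearConcat γ β.2.blocks) α.head.blocks

/-- `(0 · 1^{n_1}) ▷ 1^{n_2} ▷ ⋯ ▷ 1^{n_k}`. -/
def nearConcatOnes : List ℕ :=
  α.tail.foldl (fun γ β => nearConcat γ (List.replicate β.1 1))
    (0 :: List.replicate α.headSize 1)

/-- `I = {s_i : i ∈ D(α^1 ▷ ⋯ ▷ α^k)}`. -/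
def setI : Finset (Fin n) := Finset.univ.filter fun i => (i : ℕ) ∈ descentSet α.nearConcatAll

/-- `J = {s_j : j ∈ D(0 · 1^{n_1} ▷ 1^{n_2} ▷ ⋯ ▷ 1^{n_k})}`. -/
def setJ : Finset (Fin n) := Finset.univ.filter fun j => (j : ℕ) ∈ descentSet α.nearConcatOnes

/-- The set `[α]`, defined recursively by `[α^1] = {α^1}` and
`[α^1 ⊕ ⋯ ⊕ α^k] = {β · α^k, β ▷ α^k : β ∈ [α^1 ⊕ ⋯ ⊕ α^{k-1}]}`. -/
def bracket : Set (List ℕ) :=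
  α.tail.foldl (fun S γ => {δ | ∃ β ∈ S, δ = β ++ γ.2.blocks ∨ δ = nearConcat β γ.2.blocks})
    {α.head.blocks}

end GenPseudoRibbon

/-! ### Tableaux

The boxes of a diagram are numbered in reading order (rows from bottom to top, each row from left to
right); the extra 0-box has number `0`. Let `E` be the set of numbers of boxes that are followed by
the start of a new row, and `N ⊆ E` the set of numbers of boxes that are followed by the start of a
new component. From a box to the next one we go

* one step to the right if the row continues,
* one step up if a new row of the same component starts (such a row starts in the column where the
  previous row ends),
* one step up and one step to the right if a new component starts.

The functions `boxRow` and `boxCol` are the coordinates of the boxes, rows being counted from bottom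
to top. -/

/-- The row of box number `k`, counted from the bottom. -/
def boxRow (E : Finset ℕ) (k : ℕ) : ℕ := ((Finset.range k).filter fun j => j ∈ E).card

/-- The column of box number `k`, counted from the left. -/
def boxCol (E N : Finset ℕ) (k : ℕ) : ℕ := ((Finset.range k).filter fun j => j ∉ E ∨ j ∈ N).card

/-- The filling that puts the integer `w k` into box number `k` increases along each row from left
to right and along each column from top to bottom. -/
def IsIncreasing (E N boxes : Finset ℕ) (w : ℤ → ℤ) : Prop :=
  ∀ a ∈ boxes, ∀ b ∈ boxes,
    (boxRow E a = boxRow E b → boxCol E N a < boxCol E N b → w a < w b) ∧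
    (boxCol E N a = boxCol E N b → boxRow E a < boxRow E b → w b < w a)

/-- The integer `x` appears in the filling `w` of the boxes with numbers in `boxes`. -/
def Appears (boxes : Finset ℕ) (w : ℤ → ℤ) (x : ℤ) : Prop := ∃ a ∈ boxes, w a = x

/-- The integers `x` and `y` both appear in the filling, and `x` is in a row higher than `y`. -/
def Higher (E boxes : Finset ℕ) (w : ℤ → ℤ) (x y : ℤ) : Prop :=
  ∃ a ∈ boxes, ∃ b ∈ boxes, w a = x ∧ w b = y ∧ boxRow E b < boxRow E a

/-! #### Type A: ribbons -/

/-- A standard tableau of ribbon shape `β ⊨ m`, encoded by its reading word `w`: box number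
`k ∈ {1, …, m}` contains `w k`. -/
def IsTableauA {m : ℕ} (β : Composition m) (w : Equiv.Perm ℤ) : Prop :=
  w ∈ symPerm m ∧ IsIncreasing (descentSet β.blocks) ∅ (Finset.Icc 1 m) w

/-- The standard tableaux of ribbon shape `β`. -/
abbrev TableauA {m : ℕ} (β : Composition m) : Type := {w : Equiv.Perm ℤ // IsTableauA β w}

/-- The vector space `P_β`. -/
abbrev SpaceA (F : Type*) [Field F] {m : ℕ} (β : Composition m) : Type _ := TableauA β →₀ F

open scoped Classical in
/-- The operator by which `π̄_i` has to act on `P_β`: it sends a tableau `τ` to `-τ` if `i` is in a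
higher row than `i + 1`, to `s_i(τ)` if `i` is in a lower row than `i + 1` (the tableau `s_i(τ)` is
then automatically standard), and to `0` if they are in the same row. -/
def opA (F : Type*) [Field F] {m : ℕ} (β : Composition m) (i : ℕ) :
    Module.End F (SpaceA F β) :=
  Finsupp.linearCombination F fun τ : TableauA β =>
    if Higher (descentSet β.blocks) (Finset.Icc 1 m) τ.1 i (i + 1) then -Finsupp.single τ 1
    else if h : Higher (descentSet β.blocks) (Finset.Icc 1 m) τ.1 (i + 1) i ∧
        IsTableauA β (Equiv.swap (i : ℤ) (i + 1) * τ.1) then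
      Finsupp.single ⟨Equiv.swap (i : ℤ) (i + 1) * τ.1, h.2⟩ 1
    else 0

/-! #### Type B: generalized pseudo-ribbons -/

namespace GenPseudoRibbon

variable {n : ℕ} (α : GenPseudoRibbon n)

/-- The numbers of the boxes that are followed by the start of a new row. -/
def rowEnds : Finset ℕ := descentSet α.rows

/-- The numbers of the boxes that are followed by the start of a new component. -/
def compEnds : Finset ℕ := (Finset.range α.numTail).image α.offset

/-- A type B standard tableau of shape `α`, encoded by its reading word `w`, a signed permutation:
box number `k ∈ {0, 1, …, n}` contains `w k`, with `w 0 = 0` in the extra box. -/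
def IsTableau (w : Equiv.Perm ℤ) : Prop :=
  w ∈ signedPerm n ∧ IsIncreasing α.rowEnds α.compEnds (Finset.range (n + 1)) w

/-- The type B standard tableaux of shape `α`. -/
abbrev Tableau : Type := {w : Equiv.Perm ℤ // α.IsTableau w}

/-- `i` is a descent of the tableau with reading word `w`. -/
def IsDescent (w : Equiv.Perm ℤ) (i : ℕ) : Prop :=
  if i = 0 then Appears (Finset.Icc 1 n) w (-1)
  else Higher α.rowEnds (Finset.Icc 1 n) w i (i + 1) ∨
    Higher α.rowEnds (Finset.Icc 1 n) w (-(i + 1)) (-i) ∨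
    (Appears (Finset.Icc 1 n) w i ∧ Appears (Finset.Icc 1 n) w (-(i + 1)))

/-- The vector space `P^B_α`. -/
abbrev Space (F : Type*) [Field F] : Type _ := α.Tableau →₀ F

open scoped Classical in
/-- The operator by which `π̄_i` has to act on `P^B_α`: it sends a tableau `τ` to `-τ` if `i` is a
descent of `τ`, to `s_i(τ)` if `i` is not a descent and `s_i(τ)` is standard, and to `0` otherwise.
Here `s_i(τ)` arises from `τ` by applying `s_i` to every entry. -/
def op (F : Type*) [Field F] (i : ℕ) : Module.End F (α.Space F) :=
  Finsupp.linearCombination F fun τ : α.Tableau =>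
    if α.IsDescent τ.1 i then -Finsupp.single τ 1
    else if h : α.IsTableau (genB i * τ.1) then Finsupp.single ⟨genB i * τ.1, h⟩ 1
    else 0

end GenPseudoRibbon

/-! ### Modules from representations, induction -/

/-- The module over the algebra `H` given by a representation `ρ` of `H` on the vector space `V`. -/
def ModuleOf {F H V : Type*} [Field F] [Ring H] [Algebra F H] [AddCommGroup V] [Module F V]
    (_ρ : H →ₐ[F] Module.End F V) : Type _ := V

namespace ModuleOf

variable {F H V : Type*} [Field F] [Ring H] [Algebra F H] [AddCommGroup V] [Module F V]
  (ρ : H →ₐ[F] Module.End F V)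

instance : AddCommGroup (ModuleOf ρ) := inferInstanceAs (AddCommGroup V)

instance : Module H (ModuleOf ρ) :=
  letI : Module (Module.End F V) (ModuleOf ρ) := inferInstanceAs (Module (Module.End F V) V)
  Module.compHom (ModuleOf ρ) ρ.toRingHom

theorem smul_def (h : H) (v : ModuleOf ρ) : h • v = (ρ h : V → V) v := rfl

end ModuleOf

/-- The induced module `B ⊗_A V` of a representation `ρ` of `A` on `V` along a homomorphism
`φ : A → B` of `F`-algebras: the quotient of `B ⊗_F V` by the relations
`b φ(a) ⊗ v = b ⊗ a v`. -/
abbrev InducedModule {F A B V : Type*} [Field F] [Ring A] [Algebra F A] [Ring B] [Algebra F B]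
    [AddCommGroup V] [Module F V] (φ : A →ₐ[F] B) (ρ : A →ₐ[F] Module.End F V) : Type _ :=
  (B ⊗[F] V) ⧸ Submodule.span B
    {x : B ⊗[F] V | ∃ (b : B) (a : A) (v : V), x = (b * φ a) ⊗ₜ[F] v - b ⊗ₜ[F] (ρ a v)}

/-- The outer tensor product of two representations. -/
def tensorRep {F A₁ A₂ V₁ V₂ : Type*} [Field F] [Ring A₁] [Algebra F A₁] [Ring A₂] [Algebra F A₂]
    [AddCommGroup V₁] [Module F V₁] [AddCommGroup V₂] [Module F V₂]
    (ρ₁ : A₁ →ₐ[F] Module.End F V₁) (ρ₂ : A₂ →ₐ[F] Module.End F V₂) :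
    A₁ ⊗[F] A₂ →ₐ[F] Module.End F (V₁ ⊗[F] V₂) :=
  (Module.endTensorEndAlgHom (R := F) (S := F) (A := F) (M := V₁) (N := V₂)).comp
    (Algebra.TensorProduct.map ρ₁ ρ₂)

/-- The outer tensor product of a finite family of representations. -/
def piTensorRep {F : Type*} [Field F] {k : ℕ} {A V : Fin k → Type*} [∀ i, Ring (A i)]
    [∀ i, Algebra F (A i)] [∀ i, AddCommGroup (V i)] [∀ i, Module F (V i)]
    (ρ : ∀ i, A i →ₐ[F] Module.End F (V i)) :
    (⨂[F] i, A i) →ₐ[F] Module.End F (⨂[F] i, V i) :=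
  PiTensorProduct.liftAlgHom
    ((PiTensorProduct.mapMultilinear F V V).compLinearMap fun i => (ρ i).toLinearMap)
    (by
      have h : (fun i => (ρ i).toLinearMap ((1 : ∀ i, A i) i)) = fun i => (1 : V i →ₗ[F] V i) := by
        funext i
        simp
      rw [MultilinearMap.compLinearMap_apply, h]
      exact PiTensorProduct.map_one)
    (by
      intro x y
      have h : (fun i => (ρ i).toLinearMap ((x * y) i)) =
          fun i => (ρ i (x i) * ρ i (y i) : V i →ₗ[F] V i) := by
        funext i
        simp
      rw [MultilinearMap.compLinearMap_apply, h]
      exact PiTensorProduct.map_mul (fun i => ρ i (x i)) (fun i => ρ i (y i)))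

theorem list_prod_ofFn_mul {H : Type*} [Monoid H] {k : ℕ} (f g : Fin k → H)
    (h : ∀ i j, i ≠ j → Commute (f i) (g j)) :
    (List.ofFn fun i => f i * g i).prod = (List.ofFn f).prod * (List.ofFn g).prod := by
  induction k with
  | zero => simp
  | succ k ih =>
    simp only [List.ofFn_succ, List.prod_cons]
    rw [ih (fun i => f i.succ) (fun i => g i.succ)
      (fun i j hij => h _ _ (fun e => hij (Fin.succ_injective _ e)))]
    have hc : Commute (List.ofFn fun i : Fin k => f i.succ).prod (g 0) := by
      apply Commute.list_prod_left
      intro x hx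
      obtain ⟨i, rfl⟩ := (List.mem_ofFn' _ _).mp hx
      exact h _ _ (Fin.succ_ne_zero i)
    rw [mul_assoc, mul_assoc, ← mul_assoc (g 0), ← hc.eq, mul_assoc]

/-- Homomorphisms `A_i → H` with pairwise commuting images give a homomorphism
`a_1 ⊗ ⋯ ⊗ a_k ↦ φ_1(a_1) ⋯ φ_k(a_k)`. -/
def piTensorLift {F : Type*} [Field F] {k : ℕ} {A : Fin k → Type*} [∀ i, Ring (A i)]
    [∀ i, Algebra F (A i)] {H : Type*} [Ring H] [Algebra F H] (φ : ∀ i, A i →ₐ[F] H)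
    (hcomm : ∀ i j, i ≠ j → ∀ a b, Commute (φ i a) (φ j b)) : (⨂[F] i, A i) →ₐ[F] H :=
  PiTensorProduct.liftAlgHom
    ((MultilinearMap.mkPiAlgebraFin F k H).compLinearMap fun i => (φ i).toLinearMap)
    (by simp [MultilinearMap.compLinearMap_apply])
    (by
      intro x y
      simp only [MultilinearMap.compLinearMap_apply, MultilinearMap.mkPiAlgebraFin_apply,
        AlgHom.toLinearMap_apply, Pi.mul_apply, map_mul]
      exact list_prod_ofFn_mul _ _ fun i j hij => hcomm i j hij _ _)

namespace GenPseudoRibbon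

variable {n : ℕ} (α : GenPseudoRibbon n)

theorem headSize_le : α.headSize ≤ n := by
  have := α.size_eq
  omega

theorem offset_add_le (i : Fin α.numTail) {j : ℕ} (hij : (i : ℕ) < j) :
    α.offset i + α.tailSize i ≤ α.offset j := by
  have h1 : α.tail.take (i + 1) = α.tail.take i ++ [α.tail.get i] := by
    rw [List.take_add_one]
    simp
  have h2 : α.offset (i + 1) = α.offset i + α.tailSize i := by
    simp only [offset, h1, List.map_append, List.sum_append]
    simp [tailSize, add_assoc]
  have h3 : α.offset (i + 1) ≤ α.offset j := by
    have hs : (α.tail.take (i + 1)).Sublist (α.tail.take j) :=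
      (List.take_prefix_take_left (by omega)).sublist
    have := (hs.map Sigma.fst).sum_le_sum (by simp)
    simp only [offset]
    omega
  omega

theorem offset_numTail : α.offset α.numTail = n := by
  simp [offset, numTail, α.size_eq]

theorem headSize_le_offset (i : ℕ) : α.headSize ≤ α.offset i := Nat.le_add_right _ _

/-- The embedding `H^B_{n_1}(0) → H^B_n(0)`, `π_j ↦ π_j`. -/
def headHom (F : Type*) [Field F] : HeckeB F α.headSize →ₐ[F] HeckeB F n :=
  ZeroHecke.map F _ _ (Fin.castLE α.headSize_le) (by
    intro s t
    show (coxeterB n).M _ _ = (coxeterB α.headSize).M _ _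
    simp only [coxeterB, Matrix.of_apply, Fin.ext_iff, Fin.val_castLE])

/-- The index `offset + j` in `H^B_n(0)` of the `j`-th generator (`j ≥ 1`) of the factor `H_{n_i}(0)`
that belongs to the component number `i` after the first one. -/
def tailIndex (i : Fin α.numTail) (j : Fin (α.tailSize i - 1)) : Fin n :=
  ⟨α.offset i + (j + 1), by
    have h1 := α.offset_add_le i i.isLt
    have h2 := α.offset_numTail
    have h3 := j.isLt
    change α.offset i + α.tailSize i ≤ α.offset α.numTail at h1
    omega⟩

/-- The embedding `H_{n_i}(0) → H^B_n(0)`, `π_j ↦ π_{offset + j}`. -/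
def tailHom (F : Type*) [Field F] (i : Fin α.numTail) :
    HeckeA F (α.tailSize i) →ₐ[F] HeckeB F n :=
  ZeroHecke.map F _ _ (α.tailIndex i) (by
    intro s t
    show (coxeterB n).M _ _ = (CoxeterMatrix.A _).M _ _
    simp only [coxeterB, CoxeterMatrix.A, Matrix.of_apply, Fin.ext_iff, tailIndex]
    split_ifs <;> first | omega | simp_all)

theorem commute_tail (F : Type*) [Field F] (i j : Fin α.numTail) (hij : i ≠ j)
    (a : HeckeA F (α.tailSize i)) (b : HeckeA F (α.tailSize j)) :
    Commute (α.tailHom F i a) (α.tailHom F j b) := by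
  refine ZeroHecke.commute_of_pi _ _ _ (fun s => ?_) a
  refine (ZeroHecke.commute_of_pi _ _ _ (fun t => ?_) b).symm
  rw [tailHom, tailHom, ZeroHecke.map_pi, ZeroHecke.map_pi]
  apply ZeroHecke.pi_comm
  show (coxeterB n).M _ _ = 2
  simp only [coxeterB, Matrix.of_apply, Fin.ext_iff, tailIndex]
  have hs := s.isLt
  have ht := t.isLt
  rcases lt_or_gt_of_ne (fun e => hij (Fin.ext e)) with h | h
  · have := α.offset_add_le i h
    split_ifs <;> omega
  · have := α.offset_add_le j h
    split_ifs <;> omega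

theorem commute_head (F : Type*) [Field F] (i : Fin α.numTail) (a : HeckeB F α.headSize)
    (b : HeckeA F (α.tailSize i)) : Commute (α.headHom F a) (α.tailHom F i b) := by
  refine ZeroHecke.commute_of_pi _ _ _ (fun s => ?_) a
  refine (ZeroHecke.commute_of_pi _ _ _ (fun t => ?_) b).symm
  rw [tailHom, headHom, ZeroHecke.map_pi, ZeroHecke.map_pi]
  apply ZeroHecke.pi_comm
  show (coxeterB n).M _ _ = 2
  simp only [coxeterB, Matrix.of_apply, Fin.ext_iff, tailIndex, Fin.val_castLE]
  have hs := s.isLt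
  have := α.headSize_le_offset i
  split_ifs <;> omega

/-- The embedding of `H^B_{n_1}(0) ⊗ H_{n_2}(0) ⊗ ⋯ ⊗ H_{n_k}(0)` into `H^B_n(0)`, whose image is the
parabolic subalgebra `H^B_{n_1,…,n_k}(0)`. -/
def parabolicHom (F : Type*) [Field F] :
    HeckeB F α.headSize ⊗[F] (⨂[F] i : Fin α.numTail, HeckeA F (α.tailSize i)) →ₐ[F]
      HeckeB F n :=
  Algebra.TensorProduct.lift (α.headHom F) (piTensorLift (α.tailHom F) (α.commute_tail F)) (by
    intro a x
    induction x using PiTensorProduct.induction_on with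
    | smul_tprod r f =>
      rw [map_smul]
      refine Commute.smul_right ?_ r
      simp only [piTensorLift, PiTensorProduct.liftAlgHom_apply, PiTensorProduct.lift.tprod,
        MultilinearMap.compLinearMap_apply, MultilinearMap.mkPiAlgebraFin_apply]
      apply Commute.list_prod_right
      intro y hy
      obtain ⟨i, rfl⟩ := (List.mem_ofFn' _ _).mp hy
      exact α.commute_head F i a _
    | add x y hx hy =>
      rw [map_add]
      exact hx.add_right hy)

end GenPseudoRibbon

/-- A module is indecomposable if it is nonzero and is not the direct sum of two nonzero
submodules. -/
def IsIndecomposable (R M : Type*) [Ring R] [AddCommGroup M] [Module R M] : Prop :=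
  Nontrivial M ∧ ∀ A B : Submodule R M, IsCompl A B → A = ⊥ ∨ B = ⊥

end

/-! Everything is read off from right descent sets. The reading word identifies the tableaux of
shape α with the signed permutations w whose right descents inside J are exactly I: a step upwards
forces a descent, a step to the right an ascent, a component break nothing (`isTableau_iff`). The
operators (1) become those of the regular representation in the basis π̄_w, cut down to this descent
class. Going up in left weak order never loses a right descent (`rdesc_gen_mul`), so the w with all
descents in I span a submodule, as do the w with some descent in J \ I. The descent class is a basis
of a subquotient, whence the formulas define a module (`convRep`). The map w ↦ π̄_w π_{w₀(J \ I)}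
kills what was divided out and is injective on the rest; its image is P_{I,J} (`descModel`).

For J = S, the products π̄_w π_{w₀(S \ D(w))} are unitriangular with respect to the π̄_w. So the
algebra is the direct sum of the left ideals spanned by those with a given descent set, and each
summand is projective (`ascentMap_bijective`, `descSplitModel`). The algebra acts triangularly on
the basis π̄_w ordered by length, with characters on the diagonal. Modulo elements killed by all
characters the ideal P_I is spanned by its generator, and such elements raise the length; hence P_I
does not decompose (`isIndecomposable_descRep`).

For general J, each I' with I' ∩ J = I gives a homomorphism from the module of I' that sends w to w
plus terms with more right descents. Together these are unitriangular, hence an isomorphism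
(`descLiftAll_bijective`). The sets I' are the descent sets of the members of [α]: · and ▷ decide
freely whether a joint is a descent (`exists_mem_joins`).

A module that is an explicit retract of its algebra stays explicit under tensor products and
induction: A ⊗ N is the left ideal generated by the image of the generator (`inducedEquiv`). That
image is recognised, up to sign, by the way in which the generators are absorbed (`IsPiTop.eq`,
`IsPibarTop.eq_or_eq_neg`).

The Coxeter theory needed in types A and B is derived once, from the orbit of a regular weight
(`DescentSystem`). Its centre is Matsumoto's theorem (`along_eq_mul`). -/

noncomputable section

/-! ### Descent systems -/

/-- A group with generators indexed by the nodes of a Coxeter matrix, together with the coordinates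
of the orbit of a regular dominant weight: `coord w i < 0` says that `i` is a left descent of `w`. -/
structure DescentSystem {B : Type*} (M : CoxeterMatrix B) (W : Type*) [Group W] where
  gen : B → W
  coord : W → B → ℤ
  cartan : B → B → ℤ
  -- A simple reflection in the coordinates given by the simple coroots.
  coord_gen_mul : ∀ i w j, coord (gen i * w) j = coord w j - cartan i j * coord w i
  coord_ne_zero : ∀ w i, coord w i ≠ 0
  coord_one_pos : ∀ i, 0 < coord 1 i
  eq_one : ∀ w, (∀ i, 0 < coord w i) → w = 1
  cartan_self : ∀ i, cartan i i = 2
  -- A double bond occurs twice because its Cartan integers are not symmetric in `s` and `t`.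
  rank_two : ∀ s t, s ≠ t → (M s t = 2 ∧ cartan s t = 0 ∧ cartan t s = 0) ∨
    (M s t = 3 ∧ cartan s t = -1 ∧ cartan t s = -1) ∨
    (M s t = 4 ∧ cartan s t = -1 ∧ cartan t s = -2) ∨
    (M s t = 4 ∧ cartan s t = -2 ∧ cartan t s = -1)
  -- A quantity that grows when a left descent is removed. It makes recursion along descents
  -- terminate before any length function exists.
  potential : W → ℤ
  potential_lt : ∀ w i, coord w i < 0 → potential w < potential (gen i * w)
  -- Elements of a standard parabolic subgroup have no left descents outside it. The rest of the
  -- parabolic theory follows from this.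
  coord_pos_of_mem : ∀ (I : Set B) (w : W), w ∈ Subgroup.closure (gen '' I) →
    ∀ k ∉ I, 0 < coord w k

/-- The braid relations of the Coxeter matrix `M` for a family of elements of a monoid. -/
def SatisfiesBraid {B N : Type*} [Monoid N] (M : CoxeterMatrix B) (a : B → N) : Prop :=
  ∀ s t, ((CoxeterSystem.alternatingWord s t (M s t)).map a).prod =
    ((CoxeterSystem.alternatingWord t s (M s t)).map a).prod

namespace SatisfiesBraid

variable {B N : Type*} [Monoid N] {M : CoxeterMatrix B} {a : B → N}

theorem prod_eq (h : SatisfiesBraid M a) (s t : B) :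
    ((CoxeterSystem.alternatingWord s t (M s t)).map a).prod =
      ((CoxeterSystem.alternatingWord t s (M s t)).map a).prod := h s t

theorem two (h : SatisfiesBraid M a) {s t : B} (hst : M s t = 2) : a s * a t = a t * a s := by
  simpa [hst, CoxeterSystem.alternatingWord] using h s t

theorem three (h : SatisfiesBraid M a) {s t : B} (hst : M s t = 3) :
    a s * (a t * a s) = a t * (a s * a t) := by
  simpa [hst, CoxeterSystem.alternatingWord] using (h s t).symm

theorem four (h : SatisfiesBraid M a) {s t : B} (hst : M s t = 4) :
    a s * (a t * (a s * a t)) = a t * (a s * (a t * a s)) := by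
  simpa [hst, CoxeterSystem.alternatingWord] using h s t

end SatisfiesBraid

/-! ### Reduced words and Matsumoto's theorem -/

namespace DescentSystem

variable {B : Type*} {M : CoxeterMatrix B} {W : Type*} [Group W] (𝒟 : DescentSystem M W)

theorem coord_gen_mul_self (i : B) (w : W) : 𝒟.coord (𝒟.gen i * w) i = -𝒟.coord w i := by
  rw [𝒟.coord_gen_mul, 𝒟.cartan_self]
  ring

theorem coord_gen_mul_neg {w : W} {i : B} : 𝒟.coord (𝒟.gen i * w) i < 0 ↔ ¬ 𝒟.coord w i < 0 := by
  rw [𝒟.coord_gen_mul_self]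
  have := 𝒟.coord_ne_zero w i
  omega

/-- `i` is a right descent of `w`. -/
def rdesc (w : W) (i : B) : Prop := 𝒟.coord w⁻¹ i < 0

/-- The parabolic subgroup generated by the generators in `I`. -/
def par (I : Set B) : Subgroup W := Subgroup.closure (𝒟.gen '' I)

theorem gen_mem_par {I : Set B} {i : B} (hi : i ∈ I) : 𝒟.gen i ∈ 𝒟.par I :=
  Subgroup.subset_closure ⟨i, hi, rfl⟩

theorem not_rdesc_of_mem_par {I : Set B} {w : W} (hw : w ∈ 𝒟.par I) {k : B} (hk : k ∉ I) :
    ¬ 𝒟.rdesc w k :=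
  (𝒟.coord_pos_of_mem I _ (inv_mem hw) k hk).not_gt

/-- One orientation of a double bond is enough: the relation for the other orientation is the same
one read backwards. -/
theorem satisfiesBraid_of {N : Type*} [Monoid N] {a : B → N}
    (h2 : ∀ s t, M s t = 2 → 𝒟.cartan s t = 0 → 𝒟.cartan t s = 0 → a s * a t = a t * a s)
    (h3 : ∀ s t, M s t = 3 → 𝒟.cartan s t = -1 → 𝒟.cartan t s = -1 →
      a s * (a t * a s) = a t * (a s * a t))
    (h4 : ∀ s t, M s t = 4 → 𝒟.cartan s t = -1 → 𝒟.cartan t s = -2 →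
      a s * (a t * (a s * a t)) = a t * (a s * (a t * a s))) : SatisfiesBraid M a := by
  intro s t
  by_cases hst : s = t
  · rw [hst]
  · rcases 𝒟.rank_two s t hst with ⟨h, h', h''⟩ | ⟨h, h', h''⟩ | ⟨h, h', h''⟩ | ⟨h, h', h''⟩
    · simpa [h, CoxeterSystem.alternatingWord] using h2 s t h h' h''
    · simpa [h, CoxeterSystem.alternatingWord] using (h3 s t h h' h'').symm
    · simpa [h, CoxeterSystem.alternatingWord] using h4 s t h h' h''
    · simpa [h, CoxeterSystem.alternatingWord] using
        (h4 t s (by rw [M.symmetric]; exact h) h'' h').symm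

section Finite

variable [Finite W]

theorem ncard_lt {v w : W} (hlt : 𝒟.potential w < 𝒟.potential v) :
    {u | 𝒟.potential v < 𝒟.potential u}.ncard < {u | 𝒟.potential w < 𝒟.potential u}.ncard := by
  refine Set.ncard_lt_ncard (Set.ssubset_iff_of_subset (fun u hu => hlt.trans hu) |>.mpr ?_)
    (Set.toFinite _)
  exact ⟨v, hlt, lt_irrefl (𝒟.potential v)⟩

/-- Induction along left descents. -/
theorem descent_induction {P : W → Prop}
    (h : ∀ w, (∀ v, 𝒟.potential w < 𝒟.potential v → P v) → P w) (w : W) : P w := by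
  induction hn : {v | 𝒟.potential w < 𝒟.potential v}.ncard using Nat.strong_induction_on
    generalizing w with
  | _ n ih => exact h w fun v hv => ih _ (hn ▸ 𝒟.ncard_lt hv) v rfl

/-- Two elements with the same coordinates have the same descents, so the same generators carry both
to a dominant element, which must be 1. Relations in `W` can therefore be checked on coordinates. -/
theorem coord_injective : Function.Injective 𝒟.coord := by
  intro v
  induction v using 𝒟.descent_induction with
  | h v ih =>
    intro w hvw
    by_cases hv : ∃ i, 𝒟.coord v i < 0
    · obtain ⟨i, hi⟩ := hv
      refine mul_left_cancel (ih _ (𝒟.potential_lt v i hi) (a₂ := 𝒟.gen i * w) ?_)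
      funext j
      rw [𝒟.coord_gen_mul, 𝒟.coord_gen_mul, hvw]
    · push Not at hv
      have hv' : ∀ i, 0 < 𝒟.coord v i := fun i => lt_of_le_of_ne (hv i) (𝒟.coord_ne_zero v i).symm
      rw [𝒟.eq_one v hv', 𝒟.eq_one w (by rwa [← hvw])]

@[simp]
theorem gen_mul_gen_mul (i : B) (w : W) : 𝒟.gen i * (𝒟.gen i * w) = w := by
  apply 𝒟.coord_injective
  funext j
  simp only [𝒟.coord_gen_mul, 𝒟.cartan_self]
  ring

@[simp]
theorem gen_mul_self (i : B) : 𝒟.gen i * 𝒟.gen i = 1 := by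
  simpa using 𝒟.gen_mul_gen_mul i 1

@[simp]
theorem gen_inv (i : B) : (𝒟.gen i)⁻¹ = 𝒟.gen i :=
  inv_eq_of_mul_eq_one_left (𝒟.gen_mul_self i)

@[simp]
theorem mul_gen_mul_gen (w : W) (i : B) : w * 𝒟.gen i * 𝒟.gen i = w := by
  rw [mul_assoc, gen_mul_self, mul_one]

theorem satisfiesBraid_gen : SatisfiesBraid M 𝒟.gen := by
  -- The trailing factor 1 gives the last generator something to act on, so that `coord_gen_mul`
  -- unfolds the whole product.
  have key : ∀ v w : W, (∀ j, 𝒟.coord (v * 1) j = 𝒟.coord (w * 1) j) → v = w := fun v w h =>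
    𝒟.coord_injective (funext fun j => by simpa using h j)
  refine 𝒟.satisfiesBraid_of ?_ ?_ ?_ <;> intro s t _ hst hts <;> apply key <;> intro j <;>
    simp only [mul_assoc, 𝒟.coord_gen_mul, 𝒟.cartan_self, hst, hts] <;> ring

end Finite

open Classical in
/-- A reduced word, obtained by removing left descents one at a time. -/
def word [Finite W] (w : W) : List B :=
  if h : ∃ i, 𝒟.coord w i < 0 then h.choose :: word (𝒟.gen h.choose * w) else []
termination_by {v | 𝒟.potential w < 𝒟.potential v}.ncard
decreasing_by exact 𝒟.ncard_lt (𝒟.potential_lt _ _ h.choose_spec)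

section Finite

variable [Finite W]

theorem word_of_exists {w : W} (h : ∃ i, 𝒟.coord w i < 0) :
    ∃ i, 𝒟.coord w i < 0 ∧ 𝒟.word w = i :: 𝒟.word (𝒟.gen i * w) := by
  refine ⟨h.choose, h.choose_spec, ?_⟩
  rw [word, dif_pos h]

theorem word_of_not_exists {w : W} (h : ¬ ∃ i, 𝒟.coord w i < 0) : 𝒟.word w = [] := by
  rw [word, dif_neg h]

@[simp]
theorem word_one : 𝒟.word 1 = [] :=
  𝒟.word_of_not_exists fun ⟨i, hi⟩ => absurd (𝒟.coord_one_pos i) hi.not_gt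

/-- The product of a family of monoid elements along a reduced word of `w`. -/
def along {N : Type*} [Monoid N] (a : B → N) (w : W) : N := ((𝒟.word w).map a).prod

@[simp]
theorem along_one {N : Type*} [Monoid N] (a : B → N) : 𝒟.along a 1 = 1 := by simp [along]

/-- Matsumoto's theorem. -/
theorem along_eq_mul {N : Type*} [Monoid N] {a : B → N} (ha : SatisfiesBraid M a) {w : W} {i : B}
    (hi : 𝒟.coord w i < 0) : 𝒟.along a w = a i * 𝒟.along a (𝒟.gen i * w) := by
  induction w using 𝒟.descent_induction generalizing i with
  | h w ih =>
    -- The word of `w` starts with a descent `d` that need not be `i`. As both are descents, `w`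
    -- starts with the longest element of the dihedral group of `d` and `i`. The induction
    -- hypothesis peels off either of its two reduced words, the remainders agree by the braid
    -- relation in `W`, and the braid relation in `N` matches the letters.
    obtain ⟨d, hd, hw⟩ := 𝒟.word_of_exists ⟨i, hi⟩
    have hw' : 𝒟.along a w = a d * 𝒟.along a (𝒟.gen d * w) := by simp [along, hw]
    by_cases hdi : d = i
    · rw [hw', hdi]
    have g := 𝒟.satisfiesBraid_gen
    have four : ∀ s t, M s t = 4 → 𝒟.cartan s t = -1 → 𝒟.cartan t s = -2 → 𝒟.coord w s < 0 →
        𝒟.coord w t < 0 →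
        a s * 𝒟.along a (𝒟.gen s * w) = a t * 𝒟.along a (𝒟.gen t * w) := by
      intro s t h h1 h2 hs ht
      have hs' := 𝒟.potential_lt _ _ hs
      have ht' := 𝒟.potential_lt _ _ ht
      -- Each further letter of the dihedral word is a descent, since the coordinate in question is
      -- a nonnegative combination of `coord w s` and `coord w t`.
      have e1 : 𝒟.coord (𝒟.gen s * w) t < 0 := by
        simp only [𝒟.coord_gen_mul, h1]; linarith
      have e2 : 𝒟.coord (𝒟.gen t * (𝒟.gen s * w)) s < 0 := by
        simp only [𝒟.coord_gen_mul, h1, h2, 𝒟.cartan_self]; linarith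
      have e3 : 𝒟.coord (𝒟.gen s * (𝒟.gen t * (𝒟.gen s * w))) t < 0 := by
        simp only [𝒟.coord_gen_mul, h1, h2, 𝒟.cartan_self]; linarith
      have d1 : 𝒟.coord (𝒟.gen t * w) s < 0 := by
        simp only [𝒟.coord_gen_mul, h2]; linarith
      have d2 : 𝒟.coord (𝒟.gen s * (𝒟.gen t * w)) t < 0 := by
        simp only [𝒟.coord_gen_mul, h1, h2, 𝒟.cartan_self]; linarith
      have d3 : 𝒟.coord (𝒟.gen t * (𝒟.gen s * (𝒟.gen t * w))) s < 0 := by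
        simp only [𝒟.coord_gen_mul, h1, h2, 𝒟.cartan_self]; linarith
      have e1' := 𝒟.potential_lt _ _ e1
      have e2' := 𝒟.potential_lt _ _ e2
      have d1' := 𝒟.potential_lt _ _ d1
      have d2' := 𝒟.potential_lt _ _ d2
      rw [ih _ hs' e1, ih _ (hs'.trans e1') e2, ih _ ((hs'.trans e1').trans e2') e3,
        ih _ ht' d1, ih _ (ht'.trans d1') d2, ih _ ((ht'.trans d1').trans d2') d3]
      have ha4 := ha.four h
      have hg4 := congrArg (· * w) (g.four h)
      simp only [mul_assoc] at hg4
      rw [hg4]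
      simp only [← mul_assoc] at ha4 ⊢
      rw [ha4]
    have hd' := 𝒟.potential_lt _ _ hd
    have hi' := 𝒟.potential_lt _ _ hi
    rw [hw']
    rcases 𝒟.rank_two d i hdi with ⟨h, h1, h2⟩ | ⟨h, h1, h2⟩ | ⟨h, h1, h2⟩ | ⟨h, h1, h2⟩
    · rw [ih _ hd' (i := i) (by simp only [𝒟.coord_gen_mul, h1]; linarith),
        ih _ hi' (i := d) (by simp only [𝒟.coord_gen_mul, h2]; linarith)]
      simp only [← mul_assoc]
      rw [ha.two h, g.two h]
    · have e1 : 𝒟.coord (𝒟.gen d * w) i < 0 := by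
        simp only [𝒟.coord_gen_mul, h1]; linarith
      have e2 : 𝒟.coord (𝒟.gen i * (𝒟.gen d * w)) d < 0 := by
        simp only [𝒟.coord_gen_mul, h1, h2, 𝒟.cartan_self]; linarith
      have d1 : 𝒟.coord (𝒟.gen i * w) d < 0 := by
        simp only [𝒟.coord_gen_mul, h2]; linarith
      have d2 : 𝒟.coord (𝒟.gen d * (𝒟.gen i * w)) i < 0 := by
        simp only [𝒟.coord_gen_mul, h1, h2, 𝒟.cartan_self]; linarith
      rw [ih _ hd' e1, ih _ (hd'.trans (𝒟.potential_lt _ _ e1)) e2, ih _ hi' d1,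
        ih _ (hi'.trans (𝒟.potential_lt _ _ d1)) d2]
      have ha3 := ha.three h
      have hg3 := congrArg (· * w) (g.three h)
      simp only [mul_assoc] at hg3
      rw [hg3]
      simp only [← mul_assoc] at ha3 ⊢
      rw [ha3]
    · exact four d i h h1 h2 hd hi
    · exact (four i d (by rw [M.symmetric]; exact h) h2 h1 hi hd).symm

/-! ### Length -/

/-- The length of `w`. -/
def len (w : W) : ℕ := (𝒟.word w).length

@[simp]
theorem len_one : 𝒟.len 1 = 0 := by simp [len]

/-- Length is the product along the word of the constant family `ofAdd 1`. This family satisfies the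
braid relations, whose two sides have equally many factors, so Matsumoto's theorem applies to it. -/
theorem len_of_neg {w : W} {i : B} (hi : 𝒟.coord w i < 0) :
    𝒟.len w = 𝒟.len (𝒟.gen i * w) + 1 := by
  have h := 𝒟.along_eq_mul (a := fun _ : B => Multiplicative.ofAdd 1)
    (fun s t => by simp [CoxeterSystem.length_alternatingWord]) hi
  have key : ∀ w, 𝒟.along (fun _ : B => Multiplicative.ofAdd 1) w =
      Multiplicative.ofAdd (𝒟.len w) := by
    intro w
    simp [along, len, ← ofAdd_nsmul]
  rw [key, key, ← ofAdd_add] at h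
  have := Multiplicative.ofAdd.injective h
  omega

theorem len_of_not_neg {w : W} {i : B} (hi : ¬ 𝒟.coord w i < 0) :
    𝒟.len (𝒟.gen i * w) = 𝒟.len w + 1 := by
  simpa using 𝒟.len_of_neg (𝒟.coord_gen_mul_neg.mpr hi)

theorem word_prod (w : W) : ((𝒟.word w).map 𝒟.gen).prod = w := by
  induction w using 𝒟.descent_induction with
  | h w ih =>
    by_cases h : ∃ i, 𝒟.coord w i < 0
    · obtain ⟨i, hi, hw⟩ := 𝒟.word_of_exists h
      rw [hw, List.map_cons, List.prod_cons, ih _ (𝒟.potential_lt _ _ hi), gen_mul_gen_mul]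
    · rw [𝒟.word_of_not_exists h, 𝒟.eq_one w (fun i => ?_)]
      · simp
      · have := 𝒟.coord_ne_zero w i
        have h' := not_exists.mp h i
        omega

theorem len_gen_mul_le (i : B) (w : W) : 𝒟.len (𝒟.gen i * w) ≤ 𝒟.len w + 1 := by
  by_cases h : 𝒟.coord w i < 0
  · have := 𝒟.len_of_neg h
    omega
  · exact (𝒟.len_of_not_neg h).le

theorem len_prod_le (u : List B) : 𝒟.len (u.map 𝒟.gen).prod ≤ u.length := by
  induction u with
  | nil => simp
  | cons i u ih =>
    have := 𝒟.len_gen_mul_le i (u.map 𝒟.gen).prod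
    simp only [List.map_cons, List.prod_cons, List.length_cons]
    omega

theorem prod_reverse (u : List B) : (u.reverse.map 𝒟.gen).prod = (u.map 𝒟.gen).prod⁻¹ := by
  induction u with
  | nil => simp
  | cons i u ih =>
    simp only [List.reverse_cons, List.map_append, List.prod_append, ih]
    simp

theorem len_inv (w : W) : 𝒟.len w⁻¹ = 𝒟.len w := by
  have key : ∀ w, 𝒟.len w⁻¹ ≤ 𝒟.len w := by
    intro w
    have h := 𝒟.len_prod_le (𝒟.word w).reverse
    rwa [prod_reverse, word_prod, List.length_reverse] at h
  exact le_antisymm (key w) (by simpa using key w⁻¹)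

/-- A word is reduced if its length is the length of its product. -/
def IsReduced (u : List B) : Prop := 𝒟.len (u.map 𝒟.gen).prod = u.length

theorem isReduced_word (w : W) : 𝒟.IsReduced (𝒟.word w) := by
  rw [IsReduced, word_prod, len]

theorem IsReduced.cons {i : B} {u : List B} (h : 𝒟.IsReduced (i :: u)) :
    𝒟.IsReduced u ∧ ¬ 𝒟.coord (u.map 𝒟.gen).prod i < 0 := by
  have h1 := 𝒟.len_prod_le u
  simp only [IsReduced, List.map_cons, List.prod_cons, List.length_cons] at h ⊢
  have h3 : ¬ 𝒟.coord (u.map 𝒟.gen).prod i < 0 := fun hn => by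
    have := 𝒟.len_of_neg hn
    omega
  have := 𝒟.len_of_not_neg h3
  exact ⟨by omega, h3⟩

theorem IsReduced.prod_eq_along {N : Type*} [Monoid N] {a : B → N} (ha : SatisfiesBraid M a)
    {u : List B} (h : 𝒟.IsReduced u) : (u.map a).prod = 𝒟.along a (u.map 𝒟.gen).prod := by
  induction u with
  | nil => simp
  | cons i u ih =>
    obtain ⟨h1, h2⟩ := IsReduced.cons 𝒟 h
    have := 𝒟.along_eq_mul ha (𝒟.coord_gen_mul_neg.mpr h2)
    simp only [List.map_cons, List.prod_cons]
    rw [ih h1, this, gen_mul_gen_mul]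

theorem rdesc_mul_gen {w : W} {i : B} : 𝒟.rdesc (w * 𝒟.gen i) i ↔ ¬ 𝒟.rdesc w i := by
  rw [rdesc, mul_inv_rev, gen_inv, coord_gen_mul_neg, rdesc]

theorem len_of_rdesc {w : W} {i : B} (h : 𝒟.rdesc w i) : 𝒟.len w = 𝒟.len (w * 𝒟.gen i) + 1 := by
  rw [← len_inv, 𝒟.len_of_neg h, ← 𝒟.len_inv (w * _), mul_inv_rev, gen_inv]

theorem len_of_not_rdesc {w : W} {i : B} (h : ¬ 𝒟.rdesc w i) :
    𝒟.len (w * 𝒟.gen i) = 𝒟.len w + 1 := by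
  rw [← 𝒟.len_inv w, ← 𝒟.len_of_not_neg h, ← 𝒟.len_inv (w * _), mul_inv_rev, gen_inv]

/-- A reduced word of `w * gen i` followed by `i` has the right number of letters to be a reduced
word of `w`. -/
theorem along_eq_mul_of_rdesc {N : Type*} [Monoid N] {a : B → N} (ha : SatisfiesBraid M a) {w : W}
    {i : B} (h : 𝒟.rdesc w i) : 𝒟.along a w = 𝒟.along a (w * 𝒟.gen i) * a i := by
  have hr : 𝒟.IsReduced (𝒟.word (w * 𝒟.gen i) ++ [i]) := by
    rw [IsReduced]
    simp only [List.map_append, List.prod_append, word_prod, List.map_cons, List.map_nil,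
      List.prod_singleton, mul_gen_mul_gen, List.length_append, List.length_singleton]
    rw [𝒟.len_of_rdesc h]
    rfl
  have := IsReduced.prod_eq_along 𝒟 ha hr
  simp only [List.map_append, List.prod_append, word_prod, List.map_cons, List.map_nil,
      List.prod_singleton, mul_gen_mul_gen] at this
  rw [← this, along]

/-- Otherwise s_i w s_j would have length ℓ(w) + 2, although w s_j has length ℓ(w) - 1. This makes
conditions on right descents compatible with the left action of the 0-Hecke algebra. -/
theorem rdesc_gen_mul {w : W} {i j : B} (hi : ¬ 𝒟.coord w i < 0) (hj : 𝒟.rdesc w j) :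
    𝒟.rdesc (𝒟.gen i * w) j := by
  by_contra h
  have h1 := 𝒟.len_of_not_rdesc h
  have h2 := 𝒟.len_of_not_neg hi
  have h3 := 𝒟.len_of_rdesc hj
  have h4 := 𝒟.len_gen_mul_le i (w * 𝒟.gen j)
  rw [mul_assoc] at h1
  omega

/-! ### Parabolic subgroups -/

/-- The first letter of a reduced word is a left descent of its product, hence lies in `I`; removing
it stays in the parabolic subgroup. -/
theorem mem_of_reduced {I : Set B} {u : List B} (hr : 𝒟.IsReduced u)
    (hu : (u.map 𝒟.gen).prod ∈ 𝒟.par I) : ∀ i ∈ u, i ∈ I := by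
  induction u with
  | nil => simp
  | cons i u ih =>
    obtain ⟨h1, h2⟩ := IsReduced.cons 𝒟 hr
    have hi : i ∈ I := by
      by_contra hi
      have := 𝒟.coord_pos_of_mem I _ hu i hi
      rw [List.map_cons, List.prod_cons, 𝒟.coord_gen_mul_self] at this
      omega
    have hu' : (u.map 𝒟.gen).prod ∈ 𝒟.par I := by
      have := mul_mem (𝒟.gen_mem_par hi) hu
      rwa [List.map_cons, List.prod_cons, gen_mul_gen_mul] at this
    simpa [hi] using ih h1 hu'

theorem word_mem {I : Set B} {w : W} (hw : w ∈ 𝒟.par I) : ∀ i ∈ 𝒟.word w, i ∈ I :=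
  𝒟.mem_of_reduced (𝒟.isReduced_word w) (by rwa [word_prod])

theorem along_mem_closure {N : Type*} [Monoid N] (a : B → N) {I : Set B} {w : W}
    (hw : w ∈ 𝒟.par I) : 𝒟.along a w ∈ Submonoid.closure (a '' I) := by
  refine Submonoid.list_prod_mem _ fun x hx => ?_
  obtain ⟨i, hi, rfl⟩ := List.mem_map.mp hx
  exact Submonoid.subset_closure ⟨i, 𝒟.word_mem hw i hi, rfl⟩

/-- `w` is an element of maximal length of the parabolic subgroup of `I`. -/
def IsLongest (I : Set B) (w : W) : Prop := w ∈ 𝒟.par I ∧ ∀ v ∈ 𝒟.par I, 𝒟.len v ≤ 𝒟.len w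

theorem exists_isLongest (I : Set B) : ∃ w, 𝒟.IsLongest I w :=
  Set.exists_max_image (𝒟.par I : Set W) 𝒟.len (Set.toFinite _) ⟨1, one_mem _⟩

variable {𝒟} in
theorem IsLongest.coord_neg {I : Set B} {w : W} (h : 𝒟.IsLongest I w) {i : B} (hi : i ∈ I) :
    𝒟.coord w i < 0 := by
  by_contra hn
  have h1 := 𝒟.len_of_not_neg hn
  have h2 := h.2 _ (mul_mem (𝒟.gen_mem_par hi) h.1)
  omega

variable {𝒟} in
theorem IsLongest.rdesc {I : Set B} {w : W} (h : 𝒟.IsLongest I w) {i : B} :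
    𝒟.rdesc w i ↔ i ∈ I := by
  refine ⟨fun hn => by_contra fun hi => 𝒟.not_rdesc_of_mem_par h.1 hi hn, fun hi => ?_⟩
  by_contra hn
  have h1 := 𝒟.len_of_not_rdesc hn
  have h2 := h.2 _ (mul_mem h.1 (𝒟.gen_mem_par hi))
  omega

end Finite
end DescentSystem

/-! ### Products of generators of the 0-Hecke algebra -/

namespace ZeroHecke

variable {F : Type*} [Field F] {B : Type*} {M : CoxeterMatrix B}

theorem pi_eq (s : B) : pi F M s = pibar F M s + 1 := by simp [pibar]

theorem pibar_mul_self (s : B) : pibar F M s * pibar F M s = -pibar F M s := by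
  simp only [pibar, sub_mul, mul_sub, pi_mul_self]
  simp

theorem pibar_mul_pi (s : B) : pibar F M s * pi F M s = 0 := by
  simp [pibar, sub_mul, pi_mul_self]

/-- Induction on the algebra generated by the elements `π̄_s`. -/
theorem induction {P : ZeroHecke F M → Prop} (scalar : ∀ r, P (algebraMap F _ r))
    (gen : ∀ s, P (pibar F M s)) (mul : ∀ a b, P a → P b → P (a * b))
    (add : ∀ a b, P a → P b → P (a + b)) (a : ZeroHecke F M) : P a := by
  let q : FreeAlgebra F B →ₐ[F] ZeroHecke F M := RingQuot.mkAlgHom F (Rel F M)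
  obtain ⟨b, rfl⟩ : ∃ b, q b = a := RingQuot.mkAlgHom_surjective F (Rel F M) a
  induction b using FreeAlgebra.induction with
  | grade0 r => simpa using scalar r
  | grade1 s =>
    have h : q (FreeAlgebra.ι F s) = pibar F M s + algebraMap F _ 1 := by
      rw [map_one, ← pi_eq]
      rfl
    rw [h]
    exact add _ _ (gen s) (scalar 1)
  | mul a b ha hb => simpa using mul _ _ ha hb
  | add a b ha hb => simpa using add _ _ ha hb

theorem algHom_ext {A : Type*} [Ring A] [Algebra F A] {φ ψ : ZeroHecke F M →ₐ[F] A}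
    (h : ∀ s, φ (pibar F M s) = ψ (pibar F M s)) : φ = ψ := by
  ext a
  induction a using ZeroHecke.induction with
  | scalar r => simp
  | gen s => exact h s
  | mul a b ha hb => simp [ha, hb]
  | add a b ha hb => simp [ha, hb]

theorem satisfiesBraid_pi : SatisfiesBraid M (pi F M) := pi_braid F M

end ZeroHecke

namespace DescentSystem

open ZeroHecke

section Braid

variable {B : Type*} {M : CoxeterMatrix B} {W : Type*} [Group W]

/-- After expansion and use of idempotence the shorter monomials are the same on both sides, and the
longest ones agree by the braid relation. -/
theorem satisfiesBraid_one_sub (𝒟 : DescentSystem M W) {R : Type*} [Ring R] {a : B → R} (ha : SatisfiesBraid M a)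
    (hi : ∀ s, a s * a s = a s) : SatisfiesBraid M (fun s => 1 - a s) := by
  have hi' : ∀ s x, a s * (a s * x) = a s * x := fun s x => by rw [← mul_assoc, hi]
  refine 𝒟.satisfiesBraid_of ?_ ?_ ?_
  · intro s t h _ _
    simp only [mul_sub, sub_mul, one_mul, mul_one, ha.two h]
    abel
  · intro s t h _ _
    have h3 := ha.three h
    simp only [mul_sub, sub_mul, one_mul, mul_one, hi, h3]
    abel
  · intro s t h _ _
    have h4 := ha.four h
    simp only [mul_sub, sub_mul, one_mul, mul_one, hi, hi', h4]
    abel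

theorem satisfiesBraid_neg (𝒟 : DescentSystem M W) {R : Type*} [Ring R] {a : B → R} (ha : SatisfiesBraid M a) :
    SatisfiesBraid M (fun s => -a s) := by
  refine 𝒟.satisfiesBraid_of ?_ ?_ ?_ <;> intro s t h _ _
  · simp [ha.two h]
  · simp [ha.three h]
  · simp [ha.four h]

theorem satisfiesBraid_pibar (𝒟 : DescentSystem M W) (F : Type*) [Field F] : SatisfiesBraid M (pibar F M) := by
  have h := 𝒟.satisfiesBraid_neg (𝒟.satisfiesBraid_one_sub (satisfiesBraid_pi (F := F) (M := M))
    (pi_mul_self F M))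
  have e : (fun s => -(1 - pi F M s)) = pibar F M := by
    funext s
    simp [pibar]
  rwa [e] at h

end Braid

variable {B : Type*} {M : CoxeterMatrix B} {W : Type*} [Group W] (𝒟 : DescentSystem M W)

/-! ### The regular representation -/

open Classical in
/-- The Demazure action of a generator on the group. -/
def demazure (i : B) (w : W) : W := if 𝒟.coord w i < 0 then w else 𝒟.gen i * w

theorem demazure_of_neg {w : W} {i : B} (h : 𝒟.coord w i < 0) : 𝒟.demazure i w = w := if_pos h

theorem demazure_of_pos {w : W} {i : B} (h : 0 < 𝒟.coord w i) :
    𝒟.demazure i w = 𝒟.gen i * w := if_neg h.not_gt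

theorem coord_demazure_neg (w : W) (i : B) : 𝒟.coord (𝒟.demazure i w) i < 0 := by
  rcases (𝒟.coord_ne_zero w i).lt_or_gt with h | h
  · rwa [𝒟.demazure_of_neg h]
  · rw [𝒟.demazure_of_pos h, 𝒟.coord_gen_mul_self]
    omega

theorem demazure_idem (i : B) (w : W) : 𝒟.demazure i (𝒟.demazure i w) = 𝒟.demazure i w :=
  𝒟.demazure_of_neg (𝒟.coord_demazure_neg w i)

variable [Finite W]

/-- Both alternating products send `w` to the top of its coset under the dihedral group of `s` and
`t`. In each pattern of signs of the coordinates, the two sides agree by the relation in `W` or the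
pattern is impossible. -/
theorem satisfiesBraid_demazure : SatisfiesBraid (N := Function.End W) M 𝒟.demazure := by
  have g := 𝒟.satisfiesBraid_gen
  refine 𝒟.satisfiesBraid_of ?_ ?_ ?_
  · intro s t h h1 h2
    funext w
    have hs := 𝒟.coord_ne_zero w s
    have ht := 𝒟.coord_ne_zero w t
    have hg := congrArg (· * w) (g.two h)
    simp only [mul_assoc] at hg
    change 𝒟.demazure s (𝒟.demazure t w) = 𝒟.demazure t (𝒟.demazure s w)
    simp only [demazure]
    rcases hs.lt_or_gt with hs | hs <;> rcases ht.lt_or_gt with ht | ht <;>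
      simp [hs, ht, 𝒟.coord_gen_mul, h1, h2, hs.not_gt, ht.not_gt, hg]
  · intro s t h h1 h2
    funext w
    have hs := 𝒟.coord_ne_zero w s
    have ht := 𝒟.coord_ne_zero w t
    -- Nonvanishing of this mixed coordinate turns "not negative" into "positive" in the case split.
    have hst := 𝒟.coord_ne_zero (𝒟.gen s * w) t
    rw [𝒟.coord_gen_mul, h1] at hst
    have hg := congrArg (· * w) (g.three h)
    simp only [mul_assoc] at hg
    change 𝒟.demazure s (𝒟.demazure t (𝒟.demazure s w)) =
      𝒟.demazure t (𝒟.demazure s (𝒟.demazure t w))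
    simp only [demazure]
    split_ifs <;> first
      | rfl
      | exact hg
      | (exfalso; simp only [𝒟.coord_gen_mul, h1, h2, 𝒟.cartan_self] at *; omega)
  · intro s t h h1 h2
    funext w
    have hs := 𝒟.coord_ne_zero w s
    have ht := 𝒟.coord_ne_zero w t
    have hst := 𝒟.coord_ne_zero (𝒟.gen s * w) t
    have hts := 𝒟.coord_ne_zero (𝒟.gen t * w) s
    rw [𝒟.coord_gen_mul, h1] at hst
    rw [𝒟.coord_gen_mul, h2] at hts
    have hg := congrArg (· * w) (g.four h)
    simp only [mul_assoc] at hg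
    change 𝒟.demazure s (𝒟.demazure t (𝒟.demazure s (𝒟.demazure t w))) =
      𝒟.demazure t (𝒟.demazure s (𝒟.demazure t (𝒟.demazure s w)))
    simp only [demazure]
    split_ifs <;> first
      | rfl
      | exact hg
      | (exfalso; simp only [𝒟.coord_gen_mul, h1, h2, 𝒟.cartan_self] at *; omega)

end DescentSystem

namespace DescentSystem

open ZeroHecke

variable (F : Type*) [Field F] {B : Type*} {M : CoxeterMatrix B} {W : Type*} [Group W]
  (𝒟 : DescentSystem M W) [Finite W]

open Classical in
/-- The operator of `-π̄_i` on the regular representation. -/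
def negOp (i : B) : Module.End F (W →₀ F) :=
  Finsupp.linearCombination F fun w =>
    if 𝒟.coord w i < 0 then Finsupp.single w 1 else -Finsupp.single (𝒟.gen i * w) 1

/-- The operator is the Demazure action twisted by the parity of the change of length. These signs
telescope along products, so the relations of the Demazure action pass to the operators. -/
theorem negOp_single (i : B) (w : W) :
    𝒟.negOp F i (Finsupp.single w 1) = (-1 : F) ^ (𝒟.len w + 𝒟.len (𝒟.demazure i w)) •
      Finsupp.single (𝒟.demazure i w) 1 := by
  rw [negOp, Finsupp.linearCombination_single, one_smul]
  rcases (𝒟.coord_ne_zero w i).lt_or_gt with h | h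
  · rw [if_pos h, 𝒟.demazure_of_neg h, Even.neg_one_pow ⟨_, rfl⟩, one_smul]
  · rw [if_neg h.not_gt, 𝒟.demazure_of_pos h, 𝒟.len_of_not_neg h.not_gt, ← add_assoc,
      Odd.neg_one_pow ⟨𝒟.len w, by ring⟩, neg_one_smul]

theorem prod_negOp_single (u : List B) (w : W) :
    (u.map (𝒟.negOp F)).prod (Finsupp.single w 1) =
      (-1 : F) ^ (𝒟.len w + 𝒟.len ((u.map (β := Function.End W) 𝒟.demazure).prod w)) •
        Finsupp.single ((u.map (β := Function.End W) 𝒟.demazure).prod w) 1 := by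
  induction u with
  | nil =>
    change _ = (-1 : F) ^ (𝒟.len w + 𝒟.len w) • Finsupp.single w 1
    rw [Even.neg_one_pow ⟨_, rfl⟩, one_smul]
    rfl
  | cons i u ih =>
    simp only [List.map_cons, List.prod_cons, Module.End.mul_apply]
    rw [ih, map_smul, negOp_single, smul_smul, ← pow_add]
    change _ = (-1 : F) ^ (𝒟.len w + 𝒟.len (𝒟.demazure i
      ((u.map (β := Function.End W) 𝒟.demazure).prod w))) • Finsupp.single (𝒟.demazure i
      ((u.map (β := Function.End W) 𝒟.demazure).prod w)) 1
    congr 1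
    generalize 𝒟.len ((u.map (β := Function.End W) 𝒟.demazure).prod w) = x
    rw [show 𝒟.len w + x + (x + 𝒟.len (𝒟.demazure i
      ((u.map (β := Function.End W) 𝒟.demazure).prod w))) = (𝒟.len w + 𝒟.len (𝒟.demazure i
      ((u.map (β := Function.End W) 𝒟.demazure).prod w))) + (x + x) by ring, pow_add _ _ (x + x),
      Even.neg_one_pow ⟨x, rfl⟩, mul_one]

theorem satisfiesBraid_negOp : SatisfiesBraid M (𝒟.negOp F) := by
  intro s t
  refine Finsupp.lhom_ext' fun w => LinearMap.ext_ring ?_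
  simp only [LinearMap.comp_apply, Finsupp.lsingle_apply]
  rw [prod_negOp_single, prod_negOp_single, 𝒟.satisfiesBraid_demazure s t]

theorem negOp_mul_self (i : B) : 𝒟.negOp F i * 𝒟.negOp F i = 𝒟.negOp F i := by
  refine Finsupp.lhom_ext' fun w => LinearMap.ext_ring ?_
  simp only [LinearMap.comp_apply, Finsupp.lsingle_apply, Module.End.mul_apply]
  rw [negOp_single, map_smul, negOp_single, demazure_idem, Even.neg_one_pow (n := _ + 𝒟.len _)
    ⟨_, rfl⟩, one_smul]

variable {F} in
omit [Finite W] in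
/-- The homomorphism `π̄_i ↦ -a_i` for idempotents `a_i` that satisfy the braid relations. -/
def liftNeg {A : Type*} [Ring A] [Algebra F A] (𝒟 : DescentSystem M W) (a : B → A)
    (ha : SatisfiesBraid M a) (hi : ∀ i, a i * a i = a i) : ZeroHecke F M →ₐ[F] A :=
  ZeroHecke.lift M (fun i => 1 - a i)
    (fun i => by
      simp [mul_sub, sub_mul, hi])
    (𝒟.satisfiesBraid_one_sub ha hi).prod_eq

variable {F} in
omit [Finite W] in
theorem liftNeg_pibar {A : Type*} [Ring A] [Algebra F A] (a : B → A)
    (ha : SatisfiesBraid M a) (hi : ∀ i, a i * a i = a i) (i : B) :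
    𝒟.liftNeg a ha hi (pibar F M i) = -a i := by
  rw [pibar, map_sub, liftNeg, lift_pi, map_one]
  abel

/-- The regular representation on the vector space with basis `W`. -/
def regRep : ZeroHecke F M →ₐ[F] Module.End F (W →₀ F) :=
  𝒟.liftNeg (𝒟.negOp F) (𝒟.satisfiesBraid_negOp F) (𝒟.negOp_mul_self F)

theorem regRep_pibar (i : B) : 𝒟.regRep F (pibar F M i) = -𝒟.negOp F i :=
  𝒟.liftNeg_pibar _ _ _ i

variable {F}

theorem regRep_of_neg {w : W} {i : B} (h : 𝒟.coord w i < 0) :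
    𝒟.regRep F (pibar F M i) (Finsupp.single w 1) = -Finsupp.single w 1 := by
  simp [regRep_pibar, negOp, h]

theorem regRep_of_not_neg {w : W} {i : B} (h : ¬ 𝒟.coord w i < 0) :
    𝒟.regRep F (pibar F M i) (Finsupp.single w 1) = Finsupp.single (𝒟.gen i * w) 1 := by
  simp [regRep_pibar, negOp, h]

variable (F)

/-- The element `π̄_w`. -/
def pibarOf (w : W) : ZeroHecke F M := 𝒟.along (pibar F M) w

@[simp]
theorem pibarOf_one : 𝒟.pibarOf F 1 = 1 := 𝒟.along_one _

theorem pibarOf_of_neg {w : W} {i : B} (h : 𝒟.coord w i < 0) :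
    𝒟.pibarOf F w = pibar F M i * 𝒟.pibarOf F (𝒟.gen i * w) :=
  𝒟.along_eq_mul (𝒟.satisfiesBraid_pibar F) h

theorem pibar_mul_of_neg {w : W} {i : B} (h : 𝒟.coord w i < 0) :
    pibar F M i * 𝒟.pibarOf F w = -𝒟.pibarOf F w := by
  rw [𝒟.pibarOf_of_neg F h, ← mul_assoc, pibar_mul_self, neg_mul]

theorem pibar_mul_of_not_neg {w : W} {i : B} (h : ¬ 𝒟.coord w i < 0) :
    pibar F M i * 𝒟.pibarOf F w = 𝒟.pibarOf F (𝒟.gen i * w) := by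
  rw [𝒟.pibarOf_of_neg F (𝒟.coord_gen_mul_neg.mpr h), gen_mul_gen_mul]

theorem pibarOf_of_rdesc {w : W} {i : B} (h : 𝒟.rdesc w i) :
    𝒟.pibarOf F w = 𝒟.pibarOf F (w * 𝒟.gen i) * pibar F M i :=
  𝒟.along_eq_mul_of_rdesc (𝒟.satisfiesBraid_pibar F) h

theorem pibarOf_mul_of_rdesc {w : W} {i : B} (h : 𝒟.rdesc w i) :
    𝒟.pibarOf F w * pibar F M i = -𝒟.pibarOf F w := by
  rw [𝒟.pibarOf_of_rdesc F h, mul_assoc, pibar_mul_self, mul_neg]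

theorem pibarOf_mul_of_not_rdesc {w : W} {i : B} (h : ¬ 𝒟.rdesc w i) :
    𝒟.pibarOf F w * pibar F M i = 𝒟.pibarOf F (w * 𝒟.gen i) := by
  rw [𝒟.pibarOf_of_rdesc F (𝒟.rdesc_mul_gen.mpr h), mul_gen_mul_gen]

/-- Along a reduced word every letter moves the basis vector up by one step. This gives the linear
independence of the elements π̄_w. -/
theorem regRep_pibarOf (w : W) :
    𝒟.regRep F (𝒟.pibarOf F w) (Finsupp.single 1 1) = Finsupp.single w 1 := by
  induction w using 𝒟.descent_induction with
  | h w ih =>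
    by_cases h : ∃ i, 𝒟.coord w i < 0
    · obtain ⟨i, hi⟩ := h
      rw [𝒟.pibarOf_of_neg F hi, map_mul, Module.End.mul_apply, ih _ (𝒟.potential_lt _ _ hi),
        𝒟.regRep_of_not_neg (by rw [𝒟.coord_gen_mul_neg]; simpa using hi), gen_mul_gen_mul]
    · have : w = 1 := by
        rw [← 𝒟.word_prod w, 𝒟.word_of_not_exists h]
        simp
      simp [this]

/-- The rules for π̄_i π̄_w are those of the regular representation. So the span of the π̄_w is a
left ideal containing 1, that is, the whole algebra. -/
theorem linearCombination_pibarOf_mul (h : ZeroHecke F M) (x : W →₀ F) :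
    Finsupp.linearCombination F (𝒟.pibarOf F) (𝒟.regRep F h x) =
      h * Finsupp.linearCombination F (𝒟.pibarOf F) x := by
  induction h using ZeroHecke.induction generalizing x with
  | scalar r => simp [Algebra.smul_def]
  | gen i =>
    induction x using Finsupp.induction_linear with
    | zero => simp
    | add x y hx hy => simp [hx, hy, mul_add]
    | single w r =>
      rw [← mul_one r, ← smul_eq_mul, ← Finsupp.smul_single, map_smul, map_smul, map_smul,
        mul_smul_comm]
      by_cases h : 𝒟.coord w i < 0
      · simp [𝒟.regRep_of_neg h, 𝒟.pibar_mul_of_neg F h]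
      · simp [𝒟.regRep_of_not_neg h, 𝒟.pibar_mul_of_not_neg F h]
  | mul a b ha hb => simp [ha, hb, mul_assoc]
  | add a b ha hb => simp [ha, hb, add_mul]

/-- The 0-Hecke algebra has the basis `π̄_w`. -/
def basisEquiv : (W →₀ F) ≃ₗ[F] ZeroHecke F M :=
  LinearEquiv.ofLinearMap (Finsupp.linearCombination F (𝒟.pibarOf F))
    ((LinearMap.applyₗ (Finsupp.single 1 1)).comp (𝒟.regRep F).toLinearMap)
    (by
      ext h
      have := 𝒟.linearCombination_pibarOf_mul F h (Finsupp.single 1 1)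
      simpa using this)
    (by
      refine Finsupp.lhom_ext' fun w => LinearMap.ext_ring ?_
      simp [regRep_pibarOf])

theorem basisEquiv_single (w : W) : 𝒟.basisEquiv F (Finsupp.single w 1) = 𝒟.pibarOf F w := by
  simp [basisEquiv]

/-! ### Representations on convex sets -/

/-- Sets that are closed under the passage to `s_i w` if `i` is not a left descent of `w`. -/
def IsUpper (U : Set W) : Prop := ∀ w ∈ U, ∀ i, ¬ 𝒟.coord w i < 0 → 𝒟.gen i * w ∈ U

variable {F}

variable {𝒟} in
theorem IsUpper.regRep_mem {U : Set W} (hU : 𝒟.IsUpper U) (h : ZeroHecke F M) {x : W →₀ F}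
    (hx : x ∈ Finsupp.supported F F U) : 𝒟.regRep F h x ∈ Finsupp.supported F F U := by
  induction h using ZeroHecke.induction generalizing x with
  | scalar r => simpa using Submodule.smul_mem _ r hx
  | gen i =>
    rw [Finsupp.supported_eq_span_single] at hx
    induction hx using Submodule.span_induction with
    | mem y hy =>
      obtain ⟨w, hw, rfl⟩ := hy
      by_cases h : 𝒟.coord w i < 0
      · rw [𝒟.regRep_of_neg h]
        exact neg_mem (Finsupp.single_mem_supported F 1 hw)
      · rw [𝒟.regRep_of_not_neg h]
        exact Finsupp.single_mem_supported F 1 (hU w hw i h)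
    | zero => simp
    | add y z _ _ hy hz => rw [map_add]; exact add_mem hy hz
    | smul r y _ hy => rw [map_smul]; exact Submodule.smul_mem _ r hy
  | mul a b ha hb =>
    rw [map_mul]
    exact ha (hb hx)
  | add a b ha hb => simpa using add_mem (ha hx) (hb hx)

variable (F)

/-- The inclusion of the space with basis `X` in the regular representation. -/
def incl (X : Set W) : (X →₀ F) →ₗ[F] (W →₀ F) := Finsupp.lmapDomain F F Subtype.val

/-- The projection of the regular representation onto the space with basis `X`. -/
def proj (X : Set W) : (W →₀ F) →ₗ[F] (X →₀ F) := Finsupp.lsubtypeDomain X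

omit [Group W] [Finite W]

@[simp]
theorem incl_single (X : Set W) (w : X) (r : F) :
    incl F X (Finsupp.single w r) = Finsupp.single w.1 r := by simp [incl]

@[simp]
theorem proj_incl (X : Set W) (x : X →₀ F) : proj F X (incl F X x) = x := by
  induction x using Finsupp.induction_linear with
  | zero => simp
  | add x y hx hy => simp [hx, hy]
  | single w r =>
    ext v
    rw [incl_single]
    exact Finsupp.single_apply_left Subtype.val_injective w v r

theorem incl_mem (X : Set W) (x : X →₀ F) : incl F X x ∈ Finsupp.supported F F X := by
  induction x using Finsupp.induction_linear with
  | zero => simp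
  | add x y hx hy => rw [map_add]; exact add_mem hx hy
  | single w r =>
    rw [incl_single]
    exact Finsupp.single_mem_supported F r w.2

theorem proj_single_of_mem {X : Set W} {w : W} (h : w ∈ X) (r : F) :
    proj F X (Finsupp.single w r) = Finsupp.single ⟨w, h⟩ r := by
  simpa using proj_incl F X (Finsupp.single ⟨w, h⟩ r)

variable {F} in
theorem proj_of_disjoint {X Y : Set W} (h : Disjoint X Y) {x : W →₀ F}
    (hx : x ∈ Finsupp.supported F F Y) : proj F X x = 0 := by
  ext v
  change x v.1 = 0
  by_contra hn
  exact Set.disjoint_left.mp h v.2 (hx (Finsupp.mem_support_iff.mpr hn))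

theorem proj_single_of_notMem {X : Set W} {w : W} (h : w ∉ X) (r : F) :
    proj F X (Finsupp.single w r) = 0 :=
  proj_of_disjoint (Set.disjoint_singleton_right.mpr h)
    (Finsupp.single_mem_supported F r (Set.mem_singleton w))

variable {F} in
theorem sub_incl_proj_mem {U V : Set W} {x : W →₀ F} (hx : x ∈ Finsupp.supported F F U) :
    x - incl F (U \ V) (proj F (U \ V) x) ∈ Finsupp.supported F F V := by
  rw [Finsupp.supported_eq_span_single] at hx
  induction hx using Submodule.span_induction with
  | mem y hy =>
    obtain ⟨w, hw, rfl⟩ := hy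
    by_cases h : w ∈ V
    · rw [proj_single_of_notMem F (by simp [h]), map_zero, sub_zero]
      exact Finsupp.single_mem_supported F 1 h
    · rw [proj_single_of_mem F (show w ∈ U \ V from ⟨hw, h⟩)]
      simp
  | zero => simp
  | add y z _ _ hy hz =>
    simp only [map_add, add_sub_add_comm]
    exact add_mem hy hz
  | smul r y _ hy =>
    simp only [map_smul, ← smul_sub]
    exact Submodule.smul_mem _ r hy

end DescentSystem

namespace DescentSystem

open ZeroHecke

variable (F : Type*) [Field F] {B : Type*} {M : CoxeterMatrix B} {W : Type*} [Group W]
  {𝒟 : DescentSystem M W} [Finite W]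

theorem basisEquiv_regRep (h : ZeroHecke F M) (x : W →₀ F) :
    𝒟.basisEquiv F (𝒟.regRep F h x) = h * 𝒟.basisEquiv F x :=
  𝒟.linearCombination_pibarOf_mul F h x

section Convex

variable {U V : Set W} (hU : 𝒟.IsUpper U) (hV : 𝒟.IsUpper V)

/-- The representation on the space with basis `U \ V`, where `U` and `V` are upper sets. -/
def convRep : ZeroHecke F M →ₐ[F] Module.End F ((U \ V : Set W) →₀ F) :=
  AlgHom.ofLinearMap
    { toFun := fun h => proj F (U \ V) ∘ₗ 𝒟.regRep F h ∘ₗ incl F (U \ V)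
      map_add' := fun a b => by
        rw [map_add, LinearMap.add_comp, LinearMap.comp_add]
      map_smul' := fun r a => by
        rw [map_smul, LinearMap.smul_comp, LinearMap.comp_smul, RingHom.id_apply] }
    (by
      refine LinearMap.ext fun x => ?_
      simp)
    -- Cutting `b · x` down to `U \ V` discards a vector in the span of `V`. The action of `a` keeps
    -- it there and the projection kills it, so the compressed action is multiplicative.
    (fun a b => by
      refine LinearMap.ext fun x => ?_
      have h1 : 𝒟.regRep F b (incl F (U \ V) x) ∈ Finsupp.supported F F U :=
        hU.regRep_mem b (Finsupp.supported_mono Set.sdiff_subset (incl_mem F _ x))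
      have h2 := hV.regRep_mem a (sub_incl_proj_mem (V := V) h1)
      have h3 := proj_of_disjoint (X := U \ V) Set.disjoint_sdiff_left h2
      rw [map_sub, map_sub, sub_eq_zero] at h3
      simpa using h3)

theorem convRep_apply (h : ZeroHecke F M) (x : (U \ V : Set W) →₀ F) :
    convRep F hU hV h x = proj F (U \ V) (𝒟.regRep F h (incl F (U \ V) x)) := rfl

theorem regRep_sub_convRep_mem (h : ZeroHecke F M) (x : (U \ V : Set W) →₀ F) :
    𝒟.regRep F h (incl F (U \ V) x) - incl F (U \ V) (convRep F hU hV h x) ∈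
      Finsupp.supported F F V :=
  sub_incl_proj_mem (hU.regRep_mem h (Finsupp.supported_mono Set.sdiff_subset (incl_mem F _ x)))

variable {w : (U \ V : Set W)} {i : B}

theorem convRep_of_neg (h : 𝒟.coord w i < 0) :
    convRep F hU hV (pibar F M i) (Finsupp.single w 1) = -Finsupp.single w 1 := by
  rw [convRep_apply, incl_single, regRep_of_neg 𝒟 h, map_neg, proj_single_of_mem F w.2]

theorem convRep_of_mem (h : ¬ 𝒟.coord w i < 0) (hm : 𝒟.gen i * w.1 ∈ U \ V) :
    convRep F hU hV (pibar F M i) (Finsupp.single w 1) = Finsupp.single ⟨_, hm⟩ 1 := by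
  rw [convRep_apply, incl_single, regRep_of_not_neg 𝒟 h, proj_single_of_mem F hm]

theorem convRep_of_notMem (h : ¬ 𝒟.coord w i < 0) (hm : 𝒟.gen i * w.1 ∉ U \ V) :
    convRep F hU hV (pibar F M i) (Finsupp.single w 1) = 0 := by
  rw [convRep_apply, incl_single, regRep_of_not_neg 𝒟 h, proj_single_of_notMem F hm]

variable {F}

variable (U V) in
/-- The map `w ↦ π̄_w p`. -/
def toHecke (𝒟 : DescentSystem M W) (p : ZeroHecke F M) :
    ((U \ V : Set W) →₀ F) →ₗ[F] ZeroHecke F M :=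
  LinearMap.mulRight F p ∘ₗ (𝒟.basisEquiv F).toLinearMap ∘ₗ incl F (U \ V)

theorem toHecke_apply (p : ZeroHecke F M) (x : (U \ V : Set W) →₀ F) :
    toHecke U V 𝒟 p x = 𝒟.basisEquiv F (incl F (U \ V) x) * p := rfl

theorem toHecke_single (p : ZeroHecke F M) (w : (U \ V : Set W)) :
    toHecke U V 𝒟 p (Finsupp.single w 1) = 𝒟.pibarOf F w.1 * p := by
  rw [toHecke_apply, incl_single, basisEquiv_single]

/-- Right multiplication by `p` kills precisely the kind of vectors that the passage to `U \ V`
discards. -/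
theorem toHecke_convRep {p : ZeroHecke F M} (hp : ∀ w ∈ V, 𝒟.pibarOf F w * p = 0)
    (h : ZeroHecke F M) (x : (U \ V : Set W) →₀ F) :
    toHecke U V 𝒟 p (convRep F hU hV h x) = h * toHecke U V 𝒟 p x := by
  have key : ∀ y ∈ Finsupp.supported F F V, 𝒟.basisEquiv F y * p = 0 := by
    intro y hy
    rw [Finsupp.supported_eq_span_single] at hy
    induction hy using Submodule.span_induction with
    | mem y hy =>
      obtain ⟨w, hw, rfl⟩ := hy
      rw [basisEquiv_single, hp w hw]
    | zero => simp
    | add y z _ _ hy hz => rw [map_add, add_mul, hy, hz, add_zero]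
    | smul r y _ hy => rw [map_smul, smul_mul_assoc, hy, smul_zero]
  have h1 := key _ (regRep_sub_convRep_mem F hU hV h x)
  rw [map_sub, sub_mul, sub_eq_zero, basisEquiv_regRep] at h1
  rw [toHecke_apply, toHecke_apply, ← h1, mul_assoc]

/-- Since `p` fixes the basis vector 1 modulo the span of `V`, the element π̄_w p sends it to `w`
modulo that span. Projection to `U \ V` recovers `w`. -/
theorem toHecke_injective {p : ZeroHecke F M}
    (hp : 𝒟.regRep F p (Finsupp.single 1 1) - Finsupp.single 1 1 ∈ Finsupp.supported F F V)
    (hV : 𝒟.IsUpper V) : Function.Injective (toHecke U V 𝒟 p) := by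
  refine Function.LeftInverse.injective
    (g := fun h => proj F (U \ V) (𝒟.regRep F h (Finsupp.single 1 1))) fun x => ?_
  have h1 := proj_of_disjoint (X := U \ V) Set.disjoint_sdiff_left
    (hV.regRep_mem (𝒟.basisEquiv F (incl F (U \ V) x)) hp)
  rw [map_sub, map_sub, sub_eq_zero] at h1
  simp only [toHecke_apply, map_mul, Module.End.mul_apply]
  rw [h1]
  have h2 : 𝒟.regRep F (𝒟.basisEquiv F (incl F (U \ V) x)) (Finsupp.single 1 1) =
      incl F (U \ V) x := by
    apply (𝒟.basisEquiv F).injective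
    rw [basisEquiv_regRep, basisEquiv_single, pibarOf_one, mul_one]
  rw [h2, proj_incl]

end Convex

/-! ### Descent classes -/

variable (𝒟) in
/-- Group elements all of whose right descents include `I`. -/
def descAbove (I : Set B) : Set W := {w | ∀ i ∈ I, 𝒟.rdesc w i}

variable (𝒟) in
/-- Group elements with a right descent in `K`. -/
def descMeet (K : Set B) : Set W := {w | ∃ k ∈ K, 𝒟.rdesc w k}

theorem isUpper_descAbove (I : Set B) : 𝒟.IsUpper (𝒟.descAbove I) :=
  fun _ hw _ hi j hj => 𝒟.rdesc_gen_mul hi (hw j hj)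

theorem isUpper_descMeet (K : Set B) : 𝒟.IsUpper (𝒟.descMeet K) :=
  fun _ ⟨j, hj, hw⟩ _ hi => ⟨j, hj, 𝒟.rdesc_gen_mul hi hw⟩

variable (𝒟) in
/-- Group elements whose right descents in `J` form the set `I`, for `I ⊆ J`. -/
abbrev descClass (I J : Set B) : Set W := 𝒟.descAbove I \ 𝒟.descMeet (J \ I)

omit [Finite W] in
theorem mem_descClass {I J : Set B} (h : I ⊆ J) {w : W} :
    w ∈ 𝒟.descClass I J ↔ ∀ j ∈ J, 𝒟.rdesc w j ↔ j ∈ I := by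
  constructor
  · rintro ⟨h1, h2⟩ j hj
    exact ⟨fun hw => by_contra fun hi => h2 ⟨j, ⟨hj, hi⟩, hw⟩, fun hi => h1 j hi⟩
  · exact fun h' => ⟨fun i hi => (h' i (h hi)).mpr hi,
      fun ⟨j, hj, hw⟩ => hj.2 ((h' j hj.1).mp hw)⟩

variable (𝒟) in
/-- The representation on the space with basis the descent class of `I` and `J`. -/
def descRep (I J : Set B) : ZeroHecke F M →ₐ[F] Module.End F (𝒟.descClass I J →₀ F) :=
  convRep F (isUpper_descAbove I) (isUpper_descMeet (J \ I))

end DescentSystem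

/-! ### Left ideals as models of representations -/

/-- An intertwiner from a representation to the left ideal generated by `g`, with `g` in its
range. -/
structure IdealModel {F R V : Type*} [Field F] [Ring R] [Algebra F R] [AddCommGroup V] [Module F V]
    (ρ : R →ₐ[F] Module.End F V) (g : R) where
  emb : V →ₗ[F] R
  emb_rep : ∀ h v, emb (ρ h v) = h * emb v
  emb_mem : ∀ v, ∃ a, emb v = a * g
  gen : V
  emb_gen : emb gen = g

namespace IdealModel

variable {F R V : Type*} [Field F] [Ring R] [Algebra F R] [AddCommGroup V] [Module F V]
  {ρ : R →ₐ[F] Module.End F V} {g : R} (m : IdealModel ρ g)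

/-- The intertwiner as a homomorphism of modules. -/
def toHom : ModuleOf ρ →ₗ[R] R where
  toFun := m.emb
  map_add' := m.emb.map_add
  map_smul' := m.emb_rep

theorem range_toHom : LinearMap.range m.toHom = Submodule.span R {g} := by
  apply le_antisymm
  · rintro _ ⟨v, rfl⟩
    obtain ⟨a, ha⟩ := m.emb_mem v
    exact Submodule.mem_span_singleton.mpr ⟨a, ha.symm⟩
  · rw [Submodule.span_singleton_le_iff_mem]
    exact ⟨m.gen, m.emb_gen⟩

/-- A representation that embeds is isomorphic to the left ideal. -/
def equiv (hm : Function.Injective m.emb) : ModuleOf ρ ≃ₗ[R] Submodule.span R {g} :=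
  (LinearEquiv.ofInjective m.toHom hm).trans (LinearEquiv.ofEq _ _ m.range_toHom)

end IdealModel

/-- A model together with the image `e` of `1` under a retraction of the algebra onto the
representation. -/
structure SplitModel {F R V : Type*} [Field F] [Ring R] [Algebra F R] [AddCommGroup V] [Module F V]
    (ρ : R →ₐ[F] Module.End F V) (g : R) extends IdealModel ρ g where
  unit : V
  rep_emb : ∀ v, ρ (emb v) unit = v

namespace SplitModel

variable {F R V : Type*} [Field F] [Ring R] [Algebra F R] [AddCommGroup V] [Module F V]
  {ρ : R →ₐ[F] Module.End F V} {g : R}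

theorem injective (m : SplitModel ρ g) : Function.Injective m.emb :=
  Function.LeftInverse.injective (g := fun h => ρ h m.unit) m.rep_emb

/-- The element `emb unit` is an idempotent generator of the left ideal: for `y = emb v`, the
product is `emb (ρ y unit) = emb v`. -/
theorem mul_emb_unit (m : SplitModel ρ g) {y : R} (hy : y ∈ Submodule.span R {g}) :
    y * m.emb m.unit = y := by
  obtain ⟨v, rfl⟩ := (SetLike.ext_iff.mp m.range_toHom y).mpr hy
  exact (m.emb_rep _ _).symm.trans (congrArg m.emb (m.rep_emb v))

/-- The map `a ↦ a · unit` splits the embedding into the algebra. -/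
theorem projective (m : SplitModel ρ g) : Module.Projective R (ModuleOf ρ) :=
  Module.Projective.of_split m.toHom
    (LinearMap.toSpanSingleton R (ModuleOf ρ) (m.unit : ModuleOf ρ))
    (LinearMap.ext fun v => m.rep_emb v)

end SplitModel

/-- An endomorphism that is unitriangular with respect to a grading of a finite basis is
bijective. -/
theorem bijective_of_unitriangular {F X : Type*} [Field F] [Finite X] (deg : X → ℕ)
    (G : Module.End F (X →₀ F))
    (hG : ∀ w, G (Finsupp.single w 1) - Finsupp.single w 1 ∈
      Finsupp.supported F F {v | deg w < deg v}) : Function.Bijective G := by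
  have hs : ∀ w, Finsupp.single w 1 ∈ LinearMap.range G := by
    obtain ⟨N, hN⟩ := (Set.finite_range deg).bddAbove
    intro w
    -- Descending induction on the degree: the correction terms have larger degree and are already
    -- in the range.
    induction hk : N - deg w using Nat.strong_induction_on generalizing w with
    | _ k ih =>
      have h1 : Finsupp.supported F F {v | deg w < deg v} ≤ LinearMap.range G := by
        rw [Finsupp.supported_eq_span_single, Submodule.span_le]
        rintro _ ⟨v, hv, rfl⟩
        have hv' : deg v ≤ N := hN ⟨v, rfl⟩
        have hv'' : deg w < deg v := hv
        exact ih _ (by omega) v rfl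
      have h2 := sub_mem (LinearMap.mem_range_self G (Finsupp.single w 1)) (h1 (hG w))
      rwa [sub_sub_cancel] at h2
  have hsurj : Function.Surjective G := by
    rw [← LinearMap.range_eq_top, eq_top_iff]
    rintro x -
    induction x using Finsupp.induction_linear with
    | zero => exact zero_mem _
    | add x y hx hy => exact add_mem hx hy
    | single w r => simpa using Submodule.smul_mem _ r (hs w)
  exact ⟨LinearMap.injective_iff_surjective.mpr hsurj, hsurj⟩

/-! ### Recognising π_w and π̄_w for longest elements of parabolic subgroups -/

namespace ZeroHecke

variable {F : Type*} [Field F] {B : Type*} {M : CoxeterMatrix B}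

/-- The properties of the element `π_w` for `w` the longest element of the parabolic subgroup
of `K`. -/
structure IsPiTop (K : Set B) (p : ZeroHecke F M) : Prop where
  mem : p ∈ Submonoid.closure (pi F M '' K)
  left : ∀ k ∈ K, pi F M k * p = p
  right : ∀ k ∈ K, p * pi F M k = p

/-- The properties of the element `π̄_w` for `w` the longest element of the parabolic subgroup
of `I`. -/
structure IsPibarTop (I : Set B) (z : ZeroHecke F M) : Prop where
  mem : z ∈ Submonoid.closure (pibar F M '' I)
  left : ∀ i ∈ I, pibar F M i * z = -z
  right : ∀ i ∈ I, z * pibar F M i = -z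

/-- The product `p * q` is `q` when the letters of `p` are absorbed one by one, and `p` when those
of `q` are. Thus the element is recognised without comparing reduced words. -/
theorem IsPiTop.eq {K : Set B} {p q : ZeroHecke F M} (hp : IsPiTop K p) (hq : IsPiTop K q) :
    p = q := by
  have h1 : ∀ a ∈ Submonoid.closure (pi F M '' K), a * q = q ∧ p * a = p := by
    intro a ha
    induction ha using Submonoid.closure_induction with
    | mem x hx =>
      obtain ⟨k, hk, rfl⟩ := hx
      exact ⟨hq.left k hk, hp.right k hk⟩
    | one => simp
    | mul a b _ _ ha hb =>
      exact ⟨by rw [mul_assoc, hb.1, ha.1], by rw [← mul_assoc, ha.2, hb.2]⟩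
  rw [← (h1 p hp.mem).1, (h1 q hq.mem).2]

/-- As for `IsPiTop.eq`, but every absorbed letter costs a sign and the number of letters is not
controlled. The ambiguity does not affect left ideals. -/
theorem IsPibarTop.eq_or_eq_neg {I : Set B} {y z : ZeroHecke F M} (hy : IsPibarTop I y)
    (hz : IsPibarTop I z) : y = z ∨ y = -z := by
  have h1 : ∀ a ∈ Submonoid.closure (pibar F M '' I),
      (a * z = z ∨ a * z = -z) ∧ (y * a = y ∨ y * a = -y) := by
    intro a ha
    induction ha using Submonoid.closure_induction with
    | mem x hx =>
      obtain ⟨k, hk, rfl⟩ := hx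
      exact ⟨Or.inr (hz.left k hk), Or.inr (hy.right k hk)⟩
    | one => simp
    | mul a b _ _ ha hb =>
      constructor
      · rcases hb.1 with h | h <;> rcases ha.1 with h' | h' <;> simp [mul_assoc, h, h']
      · rcases ha.2 with h | h <;> rcases hb.2 with h' | h' <;> simp [← mul_assoc, h, h']
  rcases (h1 y hy.mem).1 with h | h <;> rcases (h1 z hz.mem).2 with h' | h' <;> rw [h'] at h
  · exact Or.inl h
  · exact Or.inr (by rw [← h, neg_neg])
  · exact Or.inr h
  · exact Or.inl (neg_injective h)

theorem IsPiTop.pibar_mul {K : Set B} {p : ZeroHecke F M} (hp : IsPiTop K p) {k : B} (hk : k ∈ K) :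
    pibar F M k * p = 0 := by
  rw [← hp.left k hk, ← mul_assoc, pibar_mul_pi, zero_mul]

end ZeroHecke

/-! ### Descent classes as left ideals -/

namespace DescentSystem

open ZeroHecke

variable {F : Type*} [Field F] {B : Type*} {M : CoxeterMatrix B} {W : Type*} [Group W]
  {𝒟 : DescentSystem M W} [Finite W]

theorem IsLongest.isPiTop {K : Set B} {w : W} (h : 𝒟.IsLongest K w) :
    IsPiTop K (𝒟.along (pi F M) w) where
  mem := 𝒟.along_mem_closure _ h.1
  left k hk := by
    rw [𝒟.along_eq_mul satisfiesBraid_pi (h.coord_neg hk), ← mul_assoc, pi_mul_self]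
  right k hk := by
    rw [𝒟.along_eq_mul_of_rdesc satisfiesBraid_pi (h.rdesc.mpr hk), mul_assoc, pi_mul_self]

theorem IsLongest.isPibarTop {I : Set B} {w : W} (h : 𝒟.IsLongest I w) :
    IsPibarTop I (𝒟.pibarOf F w) where
  mem := 𝒟.along_mem_closure _ h.1
  left _ hk := 𝒟.pibar_mul_of_neg F (h.coord_neg hk)
  right _ hk := 𝒟.pibarOf_mul_of_rdesc F (h.rdesc.mpr hk)

/-- Each letter of `z` acts on π̄_w from the right by -1, so π̄_w z = ±π̄_w and the multiplier is
±π̄_w itself. No factorisation of `w` through a coset representative is needed. -/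
theorem pibarOf_mul_eq {I : Set B} {w : W} (hw : w ∈ 𝒟.descAbove I) {z : ZeroHecke F M}
    (hz : IsPibarTop I z) : ∃ a, 𝒟.pibarOf F w = a * z := by
  have h1 : ∀ a ∈ Submonoid.closure (pibar F M '' I),
      𝒟.pibarOf F w * a = 𝒟.pibarOf F w ∨ 𝒟.pibarOf F w * a = -𝒟.pibarOf F w := by
    intro a ha
    induction ha using Submonoid.closure_induction with
    | mem x hx =>
      obtain ⟨k, hk, rfl⟩ := hx
      exact Or.inr (𝒟.pibarOf_mul_of_rdesc F (hw k hk))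
    | one => simp
    | mul a b _ _ ha hb =>
      rcases ha with h | h <;> rcases hb with h' | h' <;> simp [← mul_assoc, h, h']
  rcases h1 z hz.mem with h | h
  · exact ⟨_, h.symm⟩
  · exact ⟨-𝒟.pibarOf F w, by rw [neg_mul, h, neg_neg]⟩

/-- A factor π_k sends the basis vector 1 to 1 + s_k, and s_k has the descent `k`. Further factors
preserve the span of an upper set. -/
theorem IsPiTop.regRep_sub_mem {K : Set B} {p : ZeroHecke F M} (hp : IsPiTop K p) :
    𝒟.regRep F p (Finsupp.single 1 1) - Finsupp.single 1 1 ∈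
      Finsupp.supported F F (𝒟.descMeet K) := by
  have hm := hp.mem
  clear hp
  induction hm using Submonoid.closure_induction with
  | mem x hx =>
    obtain ⟨k, hk, rfl⟩ := hx
    rw [pi_eq, map_add, map_one, LinearMap.add_apply, Module.End.one_apply, add_sub_cancel_right,
      regRep_of_not_neg 𝒟 (𝒟.coord_one_pos k).not_gt, mul_one]
    exact Finsupp.single_mem_supported F 1
      ⟨k, hk, by rw [rdesc, gen_inv, ← mul_one (𝒟.gen k), 𝒟.coord_gen_mul_neg]
                 exact (𝒟.coord_one_pos k).not_gt⟩
  | one => simp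
  | mul a b _ _ ha hb =>
    have h := (isUpper_descMeet (𝒟 := 𝒟) K).regRep_mem a hb
    rw [map_sub] at h
    rw [map_mul, Module.End.mul_apply]
    simpa using add_mem h ha

variable {I J : Set B} {w₀ : W} {p : ZeroHecke F M}

theorem pibarOf_mul_eq_zero {K : Set B} (hp : IsPiTop K p) {w : W} (hw : w ∈ 𝒟.descMeet K) :
    𝒟.pibarOf F w * p = 0 := by
  obtain ⟨k, hk, hw⟩ := hw
  rw [𝒟.pibarOf_of_rdesc F hw, mul_assoc, hp.pibar_mul hk, mul_zero]

theorem toHecke_mem {U V : Set W} {z : ZeroHecke F M} (hz : ∀ w ∈ U, ∃ a, 𝒟.pibarOf F w = a * z)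
    (x : (U \ V : Set W) →₀ F) : ∃ a, toHecke U V 𝒟 p x = a * (z * p) := by
  induction x using Finsupp.induction_linear with
  | zero => exact ⟨0, by simp⟩
  | add x y hx hy =>
    obtain ⟨a, ha⟩ := hx
    obtain ⟨b, hb⟩ := hy
    exact ⟨a + b, by rw [map_add, ha, hb, add_mul]⟩
  | single w r =>
    obtain ⟨a, ha⟩ := hz w w.2.1
    refine ⟨r • a, ?_⟩
    rw [← mul_one r, ← smul_eq_mul, ← Finsupp.smul_single, map_smul, toHecke_single, ha,
      smul_eq_mul, mul_one, smul_mul_assoc, mul_assoc]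

/-- The representation on a descent class in the form of a left ideal. -/
def descModel (hw₀ : 𝒟.IsLongest I w₀) (hp : IsPiTop (J \ I) p) :
    IdealModel (𝒟.descRep (F := F) I J) (𝒟.pibarOf F w₀ * p) where
  emb := toHecke _ _ 𝒟 p
  emb_rep := toHecke_convRep _ _ fun _ hw => pibarOf_mul_eq_zero hp hw
  emb_mem := toHecke_mem fun _ hw => pibarOf_mul_eq hw hw₀.isPibarTop
  -- The right descents of `w₀` are exactly `I`, so `w₀` itself belongs to the class and maps to the
  -- generator.
  gen := Finsupp.single ⟨w₀, fun _ hi => hw₀.rdesc.mpr hi,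
    fun ⟨_, hj, hw⟩ => hj.2 (hw₀.rdesc.mp hw)⟩ 1
  emb_gen := toHecke_single _ _

theorem descModel_injective (hw₀ : 𝒟.IsLongest I w₀) (hp : IsPiTop (J \ I) p) :
    Function.Injective (descModel hw₀ hp).emb :=
  toHecke_injective (IsPiTop.regRep_sub_mem hp) (isUpper_descMeet _)

end DescentSystem

/-! ### Length filtration and splitting of the regular representation -/

namespace DescentSystem

open ZeroHecke

variable {B : Type*} {M : CoxeterMatrix B} {W : Type*} [Group W] (𝒟 : DescentSystem M W) [Finite W]
  (F : Type*) [Field F]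

/-- The longest element of the parabolic subgroup of `K`. -/
def longestOf (K : Set B) : W := (𝒟.exists_isLongest K).choose

theorem isLongest_longestOf (K : Set B) : 𝒟.IsLongest K (𝒟.longestOf K) :=
  (𝒟.exists_isLongest K).choose_spec

/-- The element `π_w` for `w` the longest element of the parabolic subgroup of `K`. -/
def piTop (K : Set B) : ZeroHecke F M := 𝒟.along (pi F M) (𝒟.longestOf K)

theorem isPiTop_piTop (K : Set B) : IsPiTop K (𝒟.piTop F K) :=
  (𝒟.isLongest_longestOf K).isPiTop

/-- The span of the elements `π̄_v` with `v` of length larger than `k`. -/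
def lengthFilt (k : ℕ) : Submodule F (ZeroHecke F M) :=
  (Finsupp.supported F F {v | k < 𝒟.len v}).map (𝒟.basisEquiv F).toLinearMap

variable {F 𝒟}

theorem pibarOf_mem_lengthFilt {v : W} {k : ℕ} (h : k < 𝒟.len v) :
    𝒟.pibarOf F v ∈ 𝒟.lengthFilt F k :=
  ⟨Finsupp.single v 1, Finsupp.single_mem_supported F 1 h, 𝒟.basisEquiv_single F v⟩

/-- Induction on the elements of `lengthFilt`. -/
theorem lengthFilt_induction {k : ℕ} {N : Submodule F (ZeroHecke F M)}
    (h : ∀ v, k < 𝒟.len v → 𝒟.pibarOf F v ∈ N) : 𝒟.lengthFilt F k ≤ N := by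
  rw [lengthFilt, Finsupp.supported_eq_span_single, Submodule.map_span, Submodule.span_le]
  rintro _ ⟨_, ⟨v, hv, rfl⟩, rfl⟩
  have := h v hv
  rwa [← basisEquiv_single] at this

theorem lengthFilt_mono {k l : ℕ} (h : k ≤ l) : 𝒟.lengthFilt F l ≤ 𝒟.lengthFilt F k :=
  lengthFilt_induction fun _ hv => pibarOf_mem_lengthFilt (h.trans_lt hv)

theorem mul_pibar_mem {k : ℕ} {x : ZeroHecke F M} (hx : x ∈ 𝒟.lengthFilt F k) (i : B) :
    x * pibar F M i ∈ 𝒟.lengthFilt F k := by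
  refine lengthFilt_induction (N := (𝒟.lengthFilt F k).comap (LinearMap.mulRight F (pibar F M i)))
    (fun v hv => ?_) hx
  change 𝒟.pibarOf F v * pibar F M i ∈ 𝒟.lengthFilt F k
  by_cases h : 𝒟.rdesc v i
  · rw [𝒟.pibarOf_mul_of_rdesc F h]
    exact neg_mem (pibarOf_mem_lengthFilt hv)
  · rw [𝒟.pibarOf_mul_of_not_rdesc F h]
    refine pibarOf_mem_lengthFilt ?_
    rw [𝒟.len_of_not_rdesc h]
    omega

/-- Write π_k = 1 + π̄_k: at a right ascent `k` of `w` the second term yields a longer element, and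
right multiplication never leaves the filtration step. -/
theorem pibarOf_mul_sub_mem {K : Set B} {p : ZeroHecke F M} (hp : IsPiTop K p) {w : W}
    (hw : ∀ k ∈ K, ¬ 𝒟.rdesc w k) :
    𝒟.pibarOf F w * p - 𝒟.pibarOf F w ∈ 𝒟.lengthFilt F (𝒟.len w) := by
  have key : ∀ q ∈ Submonoid.closure (pi F M '' K),
      (∀ x ∈ 𝒟.lengthFilt F (𝒟.len w), x * q ∈ 𝒟.lengthFilt F (𝒟.len w)) ∧
      𝒟.pibarOf F w * q - 𝒟.pibarOf F w ∈ 𝒟.lengthFilt F (𝒟.len w) := by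
    intro q hq
    induction hq using Submonoid.closure_induction with
    | mem x hx =>
      obtain ⟨k, hk, rfl⟩ := hx
      simp only [pi_eq, mul_add, mul_one, add_sub_cancel_right]
      refine ⟨fun x hx => add_mem (mul_pibar_mem hx k) hx, ?_⟩
      rw [𝒟.pibarOf_mul_of_not_rdesc F (hw k hk)]
      refine pibarOf_mem_lengthFilt ?_
      rw [𝒟.len_of_not_rdesc (hw k hk)]
      omega
    | one => simp
    | mul a b _ _ ha hb =>
      refine ⟨fun x hx => by rw [← mul_assoc]; exact hb.1 _ (ha.1 x hx), ?_⟩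
      have h := add_mem (hb.1 _ ha.2) hb.2
      rwa [sub_mul, sub_add_sub_cancel, mul_assoc] at h
  exact (key p hp.mem).2

variable (𝒟) in
/-- The set of right descents. -/
def rdescSet (w : W) : Set B := {i | 𝒟.rdesc w i}

omit [Finite W] in
theorem mem_descClass_univ {I : Set B} {w : W} :
    w ∈ 𝒟.descClass I Set.univ ↔ 𝒟.rdescSet w = I := by
  rw [mem_descClass (Set.subset_univ I), Set.ext_iff]
  simp [rdescSet]

variable (𝒟 F) in
/-- The map `w ↦ π̄_w π_{w₀}`, where `w₀` is the longest element of the parabolic subgroup of the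
right ascents of `w`. -/
def ascentMap : (W →₀ F) →ₗ[F] ZeroHecke F M :=
  Finsupp.linearCombination F fun w => 𝒟.pibarOf F w * 𝒟.piTop F (Set.univ \ 𝒟.rdescSet w)

/-- By `pibarOf_mul_sub_mem` the image of `w` has leading term π̄_w, so these products form a basis
adapted to descent sets. -/
theorem ascentMap_bijective : Function.Bijective (𝒟.ascentMap F) := by
  have h := bijective_of_unitriangular 𝒟.len
    ((𝒟.basisEquiv F).symm.toLinearMap ∘ₗ 𝒟.ascentMap F) (fun w => ?_)
  · have h2 : (𝒟.ascentMap F : (W →₀ F) → ZeroHecke F M) =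
        𝒟.basisEquiv F ∘ ((𝒟.basisEquiv F).symm.toLinearMap ∘ₗ 𝒟.ascentMap F) := by
      funext x
      simp
    rw [h2]
    exact (𝒟.basisEquiv F).bijective.comp h
  · have h1 : 𝒟.ascentMap F (Finsupp.single w 1) - 𝒟.basisEquiv F (Finsupp.single w 1) ∈
        𝒟.lengthFilt F (𝒟.len w) := by
      rw [basisEquiv_single, ascentMap, Finsupp.linearCombination_single, one_smul]
      exact pibarOf_mul_sub_mem (𝒟.isPiTop_piTop F _) fun k hk hd => hk.2 hd
    obtain ⟨y, hy, hy'⟩ := h1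
    have : (𝒟.basisEquiv F).symm (𝒟.ascentMap F (Finsupp.single w 1)) - Finsupp.single w 1 = y := by
      apply (𝒟.basisEquiv F).injective
      rw [map_sub, LinearEquiv.apply_symm_apply]
      exact hy'.symm
    rw [LinearMap.comp_apply, LinearEquiv.coe_coe, this]
    exact hy

theorem ascentMap_incl (I : Set B) (x : 𝒟.descClass I Set.univ →₀ F) :
    𝒟.ascentMap F (incl F _ x) = toHecke _ _ 𝒟 (𝒟.piTop F (Set.univ \ I)) x := by
  induction x using Finsupp.induction_linear with
  | zero => simp
  | add x y hx hy => simp only [map_add, hx, hy]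
  | single w r =>
    have hw := mem_descClass_univ.mp w.2
    rw [← mul_one r, ← smul_eq_mul, ← Finsupp.smul_single, map_smul, map_smul, incl_single,
      map_smul, toHecke_single, ascentMap, Finsupp.linearCombination_single, one_smul, hw]

variable {I : Set B} {w₀ : W} {p : ZeroHecke F M}

/-- The retraction of the 0-Hecke algebra onto the representation on a descent class. -/
def descRetract (I : Set B) : ZeroHecke F M →ₗ[F] (𝒟.descClass I Set.univ →₀ F) :=
  proj F _ ∘ₗ (LinearEquiv.ofBijective _ (ascentMap_bijective (𝒟 := 𝒟) (F := F))).symm.toLinearMap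

theorem descRetract_ascentMap (x : W →₀ F) :
    descRetract I (𝒟.ascentMap F x) = proj F (𝒟.descClass I Set.univ) x := by
  have := (LinearEquiv.ofBijective _ (ascentMap_bijective (𝒟 := 𝒟) (F := F))).symm_apply_apply x
  rw [LinearEquiv.ofBijective_apply] at this
  rw [descRetract, LinearMap.comp_apply, LinearEquiv.coe_coe, this]

/-- The new basis vectors with a fixed descent set span a left ideal, since there `ascentMap` is the
intertwiner `toHecke`. The projection along the other descent sets is therefore a module
homomorphism. -/
theorem descRetract_mul (a h : ZeroHecke F M) :
    descRetract (𝒟 := 𝒟) I (a * h) = 𝒟.descRep F I Set.univ a (descRetract I h) := by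
  obtain ⟨x, rfl⟩ := (ascentMap_bijective (𝒟 := 𝒟) (F := F)).2 h
  induction x using Finsupp.induction_linear with
  | zero => simp
  | add x y hx hy => simp only [map_add, mul_add, hx, hy]
  | single w r =>
    let w' : 𝒟.descClass (𝒟.rdescSet w) Set.univ := ⟨w, mem_descClass_univ.mpr rfl⟩
    have h1 : Finsupp.single w r = incl F (𝒟.descClass (𝒟.rdescSet w) Set.univ)
      (Finsupp.single w' r) := (incl_single F _ w' r).symm
    have h2 : a * 𝒟.ascentMap F (Finsupp.single w r) = 𝒟.ascentMap F (incl F _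
        (𝒟.descRep F (𝒟.rdescSet w) Set.univ a (Finsupp.single w' r))) := by
      rw [h1, ascentMap_incl, ascentMap_incl]
      exact (toHecke_convRep _ _
        (fun _ hw => pibarOf_mul_eq_zero (𝒟.isPiTop_piTop F _) hw) _ _).symm
    rw [h2, descRetract_ascentMap, descRetract_ascentMap]
    by_cases hI : 𝒟.rdescSet w = I
    · subst hI
      rw [proj_incl, h1, proj_incl]
    · have hd : Disjoint (𝒟.descClass I Set.univ) (𝒟.descClass (𝒟.rdescSet w) Set.univ) := by
        rw [Set.disjoint_left]
        intro v hv hv'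
        rw [mem_descClass_univ] at hv hv'
        exact hI (hv'.symm.trans hv)
      rw [proj_of_disjoint hd (incl_mem F _ _), h1, proj_of_disjoint hd (incl_mem F _ _), map_zero]

/-- The representation on the elements with descent set `I` is a direct summand of the 0-Hecke
algebra. -/
def descSplitModel (hw₀ : 𝒟.IsLongest I w₀) (hp : IsPiTop (Set.univ \ I) p) :
    SplitModel (𝒟.descRep (F := F) I Set.univ) (𝒟.pibarOf F w₀ * p) where
  toIdealModel := descModel hw₀ hp
  unit := descRetract I 1
  rep_emb x := by
    have h : (descModel hw₀ hp).emb x = 𝒟.ascentMap F (incl F _ x) := by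
      rw [ascentMap_incl, (𝒟.isPiTop_piTop F _).eq hp]
      rfl
    rw [← descRetract_mul, mul_one, h, descRetract_ascentMap]
    exact proj_incl F _ x

end DescentSystem

namespace DescentSystem

open ZeroHecke

variable {B : Type*} {M : CoxeterMatrix B} {W : Type*} [Group W] {𝒟 : DescentSystem M W} [Finite W]
  {F : Type*} [Field F]

/-! ### Decomposition into indecomposables -/

section Decomposition

omit [Finite W]

theorem descClass_subset {I J I' : Set B} (hIJ : I ⊆ J) (h : ∀ j ∈ J, j ∈ I' ↔ j ∈ I) :
    𝒟.descClass I' Set.univ ⊆ 𝒟.descClass I J := by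
  intro w hw
  rw [mem_descClass_univ] at hw
  subst hw
  exact (mem_descClass hIJ).mpr h

omit [Group W] in
theorem incl_proj {X : Set W} {x : W →₀ F} (hx : x ∈ Finsupp.supported F F X) :
    incl F X (proj F X x) = x := by
  rw [Finsupp.supported_eq_span_single] at hx
  induction hx using Submodule.span_induction with
  | mem y hy =>
    obtain ⟨w, hw, rfl⟩ := hy
    rw [proj_single_of_mem F hw, incl_single]
  | zero => simp
  | add y z _ _ hy hz => rw [map_add, map_add, hy, hz]
  | smul r y _ hy => rw [map_smul, map_smul, hy]

omit [Group W] in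
theorem proj_mem_supported {X S : Set W} {x : W →₀ F} (hx : x ∈ Finsupp.supported F F S) :
    proj F X x ∈ Finsupp.supported F F (Subtype.val ⁻¹' S : Set X) := by
  intro v hv
  refine hx ?_
  rw [Finset.mem_coe, Finsupp.mem_support_iff] at hv ⊢
  exact hv

end Decomposition

variable {I J : Set B}

/-- A lift of the representation on the elements with descent set `I'` to the representation on the
descent class of `I` and `J`. -/
def descLift (I J I' : Set B) :
    (𝒟.descClass I' Set.univ →₀ F) →ₗ[F] (𝒟.descClass I J →₀ F) :=
  (LinearMap.applyₗ (proj F (𝒟.descClass I J) (incl F _ (descRetract (F := F) (𝒟 := 𝒟) I' 1)))) ∘ₗ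
    (𝒟.descRep F I J).toLinearMap ∘ₗ 𝒟.ascentMap F ∘ₗ incl F (𝒟.descClass I' Set.univ)

theorem descLift_apply (I J I' : Set B) (x : 𝒟.descClass I' Set.univ →₀ F) :
    descLift I J I' x = 𝒟.descRep F I J (𝒟.ascentMap F (incl F _ x))
      (proj F (𝒟.descClass I J) (incl F _ (descRetract (F := F) (𝒟 := 𝒟) I' 1))) := rfl

/-- The lift embeds the module of `I'` in the algebra and lets the result act on a fixed vector.
Both steps commute with the action. -/
theorem descLift_descRep (I J I' : Set B) (h : ZeroHecke F M)
    (x : 𝒟.descClass I' Set.univ →₀ F) :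
    descLift I J I' (𝒟.descRep F I' Set.univ h x) = 𝒟.descRep F I J h (descLift I J I' x) := by
  have h1 : 𝒟.ascentMap F (incl F _ (𝒟.descRep F I' Set.univ h x)) =
      h * 𝒟.ascentMap F (incl F _ x) := by
    rw [ascentMap_incl, ascentMap_incl]
    exact toHecke_convRep _ _ (fun _ hw => pibarOf_mul_eq_zero (𝒟.isPiTop_piTop F _) hw) _ _
  rw [descLift_apply, h1, map_mul, Module.End.mul_apply, descLift_apply]

/-- Let `a` be the image of `w` in the algebra and `u` the retraction of 1. In the module of `I'`
the product `a · u` is exactly `w`. In the regular representation the error consists of elements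
that have all descents in `I'` and one more outside, hence strictly more right descents than `w`. -/
theorem descLift_single [Finite B] (hIJ : I ⊆ J) {I' : Set B} (h : ∀ j ∈ J, j ∈ I' ↔ j ∈ I)
    (w : 𝒟.descClass I' Set.univ) :
    descLift I J I' (Finsupp.single w (1 : F)) - Finsupp.single ⟨w, descClass_subset hIJ h w.2⟩ 1 ∈
      Finsupp.supported F F {v | (𝒟.rdescSet w.1).ncard < (𝒟.rdescSet v.1).ncard} := by
  have hsub := descClass_subset (𝒟 := 𝒟) hIJ h
  set u := descRetract (F := F) (𝒟 := 𝒟) I' 1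
  set a := 𝒟.ascentMap F (incl F _ (Finsupp.single w 1)) with ha
  have hw : 𝒟.rdescSet w.1 = I' := mem_descClass_univ.mp w.2
  have h1 : 𝒟.descRep F I' Set.univ a u = Finsupp.single w 1 := by
    rw [← descRetract_mul, mul_one, descRetract_ascentMap]
    exact proj_incl F _ _
  have h2 := regRep_sub_convRep_mem F (isUpper_descAbove (𝒟 := 𝒟) I')
    (isUpper_descMeet (Set.univ \ I')) a u
  have h3 : 𝒟.regRep F a (incl F _ u) - incl F _ (𝒟.descRep F I' Set.univ a u) ∈
      Finsupp.supported F F (𝒟.descAbove I') :=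
    sub_mem ((isUpper_descAbove I').regRep_mem a
      (Finsupp.supported_mono Set.sdiff_subset (incl_mem F _ u)))
      (Finsupp.supported_mono Set.sdiff_subset (incl_mem F _ _))
  have h4 : 𝒟.regRep F a (incl F _ u) - incl F _ (𝒟.descRep F I' Set.univ a u) ∈
      Finsupp.supported F F (𝒟.descAbove I' ∩ 𝒟.descMeet (Set.univ \ I')) := by
    rw [Finsupp.supported_inter]
    exact ⟨h3, h2⟩
  have h5 := proj_mem_supported (X := 𝒟.descClass I J) h4
  rw [map_sub, h1, incl_single, proj_single_of_mem F (hsub w.2)] at h5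
  -- The class of `I'` is contained in that of `I` and `J`, so restricting `u` to the latter loses
  -- nothing.
  have h6 : descLift I J I' (Finsupp.single w 1) =
      proj F (𝒟.descClass I J) (𝒟.regRep F a (incl F _ u)) := by
    rw [descLift_apply, descRep, convRep_apply, incl_proj
      (Finsupp.supported_mono hsub (incl_mem F _ u))]
  rw [h6]
  refine Finsupp.supported_mono ?_ h5
  rintro v ⟨hv1, k, hk, hv2⟩
  rw [Set.mem_ofPred_eq, hw]
  exact Set.ncard_lt_ncard (Set.ssubset_iff_of_subset hv1 |>.mpr ⟨k, hv2, hk.2⟩) (Set.toFinite _)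

variable (𝒟 F) in
/-- The endomorphism of the space on a descent class that is made up of the lifts. -/
def descLiftAll (I J : Set B) : Module.End F (𝒟.descClass I J →₀ F) :=
  Finsupp.linearCombination F fun w =>
    descLift I J (𝒟.rdescSet w.1) (Finsupp.single ⟨w.1, mem_descClass_univ.mpr rfl⟩ 1)

theorem descLiftAll_bijective [Finite B] (hIJ : I ⊆ J) :
    Function.Bijective (𝒟.descLiftAll F I J) := by
  have key : ∀ w, 𝒟.descLiftAll F I J (Finsupp.single w 1) - Finsupp.single w 1 ∈
      Finsupp.supported F F {v | (𝒟.rdescSet w.1).ncard < (𝒟.rdescSet v.1).ncard} := by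
    rintro ⟨w, hw⟩
    have h := descLift_single (F := F) hIJ (fun j hj => (mem_descClass hIJ).mp hw j hj)
      ⟨w, mem_descClass_univ.mpr rfl⟩
    rwa [descLiftAll, Finsupp.linearCombination_single, one_smul]
  have h := bijective_of_unitriangular (F := F) (X := 𝒟.descClass I J)
    (fun w => (𝒟.rdescSet w.1).ncard) (𝒟.descLiftAll F I J) key
  exact h

theorem descLift_eq (hIJ : I ⊆ J) {I' : Set B} (h : ∀ j ∈ J, j ∈ I' ↔ j ∈ I)
    (x : 𝒟.descClass I' Set.univ →₀ F) :
    descLift I J I' x = 𝒟.descLiftAll F I J (proj F _ (incl F _ x)) := by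
  induction x using Finsupp.induction_linear with
  | zero => simp
  | add x y hx hy => simp only [map_add, hx, hy]
  | single w r =>
    obtain ⟨w, hw'⟩ := w
    have hw := mem_descClass_univ.mp hw'
    subst hw
    rw [incl_single, proj_single_of_mem F (descClass_subset hIJ h hw'), descLiftAll,
      Finsupp.linearCombination_single, ← map_smul, Finsupp.smul_single, smul_eq_mul, mul_one]

variable (𝒟 F) in
/-- The lift as a homomorphism of modules. -/
def descLiftHom (I J I' : Set B) : ModuleOf (𝒟.descRep F I' Set.univ) →ₗ[ZeroHecke F M]
    ModuleOf (𝒟.descRep F I J) where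
  toFun := descLift (F := F) (𝒟 := 𝒟) I J I'
  map_add' := (descLift (F := F) (𝒟 := 𝒟) I J I').map_add
  map_smul' := descLift_descRep I J I'

/-- Once `descLiftAll` is undone, the summands become the spans of the sets of elements with descent
set `D k`. By `hD` and `hD'` these sets partition the class of `I` and `J`. -/
theorem toModule_descLiftHom_bijective [Finite B] (hIJ : I ⊆ J) {κ : Type*} [DecidableEq κ]
    {D : κ → Set B} (hD : Function.Injective D)
    (hD' : ∀ I', I' ∈ Set.range D ↔ ∀ j ∈ J, j ∈ I' ↔ j ∈ I) :
    Function.Bijective (DirectSum.toModule (ZeroHecke F M) κ (ModuleOf (𝒟.descRep F I J))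
      fun k => 𝒟.descLiftHom F I J (D k)) := by
  let E := LinearEquiv.ofBijective _ (descLiftAll_bijective (𝒟 := 𝒟) (F := F) hIJ)
  have hE : ∀ y, E.symm (𝒟.descLiftAll F I J y) = y := E.symm_apply_apply
  have hcoord : ∀ k v, descLift I J (D k) v = 𝒟.descLiftAll F I J (proj F _ (incl F _ v)) :=
    fun k => descLift_eq hIJ ((hD' _).mp ⟨k, rfl⟩)
  have hsub : ∀ k, 𝒟.descClass (D k) Set.univ ⊆ 𝒟.descClass I J :=
    fun k => descClass_subset hIJ ((hD' _).mp ⟨k, rfl⟩)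
  constructor
  -- Additive maps that read off the components of a direct sum from its image.
  · let c : ∀ k, ModuleOf (𝒟.descRep F I J) →+ ModuleOf (𝒟.descRep F (D k) Set.univ) :=
      fun k => (proj F (𝒟.descClass (D k) Set.univ) ∘ₗ incl F _ ∘ₗ
        E.symm.toLinearMap).toAddMonoidHom
    have hc0 : ∀ (k l : κ) (v : 𝒟.descClass (D l) Set.univ →₀ F),
        proj F (𝒟.descClass (D k) Set.univ) (incl F _ (E.symm (descLift I J (D l) v))) =
          proj F (𝒟.descClass (D k) Set.univ) (incl F (𝒟.descClass (D l) Set.univ) v) := by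
      intro k l v
      rw [hcoord, hE, incl_proj (Finsupp.supported_mono (hsub l) (incl_mem F _ v))]
    have hc : ∀ (k l : κ) (v : ModuleOf (𝒟.descRep F (D l) Set.univ)),
        c k (𝒟.descLiftHom F I J (D l) v) =
          proj F (𝒟.descClass (D k) Set.univ) (incl F (𝒟.descClass (D l) Set.univ) v) := hc0
    have hc' : ∀ k x, c k (DirectSum.toModule (ZeroHecke F M) κ (ModuleOf (𝒟.descRep F I J))
        (fun k => 𝒟.descLiftHom F I J (D k)) x) = x k := by
      intro k x
      induction x using DirectSum.induction_on with
      | zero => simp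
      | of l v =>
        have h1 : DirectSum.toModule (ZeroHecke F M) κ (ModuleOf (𝒟.descRep F I J))
            (fun k => 𝒟.descLiftHom F I J (D k)) (DirectSum.of _ l v) =
            𝒟.descLiftHom F I J (D l) v := DirectSum.toModule_lof _ _ _
        rw [h1, hc]
        by_cases hkl : l = k
        · subst hkl
          rw [DirectSum.of_eq_same]
          exact proj_incl F _ v
        · rw [DirectSum.of_eq_of_ne _ _ _ (Ne.symm hkl)]
          refine proj_of_disjoint (Set.disjoint_left.mpr fun w hw hw' => hkl (hD ?_))
            (incl_mem F _ v)
          rw [mem_descClass_univ] at hw hw'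
          exact hw'.symm.trans hw
      | add x y hx hy => rw [map_add, map_add, hx, hy, DirectSum.add_apply]
    intro x y hxy
    refine DFinsupp.ext fun k => ?_
    have h1 := hc' k x
    rw [hxy, hc'] at h1
    exact h1.symm
  · intro y
    obtain ⟨x, rfl⟩ := (descLiftAll_bijective (𝒟 := 𝒟) (F := F) hIJ).2 y
    induction x using Finsupp.induction_linear with
    | zero => exact ⟨0, by rw [map_zero]; exact (map_zero _).symm⟩
    | add x y hx hy =>
      obtain ⟨a, ha⟩ := hx
      obtain ⟨b, hb⟩ := hy
      exact ⟨a + b, by rw [map_add, ha, hb]; exact (map_add (𝒟.descLiftAll F I J) x y).symm⟩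
    | single w r =>
      obtain ⟨k, hk⟩ := (hD' (𝒟.rdescSet w.1)).mpr ((mem_descClass hIJ).mp w.2)
      refine ⟨DirectSum.of _ k (Finsupp.single ⟨w.1, mem_descClass_univ.mpr hk.symm⟩ r), ?_⟩
      refine (DirectSum.toModule_lof _ _ _).trans ((hcoord k _).trans ?_)
      rw [incl_single, proj_single_of_mem F w.2]

/-- The representation on a descent class is the direct sum of the representations on the sets of
elements with a given set of right descents. -/
def directSumEquiv [Finite B] (hIJ : I ⊆ J) {κ : Type*} [DecidableEq κ]
    {D : κ → Set B} (hD : Function.Injective D)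
    (hD' : ∀ I', I' ∈ Set.range D ↔ ∀ j ∈ J, j ∈ I' ↔ j ∈ I) :
    (⨁ k, ModuleOf (𝒟.descRep F (D k) Set.univ)) ≃ₗ[ZeroHecke F M] ModuleOf (𝒟.descRep F I J) :=
  LinearEquiv.ofBijective _ (toModule_descLiftHom_bijective hIJ hD hD')

/-! ### Indecomposability -/

variable (F) in
open Classical in
/-- The character of the 0-Hecke algebra with value `-1` at `π̄_i` for `i ∈ S` and `0` at the other
generators. -/
def character (𝒟 : DescentSystem M W) (S : Set B) : ZeroHecke F M →ₐ[F] F :=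
  𝒟.liftNeg (fun i => if i ∈ S then 1 else 0)
    (𝒟.satisfiesBraid_of (fun _ _ _ _ _ => mul_comm _ _)
      (fun s t _ _ _ => by split_ifs <;> simp) (fun s t _ _ _ => by split_ifs <;> simp))
    (fun i => by split_ifs <;> simp)

omit [Finite W] in
theorem character_of_mem {S : Set B} {i : B} (h : i ∈ S) :
    character F 𝒟 S (pibar F M i) = -1 := by
  rw [character, liftNeg_pibar, if_pos h]

omit [Finite W] in
theorem character_of_notMem {S : Set B} {i : B} (h : i ∉ S) :
    character F 𝒟 S (pibar F M i) = 0 := by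
  rw [character, liftNeg_pibar, if_neg h, neg_zero]

theorem pibar_mul_mem {k : ℕ} {x : ZeroHecke F M} (hx : x ∈ 𝒟.lengthFilt F k) (i : B) :
    pibar F M i * x ∈ 𝒟.lengthFilt F k := by
  refine lengthFilt_induction (N := (𝒟.lengthFilt F k).comap (LinearMap.mulLeft F (pibar F M i)))
    (fun v hv => ?_) hx
  change pibar F M i * 𝒟.pibarOf F v ∈ 𝒟.lengthFilt F k
  by_cases h : 𝒟.coord v i < 0
  · rw [𝒟.pibar_mul_of_neg F h]
    exact neg_mem (pibarOf_mem_lengthFilt hv)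
  · rw [𝒟.pibar_mul_of_not_neg F h]
    refine pibarOf_mem_lengthFilt ?_
    rw [𝒟.len_of_not_neg h]
    omega

theorem mul_mem_lengthFilt {k : ℕ} (h : ZeroHecke F M) {x : ZeroHecke F M}
    (hx : x ∈ 𝒟.lengthFilt F k) : h * x ∈ 𝒟.lengthFilt F k := by
  induction h using ZeroHecke.induction generalizing x with
  | scalar r =>
    rw [← Algebra.smul_def]
    exact Submodule.smul_mem _ r hx
  | gen i => exact pibar_mul_mem hx i
  | mul a b ha hb =>
    rw [mul_assoc]
    exact ha (hb hx)
  | add a b ha hb =>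
    rw [add_mul]
    exact add_mem (ha hx) (hb hx)

/-- In the basis ordered by length the algebra acts by triangular matrices, with the character of
the left descent set of `w` as the diagonal entry at `w`. -/
theorem mul_pibarOf_sub_mem (h : ZeroHecke F M) (w : W) :
    h * 𝒟.pibarOf F w - character F 𝒟 {i | 𝒟.coord w i < 0} h • 𝒟.pibarOf F w ∈
      𝒟.lengthFilt F (𝒟.len w) := by
  induction h using ZeroHecke.induction with
  | scalar r => simp [Algebra.smul_def]
  | gen i =>
    by_cases hi : 𝒟.coord w i < 0
    · rw [character_of_mem (by exact hi), 𝒟.pibar_mul_of_neg F hi]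
      simp
    · rw [character_of_notMem (by exact hi), 𝒟.pibar_mul_of_not_neg F hi, zero_smul, sub_zero]
      refine pibarOf_mem_lengthFilt ?_
      rw [𝒟.len_of_not_neg hi]
      omega
  | mul a b ha hb =>
    -- The error for `a * b` is `a` times the error for `b`, plus χ(b) times the error for `a`.
    have h1 := add_mem (mul_mem_lengthFilt a hb)
      (Submodule.smul_mem _ (character F 𝒟 {i | 𝒟.coord w i < 0} b) ha)
    rw [mul_sub, smul_sub, mul_smul_comm, sub_add_sub_cancel, smul_smul, ← mul_assoc] at h1
    rwa [map_mul, mul_comm (character F 𝒟 _ a)]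
  | add a b ha hb =>
    rw [map_add, add_mul, add_smul, add_sub_add_comm]
    exact add_mem ha hb

/-- An element on which all characters vanish raises the length. -/
theorem mul_mem_of_characters {n : ZeroHecke F M} (hn : ∀ χ : ZeroHecke F M →ₐ[F] F, χ n = 0)
    (w : W) : n * 𝒟.pibarOf F w ∈ 𝒟.lengthFilt F (𝒟.len w) := by
  simpa [hn] using 𝒟.mul_pibarOf_sub_mem n w

/-- Multiplication by `n` raises the length, so `b = n * b` lies in every step of the filtration,
which is eventually zero. This plays the role of Nakayama's lemma. -/
theorem eq_zero_of_eq_mul (𝒟 : DescentSystem M W) {n b : ZeroHecke F M}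
    (hn : ∀ χ : ZeroHecke F M →ₐ[F] F, χ n = 0) (hb : b = n * b) : b = 0 := by
  have h0 : b ∈ 𝒟.lengthFilt F 0 := by
    rw [hb]
    obtain ⟨x, rfl⟩ := (𝒟.basisEquiv F).surjective b
    clear hb
    induction x using Finsupp.induction_linear with
    | zero => simp
    | add x y hx hy => rw [map_add, mul_add]; exact add_mem hx hy
    | single w r =>
      have h : Finsupp.single w r = r • Finsupp.single w (1 : F) := by simp
      rw [h, map_smul, mul_smul_comm, basisEquiv_single]
      exact Submodule.smul_mem _ r (lengthFilt_mono (Nat.zero_le _) (mul_mem_of_characters hn w))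
  have hk : ∀ k, b ∈ 𝒟.lengthFilt F k := by
    intro k
    induction k with
    | zero => exact h0
    | succ k ih =>
      rw [hb]
      exact lengthFilt_induction
        (N := (𝒟.lengthFilt F (k + 1)).comap (LinearMap.mulLeft F n))
        (fun v hv => lengthFilt_mono hv (mul_mem_of_characters hn v)) ih
  obtain ⟨N, hN⟩ := (Set.finite_range 𝒟.len).bddAbove
  have h1 : 𝒟.lengthFilt F N ≤ ⊥ :=
    lengthFilt_induction fun v hv => absurd (hN ⟨v, rfl⟩) (not_le.mpr hv)
  exact (Submodule.mem_bot F).mp (h1 (hk N))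

end DescentSystem

theorem IsIndecomposable.of_equiv {R M N : Type*} [Ring R] [AddCommGroup M] [Module R M]
    [AddCommGroup N] [Module R N] (e : M ≃ₗ[R] N) (h : IsIndecomposable R M) :
    IsIndecomposable R N := by
  have := h.1
  refine ⟨e.symm.toEquiv.nontrivial, fun A B hAB => ?_⟩
  have h1 := h.2 (A.comap e.toLinearMap) (B.comap e.toLinearMap)
    (hAB.map (Submodule.orderIsoMapComap e).symm)
  have key : ∀ C : Submodule R N, C.comap e.toLinearMap = ⊥ → C = ⊥ := fun C hC =>
    (Submodule.orderIsoMapComap e).symm.injective (hC.trans (map_bot _).symm)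
  exact h1.imp (key A) (key B)

namespace DescentSystem

open ZeroHecke

variable {B : Type*} {M : CoxeterMatrix B} {W : Type*} [Group W] {𝒟 : DescentSystem M W} [Finite W]
  {F : Type*} [Field F] {I : Set B} {w₀ : W} {p : ZeroHecke F M}

-- A character that does not vanish on `z * p` is -1 at the generators in `I`, by `hz.left`. It is 0
-- at the others, because `p = π_i p` and values in `F` commute. So it is the character of `I`, and
-- modulo elements killed by all characters the left ideal is spanned by its generator.
omit [Finite W] in
theorem characters_sub {z : ZeroHecke F M} (hz : IsPibarTop I z) (hp : IsPiTop (Set.univ \ I) p)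
    (h : ZeroHecke F M) (χ : ZeroHecke F M →ₐ[F] F) :
    χ (h * (z * p) - character F 𝒟 I h • (z * p)) = 0 := by
  by_cases hχ : χ (z * p) = 0
  · rw [map_sub, map_mul, map_smul, hχ, mul_zero, smul_zero, sub_zero]
  · have : χ = character F 𝒟 I := by
      refine algHom_ext fun i => ?_
      by_cases hi : i ∈ I
      · have h1 : χ (pibar F M i) * χ (z * p) = -1 * χ (z * p) := by
          rw [← map_mul, ← mul_assoc, hz.left i hi, neg_mul, map_neg, neg_one_mul]
        rw [character_of_mem hi, mul_right_cancel₀ hχ h1]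
      · have h1 : χ (pibar F M i) * χ (z * p) = 0 * χ (z * p) := by
          rw [map_mul, ← hp.left i ⟨trivial, hi⟩, map_mul, zero_mul, mul_left_comm,
            ← mul_assoc (χ (pibar F M i)), ← map_mul χ (pibar F M i), pibar_mul_pi, map_zero,
            zero_mul, mul_zero]
        rw [character_of_notMem hi, mul_right_cancel₀ hχ h1]
    rw [this, map_sub, map_mul, map_smul, smul_eq_mul, sub_self]

/-- For `y` in `C` a suitable multiple `t • a` makes `n = y - t • a` vanish under all characters.
From `n = n * ε = n * a + n * c` it follows that `y - n * c` lies in both `A` and `C`, so `y = n *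
c`. For `y = c` this forces `c = 0` by `eq_zero_of_eq_mul`, and then every `y` vanishes. -/
theorem eq_bot_of_disjoint (𝒟 : DescentSystem M W) {A C Q : Submodule (ZeroHecke F M) (ZeroHecke F M)}
    (hA : A ≤ Q) (hC : C ≤ Q) (hdis : Disjoint A C) {ε a c g : ZeroHecke F M}
    (hε : ∀ y ∈ Q, y * ε = y) (hac : a + c = ε) (ha : a ∈ A) (hc : c ∈ C)
    (hQ : ∀ y ∈ Q, ∃ r : F, ∀ χ : ZeroHecke F M →ₐ[F] F, χ (y - r • g) = 0)
    {r : F} (hr : r ≠ 0) (har : ∀ χ : ZeroHecke F M →ₐ[F] F, χ (a - r • g) = 0) :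
    C = ⊥ := by
  have key : ∀ y ∈ C, ∃ n : ZeroHecke F M, (∀ χ : ZeroHecke F M →ₐ[F] F, χ n = 0) ∧
      y = n * c := by
    intro y hy
    obtain ⟨s, hs⟩ := hQ y (hC hy)
    have hm : y - (s * r⁻¹) • a ∈ Q := by
      rw [Algebra.smul_def]
      exact sub_mem (hC hy) (Q.smul_mem _ (hA ha))
    refine ⟨y - (s * r⁻¹) • a, fun χ => ?_, ?_⟩
    · have h1 := hs χ
      have h2 := har χ
      rw [map_sub, map_smul, sub_eq_zero] at h1 h2
      rw [map_sub, map_smul, h1, h2, smul_smul, mul_assoc, inv_mul_cancel₀ hr, mul_one, sub_self]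
    · have h1 := hε _ hm
      rw [← hac, mul_add] at h1
      have h2 : y - (y - (s * r⁻¹) • a) * c = (y - (s * r⁻¹) • a) * a + (s * r⁻¹) • a := by
        nth_rewrite 1 [sub_eq_iff_eq_add.mp h1.symm]
        abel
      have h3 : y - (y - (s * r⁻¹) • a) * c ∈ A := by
        rw [h2, Algebra.smul_def]
        exact add_mem (A.smul_mem _ ha) (A.smul_mem _ ha)
      have h4 : y - (y - (s * r⁻¹) • a) * c ∈ C := sub_mem hy (C.smul_mem _ hc)
      exact sub_eq_zero.mp (Submodule.disjoint_def.mp hdis _ h3 h4)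
  have hc0 : c = 0 := by
    obtain ⟨n, hn, h⟩ := key c hc
    exact 𝒟.eq_zero_of_eq_mul hn h
  rw [eq_bot_iff]
  intro y hy
  obtain ⟨n, -, h⟩ := key y hy
  rw [h, hc0, mul_zero]
  exact zero_mem _

theorem isIndecomposable_descRep (hw₀ : 𝒟.IsLongest I w₀) (hp : IsPiTop (Set.univ \ I) p) :
    IsIndecomposable (ZeroHecke F M) (ModuleOf (𝒟.descRep F I Set.univ)) := by
  let m := descSplitModel hw₀ hp
  refine IsIndecomposable.of_equiv (m.equiv m.injective).symm ?_
  set g := 𝒟.pibarOf F w₀ * p with hgdef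
  set Q := Submodule.span (ZeroHecke F M) {g} with hQdef
  have hemb : ∀ v, m.emb v ∈ Q := fun v => by
    obtain ⟨a, ha⟩ := m.emb_mem v
    exact Submodule.mem_span_singleton.mpr ⟨a, ha.symm⟩
  have hε : ∀ y ∈ Q, y * m.emb m.unit = y := fun y hy => m.mul_emb_unit hy
  have hQ : ∀ y ∈ Q, ∃ r : F, ∀ χ : ZeroHecke F M →ₐ[F] F, χ (y - r • g) = 0 := by
    intro y hy
    obtain ⟨a, rfl⟩ := Submodule.mem_span_singleton.mp hy
    exact ⟨character F 𝒟 I a, characters_sub hw₀.isPibarTop hp a⟩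
  constructor
  · have : Nonempty (𝒟.descClass I Set.univ) :=
      ⟨⟨w₀, mem_descClass_univ.mpr (Set.ext fun _ => hw₀.rdesc)⟩⟩
    have : Nontrivial (ModuleOf (𝒟.descRep F I Set.univ)) :=
      inferInstanceAs (Nontrivial (𝒟.descClass I Set.univ →₀ F))
    exact (m.equiv m.injective).symm.toEquiv.nontrivial
  · intro A C hAC
    have hbot : ∀ D : Submodule (ZeroHecke F M) Q, D.map Q.subtype = ⊥ → D = ⊥ := fun D hD =>
      Submodule.map_injective_of_injective Q.injective_subtype (hD.trans (Submodule.map_bot _).symm)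
    have hle : ∀ D : Submodule (ZeroHecke F M) Q, D.map Q.subtype ≤ Q := fun D =>
      Submodule.map_subtype_le Q D
    have hdis : Disjoint (A.map Q.subtype) (C.map Q.subtype) :=
      (Submodule.disjoint_map Q.injective_subtype hAC.disjoint)
    obtain ⟨a, ha, c, hc, hac⟩ : ∃ a ∈ A, ∃ c ∈ C, a + c = ⟨_, hemb m.unit⟩ :=
      Submodule.mem_sup.mp (hAC.sup_eq_top ▸ Submodule.mem_top)
    have hac' : a.1 + c.1 = m.emb m.unit := congrArg Subtype.val hac
    obtain ⟨r, hr⟩ := hQ a.1 a.2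
    obtain ⟨s, hs⟩ := hQ c.1 c.2
    -- If both coefficients vanish, the idempotent `emb unit` is killed by all characters and hence
    -- is zero. Otherwise the summand with nonzero coefficient forces the other one to vanish.
    by_cases hr0 : r = 0
    · by_cases hs0 : s = 0
      · have hn : ∀ χ : ZeroHecke F M →ₐ[F] F, χ (m.emb m.unit) = 0 := by
          intro χ
          have h1 := hr χ
          have h2 := hs χ
          rw [hr0, zero_smul, sub_zero] at h1
          rw [hs0, zero_smul, sub_zero] at h2
          rw [← hac', map_add, h1, h2, add_zero]
        have h0 := 𝒟.eq_zero_of_eq_mul hn (hε _ (hemb m.unit)).symm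
        refine Or.inl (hbot A ?_)
        rw [eq_bot_iff]
        intro y hy
        rw [← hε y (hle A hy), h0, mul_zero]
        exact zero_mem _
      · exact Or.inl (hbot A (𝒟.eq_bot_of_disjoint (hle C) (hle A) hdis.symm hε
          ((add_comm _ _).trans hac') ⟨c, hc, rfl⟩ ⟨a, ha, rfl⟩ hQ hs0 hs))
    · exact Or.inr (hbot C (𝒟.eq_bot_of_disjoint (hle A) (hle C) hdis hε hac' ⟨a, ha, rfl⟩
        ⟨c, hc, rfl⟩ hQ hr0 hr))

end DescentSystem

/-! ### The groups of types A and B -/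

theorem add_sub_le_of_lt {p : ℤ → ℤ} {a b : ℕ} (h : ∀ k : ℕ, a ≤ k → k < b → p k < p (k + 1)) (k l : ℕ)
    (hk : a ≤ k) (hkl : k ≤ l) (hl : l ≤ b) : p k + (l - k) ≤ p l := by
  induction l, hkl using Nat.le_induction with
  | base => simp
  | succ l hkl ih =>
    have h1 := h l (by omega) (by omega)
    have h2 := ih (by omega)
    push_cast
    omega

/-- Rearrangement: exchanging neighbours in the wrong order raises the weighted sum by `p i - p (i +
1)`. -/
theorem sum_lt_sum_of_swap {p p' : ℤ → ℤ} {N i : ℕ} (hi : i < N)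
    (h : ∀ k : ℕ, k ≠ i → k ≠ i + 1 → p' k = p k) (h1 : p' i = p (i + 1)) (h2 : p' (i + 1) = p i)
    (hlt : p (i + 1) < p i) :
    ∑ k ∈ Finset.range (N + 1), (k : ℤ) * p k < ∑ k ∈ Finset.range (N + 1), (k : ℤ) * p' k := by
  rw [← sub_pos, ← Finset.sum_sub_distrib, Finset.sum_eq_add_of_mem i (i + 1)
    (Finset.mem_range.mpr (by omega)) (Finset.mem_range.mpr (by omega)) (by omega)]
  · push_cast
    rw [h1, h2]
    linarith
  · intro k _ hk
    rw [h k hk.1 hk.2, sub_self]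

/-- A family of generators that preserves a property of elements does so along the group that they
generate. -/
theorem lt_iff_of_mem_closure {W B : Type*} [Group W] (f : W →* Equiv.Perm ℤ) {gen : B → W}
    {I : Set B} {c : ℤ} (h : ∀ i ∈ I, ∀ x, c < f (gen i) x ↔ c < x) {w : W}
    (hw : w ∈ Subgroup.closure (gen '' I)) (x : ℤ) : c < f w x ↔ c < x := by
  induction hw using Subgroup.closure_induction generalizing x with
  | mem y hy =>
    obtain ⟨i, hi, rfl⟩ := hy
    exact h i hi x
  | one => simp
  | mul a b _ _ ha hb => rw [map_mul, Equiv.Perm.mul_apply, ha, hb]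
  | inv a _ ha =>
    have := ha (f a⁻¹ x)
    rwa [← Equiv.Perm.mul_apply, ← map_mul, mul_inv_cancel, map_one, Equiv.Perm.one_apply,
      iff_comm] at this

namespace signedPerm

variable {n : ℕ}

theorem apply_neg (w : signedPerm n) (x : ℤ) : w.1 (-x) = -w.1 x := w.2.1 x

theorem apply_zero (w : signedPerm n) : w.1 0 = 0 := by
  have := apply_neg w 0
  rw [neg_zero] at this
  omega

theorem apply_of_lt (w : signedPerm n) {x : ℤ} (hx : (n : ℤ) < |x|) : w.1 x = x := w.2.2 x hx

theorem abs_apply_le (w : signedPerm n) {x : ℤ} (hx : |x| ≤ n) : |w.1 x| ≤ n := by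
  by_contra h
  have := w.1.injective (w.2.2 (w.1 x) (not_le.mp h))
  rw [this] at h
  exact h hx

theorem ext_of_nat {v w : signedPerm n} (h : ∀ k : ℕ, k ≤ n → v.1 k = w.1 k) : v = w := by
  apply Subtype.ext
  ext x
  by_cases hx : (n : ℤ) < |x|
  · rw [apply_of_lt v hx, apply_of_lt w hx]
  · rw [not_lt] at hx
    rcases abs_cases x with ⟨h1, h2⟩ | ⟨h1, h2⟩
    · obtain ⟨k, rfl⟩ := Int.eq_ofNat_of_zero_le h2
      exact h k (by omega)
    · obtain ⟨k, hk⟩ := Int.eq_ofNat_of_zero_le (show 0 ≤ -x by omega)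
      have := h k (by omega)
      rw [← hk, apply_neg, apply_neg] at this
      exact neg_injective this

instance : Finite (signedPerm n) := signedPerm_finite n

end signedPerm

theorem genB_zero_apply (x : ℤ) : genB 0 x = if x = 1 then -1 else if x = -1 then 1 else x := by
  simp [genB, Equiv.swap_apply_def]

theorem genB_apply {i : ℕ} (hi : i ≠ 0) (x : ℤ) : genB i x = if x = i then (i : ℤ) + 1
    else if x = i + 1 then (i : ℤ) else if x = -i then -(i + 1 : ℤ) else if x = -(i + 1) then -(i : ℤ)
    else x := by
  simp only [genB, if_neg hi, Equiv.Perm.mul_apply, Equiv.swap_apply_def]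
  split_ifs <;> omega

theorem genB_mul_self (i : ℕ) : genB i * genB i = 1 := by
  ext x
  rw [Equiv.Perm.mul_apply, Equiv.Perm.one_apply]
  by_cases hi : i = 0
  · subst hi
    simp only [genB_zero_apply]
    split_ifs <;> first | omega | simp_all
  · simp only [genB_apply hi]
    split_ifs <;> omega

theorem genB_inv (i : ℕ) : (genB i)⁻¹ = genB i := inv_eq_of_mul_eq_one_left (genB_mul_self i)

/-- The Coxeter system of type B. -/
def descentSystemB (n : ℕ) : DescentSystem (coxeterB n) (signedPerm n) where
  gen i := ⟨genB i, genB_mem n i⟩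
  -- Since w⁻¹(0) = 0, the coordinate at 0 is w⁻¹(1), so the same formula also detects the descent
  -- at s_0.
  coord w i := (w⁻¹).1 (i + 1) - (w⁻¹).1 i
  -- The entry -2 is at (0, 1): s_0 turns w⁻¹(2) - w⁻¹(1) into w⁻¹(2) + w⁻¹(1), which adds twice the
  -- coordinate at 0.
  cartan i j := if i = j then 2 else if (i : ℕ) + 1 = j then (if (i : ℕ) = 0 then -2 else -1)
    else if (j : ℕ) + 1 = i then -1 else 0
  coord_gen_mul i w j := by
    have h0 := signedPerm.apply_zero w⁻¹
    have hn := signedPerm.apply_neg w⁻¹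
    have hv : ∀ x, ((⟨genB i, genB_mem n i⟩ * w)⁻¹ : signedPerm n).1 x = (w⁻¹).1 (genB i x) := by
      intro x
      simp [genB_inv]
    generalize (w⁻¹).1 = p at *
    rw [hv, hv]
    obtain ⟨i, hi⟩ := i
    obtain ⟨j, hj⟩ := j
    simp only [Fin.mk.injEq]
    by_cases hi0 : i = 0
    · subst hi0
      simp only [genB_zero_apply]
      by_cases hj0 : j = 0
      · subst hj0
        simp [h0, hn]
        ring
      · by_cases hj1 : j = 1
        · subst hj1
          simp [h0, hn]
          ring
        · rw [if_neg (by omega), if_neg (by omega), if_neg (by omega), if_neg (by omega),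
            if_neg (by omega), if_neg (by omega), if_neg (by omega)]
          simp
    · simp only [genB_apply hi0]
      rcases lt_trichotomy i j with h | h | h
      · by_cases h' : i + 1 = j
        · subst h'
          simp [hi0]
          split_ifs <;> omega
        · have e : ∀ x : ℤ, (x = j ∨ x = j + 1) → (if x = (i : ℤ) then (i : ℤ) + 1 else if x = i + 1
            then (i : ℤ) else if x = -i then -(i + 1 : ℤ) else if x = -(i + 1) then -(i : ℤ)
            else x) = x := fun x hx => by split_ifs <;> omega
          rw [e _ (Or.inl rfl), e _ (Or.inr rfl), if_neg (by omega), if_neg (by omega),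
            if_neg (by omega)]
          simp
      · subst h
        simp
        ring
      · by_cases h' : j + 1 = i
        · subst h'
          simp
          split_ifs <;> omega
        · have e : ∀ x : ℤ, (x = j ∨ x = j + 1) → (if x = (i : ℤ) then (i : ℤ) + 1 else if x = i + 1
            then (i : ℤ) else if x = -i then -(i + 1 : ℤ) else if x = -(i + 1) then -(i : ℤ)
            else x) = x := fun x hx => by split_ifs <;> omega
          rw [e _ (Or.inl rfl), e _ (Or.inr rfl), if_neg (by omega), if_neg (by omega),
            if_neg (by omega)]
          simp
  coord_ne_zero w i h := by
    have := (w⁻¹).1.injective (sub_eq_zero.mp h)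
    omega
  coord_one_pos i := by simp
  -- The integers w⁻¹(0) = 0 < w⁻¹(1) < … < w⁻¹(n) ≤ n leave no freedom.
  eq_one w h := by
    have hinc : ∀ k : ℕ, 0 ≤ k → k < n → (w⁻¹).1 k < (w⁻¹).1 (k + 1) := fun k _ hk => by
      simpa using h ⟨k, hk⟩
    rw [← inv_eq_one]
    refine signedPerm.ext_of_nat fun k hk => ?_
    have h1 := add_sub_le_of_lt hinc 0 k le_rfl (Nat.zero_le k) hk
    have h2 := add_sub_le_of_lt hinc k n (Nat.zero_le k) hk le_rfl
    have h3 := (abs_le.mp (signedPerm.abs_apply_le w⁻¹ (x := n) (by simp))).2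
    rw [Nat.cast_zero, signedPerm.apply_zero] at h1
    simp only [OneMemClass.coe_one, Equiv.Perm.one_apply]
    omega
  cartan_self i := if_pos rfl
  rank_two s t hst := by
    have hst' : (s : ℕ) ≠ t := fun h => hst (Fin.ext h)
    have hM : (coxeterB n) s t = if s = t then 1 else if (s : ℕ) + 1 = t ∨ (t : ℕ) + 1 = s then
      (if (s : ℕ) = 0 ∨ (t : ℕ) = 0 then 4 else 3) else 2 := rfl
    rw [hM, if_neg hst, if_neg hst, if_neg (Ne.symm hst)]
    split_ifs <;> omega
  potential w := ∑ k ∈ Finset.range (n + 1), (k : ℤ) * (w⁻¹).1 k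
  potential_lt w i h := by
    have hn := signedPerm.apply_neg w⁻¹
    have hv : ∀ x, ((⟨genB i, genB_mem n i⟩ * w)⁻¹ : signedPerm n).1 x = (w⁻¹).1 (genB i x) := by
      intro x
      simp [genB_inv]
    by_cases hi : (i : ℕ) = 0
    · rw [hi, Nat.cast_zero, zero_add, signedPerm.apply_zero, sub_zero] at h
      rw [← sub_pos, ← Finset.sum_sub_distrib, Finset.sum_eq_single_of_mem 1
        (Finset.mem_range.mpr (by have := i.isLt; omega))]
      · rw [hv, hi, genB_zero_apply, Nat.cast_one, if_pos rfl, hn]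
        omega
      · intro k _ hk
        rw [hv, hi, genB_zero_apply, if_neg (by omega), if_neg (by omega), sub_self]
    · refine sum_lt_sum_of_swap i.isLt (fun k h1 h2 => ?_) ?_ ?_ (sub_neg.mp h)
      · rw [hv, genB_apply hi, if_neg (by omega), if_neg (by omega), if_neg (by omega),
          if_neg (by omega)]
      · rw [hv, genB_apply hi, if_pos rfl]
      · rw [hv, genB_apply hi, if_neg (by omega), if_pos rfl]
  coord_pos_of_mem I w hw k hk := by
    -- All generators except s_k preserve the half-line of integers above `k`. Hence w⁻¹(k) ≤ k <
    -- w⁻¹(k + 1).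
    have key := lt_iff_of_mem_closure (signedPerm n).subtype (c := k) (fun i hi x => by
      have hik : (i : ℕ) ≠ k := fun h => hk (Fin.ext h ▸ hi)
      change (k : ℤ) < genB i x ↔ _
      by_cases hi0 : (i : ℕ) = 0
      · rw [hi0, genB_zero_apply]
        split_ifs <;> omega
      · rw [genB_apply hi0]
        split_ifs <;> omega) (inv_mem hw)
    have h1 := (key (k + 1)).mpr (by omega)
    have h2 := mt (key k).mp (by omega)
    change (k : ℤ) < (w⁻¹).1 _ at h1
    change ¬ (k : ℤ) < (w⁻¹).1 _ at h2
    omega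

namespace symPerm

variable {m : ℕ}

theorem apply_of_not (w : symPerm m) {x : ℤ} (hx : ¬ (1 ≤ x ∧ x ≤ (m : ℤ))) : w.1 x = x := w.2 x hx

theorem apply_mem (w : symPerm m) {x : ℤ} (hx : 1 ≤ x ∧ x ≤ (m : ℤ)) :
    1 ≤ w.1 x ∧ w.1 x ≤ (m : ℤ) := by
  by_contra h
  have := w.1.injective (w.2 (w.1 x) h)
  rw [this] at h
  exact h hx

theorem ext_of_nat {v w : symPerm m} (h : ∀ k : ℕ, 1 ≤ k → k ≤ m → v.1 k = w.1 k) : v = w := by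
  apply Subtype.ext
  ext x
  by_cases hx : 1 ≤ x ∧ x ≤ (m : ℤ)
  · obtain ⟨k, rfl⟩ := Int.eq_ofNat_of_zero_le (show 0 ≤ x by omega)
    exact h k (by omega) (by omega)
  · rw [apply_of_not v hx, apply_of_not w hx]

instance : Finite (symPerm m) := by
  let f : symPerm m → (Set.Icc (1 : ℤ) m → Set.Icc (1 : ℤ) m) :=
    fun w x => ⟨w.1 x, apply_mem w x.2⟩
  refine Finite.of_injective f fun v w h => ext_of_nat fun k h1 h2 => ?_
  exact congrArg Subtype.val (congrFun h ⟨k, by omega, by omega⟩)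

theorem swap_mem (j : Fin (m - 1)) : Equiv.swap ((j : ℤ) + 1) (j + 2) ∈ symPerm m := by
  intro x hx
  have := j.isLt
  rw [Equiv.swap_apply_of_ne_of_ne] <;> rintro rfl <;> omega

end symPerm

/-- The Coxeter system of type A. -/
def descentSystemA (m : ℕ) : DescentSystem (CoxeterMatrix.A (m - 1)) (symPerm m) where
  -- The index `j` stands for the generator with number `j + 1`, whence the shifts by 1 and 2.
  gen j := ⟨Equiv.swap ((j : ℤ) + 1) (j + 2), symPerm.swap_mem j⟩
  coord w j := (w⁻¹).1 (j + 2) - (w⁻¹).1 (j + 1)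
  cartan i j := if i = j then 2 else if (i : ℕ) + 1 = j ∨ (j : ℕ) + 1 = i then -1 else 0
  coord_gen_mul i w j := by
    have hv : ∀ x, ((⟨Equiv.swap ((i : ℤ) + 1) (i + 2), symPerm.swap_mem i⟩ * w)⁻¹ : symPerm m).1 x =
        (w⁻¹).1 (Equiv.swap ((i : ℤ) + 1) (i + 2) x) := by
      intro x
      simp
    rw [hv, hv]
    generalize (w⁻¹).1 = p at *
    obtain ⟨i, hi⟩ := i
    obtain ⟨j, hj⟩ := j
    simp only [Fin.mk.injEq, Equiv.swap_apply_def]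
    by_cases h : i = j
    · subst h
      simp
      ring
    · by_cases h1 : i + 1 = j
      · subst h1
        push_cast
        rw [if_neg (by omega), if_neg (by omega), if_neg (by omega), if_pos (by ring), if_neg h,
          if_pos (by simp), show (i : ℤ) + 1 + 1 = i + 2 by ring]
        ring
      · by_cases h2 : j + 1 = i
        · subst h2
          push_cast
          rw [if_pos (by ring), if_neg (by omega), if_neg (by omega), if_neg h,
            if_pos (by simp), show (j : ℤ) + 1 + 1 = j + 2 by ring]
          ring
        · rw [if_neg (by omega), if_neg (by omega), if_neg (by omega), if_neg (by omega),
            if_neg (by omega), if_neg (by omega)]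
          ring
  coord_ne_zero w i h := by
    have := (w⁻¹).1.injective (sub_eq_zero.mp h)
    omega
  coord_one_pos i := by simp
  eq_one w h := by
    have hinc : ∀ k : ℕ, 1 ≤ k → k < m → (w⁻¹).1 k < (w⁻¹).1 (k + 1) := fun k h1 h2 => by
      have := sub_pos.mp (h ⟨k - 1, by omega⟩)
      rwa [Nat.cast_sub h1, Nat.cast_one, sub_add_cancel,
        show (k : ℤ) - 1 + 2 = k + 1 by ring] at this
    rw [← inv_eq_one]
    refine symPerm.ext_of_nat fun k hk hk' => ?_
    have h1 := add_sub_le_of_lt hinc 1 k le_rfl hk hk'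
    have h2 := add_sub_le_of_lt hinc k m hk hk' le_rfl
    have h3 := symPerm.apply_mem w⁻¹ (x := m) (by omega)
    have h4 := symPerm.apply_mem w⁻¹ (x := 1) (by omega)
    rw [Nat.cast_one] at h1
    simp only [OneMemClass.coe_one, Equiv.Perm.one_apply]
    omega
  cartan_self i := if_pos rfl
  rank_two s t hst := by
    have hst' : (s : ℕ) ≠ t := fun h => hst (Fin.ext h)
    have hM : (CoxeterMatrix.A (m - 1)) s t = if s = t then 1 else
      if (t : ℕ) + 1 = s ∨ (s : ℕ) + 1 = t then 3 else 2 := rfl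
    rw [hM, if_neg hst, if_neg hst, if_neg (Ne.symm hst)]
    split_ifs <;> omega
  potential w := ∑ k ∈ Finset.range (m + 1), (k : ℤ) * (w⁻¹).1 k
  potential_lt w i h := by
    have hv : ∀ x, ((⟨Equiv.swap ((i : ℤ) + 1) (i + 2), symPerm.swap_mem i⟩ * w)⁻¹ : symPerm m).1 x =
        (w⁻¹).1 (Equiv.swap ((i : ℤ) + 1) (i + 2) x) := by
      intro x
      simp
    have hi := i.isLt
    have e : (i : ℤ) + 2 = ((i + 1 : ℕ) : ℤ) + 1 := by push_cast; ring
    rw [sub_neg, e] at h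
    refine sum_lt_sum_of_swap (i := i + 1) (by omega) (fun k h1 h2 => ?_) ?_ ?_ (by exact_mod_cast h)
    · rw [hv, Equiv.swap_apply_of_ne_of_ne (by omega) (by omega)]
    · rw [hv, e, Nat.cast_add, Nat.cast_one, Equiv.swap_apply_left]
    · rw [hv, e, Nat.cast_add, Nat.cast_one, Equiv.swap_apply_right]
  coord_pos_of_mem I w hw k hk := by
    have key := lt_iff_of_mem_closure (symPerm m).subtype (c := k + 1) (fun i hi x => by
      have hik : (i : ℕ) ≠ k := fun h => hk (Fin.ext h ▸ hi)
      change (k : ℤ) + 1 < Equiv.swap ((i : ℤ) + 1) (i + 2) x ↔ _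
      rw [Equiv.swap_apply_def]
      split_ifs <;> omega) (inv_mem hw)
    have h1 := (key (k + 2)).mpr (by omega)
    have h2 := mt (key (k + 1)).mp (by omega)
    change (k : ℤ) + 1 < (w⁻¹).1 _ at h1
    change ¬ (k : ℤ) + 1 < (w⁻¹).1 _ at h2
    omega

/-! ### Increasing fillings -/

theorem boxRow_mono (E : Finset ℕ) : Monotone (boxRow E) := fun _ _ h =>
  Finset.card_le_card (Finset.filter_subset_filter _ (Finset.range_subset_range.mpr h))

theorem boxCol_mono (E N : Finset ℕ) : Monotone (boxCol E N) := fun _ _ h =>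
  Finset.card_le_card (Finset.filter_subset_filter _ (Finset.range_subset_range.mpr h))

theorem card_filter_range_lt {p : ℕ → Prop} [DecidablePred p] {a j b : ℕ} (haj : a ≤ j) (hjb : j < b)
    (hj : p j) : ((Finset.range a).filter p).card < ((Finset.range b).filter p).card := by
  refine Finset.card_lt_card (Finset.ssubset_iff_of_subset (Finset.filter_subset_filter _
    (Finset.range_subset_range.mpr (by omega))) |>.mpr ⟨j, ?_, ?_⟩)
  · simp [hjb, hj]
  · simp [haj]

theorem boxRow_lt {E : Finset ℕ} {a j b : ℕ} (haj : a ≤ j) (hjb : j < b) (hj : j ∈ E) :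
    boxRow E a < boxRow E b := card_filter_range_lt haj hjb hj

theorem boxCol_lt {E N : Finset ℕ} {a j b : ℕ} (haj : a ≤ j) (hjb : j < b) (hj : j ∉ E ∨ j ∈ N) :
    boxCol E N a < boxCol E N b := card_filter_range_lt (p := fun j => j ∉ E ∨ j ∈ N) haj hjb hj

theorem lt_of_steps {p : ℤ → ℤ} {a b : ℕ} (hab : a < b)
    (h : ∀ k : ℕ, a ≤ k → k < b → p k < p (k + 1)) : p a < p b := by
  have := add_sub_le_of_lt h a b le_rfl hab.le le_rfl
  omega

/-- A filling of consecutively numbered boxes is increasing if and only if it increases along all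
steps to the right and decreases along all steps upwards. -/
theorem isIncreasing_iff {E N boxes : Finset ℕ} {lo hi : ℕ}
    (hb : ∀ k, k ∈ boxes ↔ lo ≤ k ∧ k ≤ hi) (w : ℤ → ℤ) :
    IsIncreasing E N boxes w ↔ ∀ k, lo ≤ k → k < hi →
      (k ∉ E → w k < w (k + 1)) ∧ (k ∈ E → k ∉ N → w (k + 1) < w k) := by
  have hrow : ∀ k, k ∉ E → boxRow E k = boxRow E (k + 1) := fun k hk => by
    simp [boxRow, Finset.range_add_one, Finset.filter_insert, hk]
  have hcol : ∀ k, k ∈ E → k ∉ N → boxCol E N k = boxCol E N (k + 1) := fun k hk hk' => by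
    simp [boxCol, Finset.range_add_one, Finset.filter_insert, hk, hk']
  constructor
  · intro h k h1 h2
    have h3 := h k ((hb k).mpr ⟨h1, h2.le⟩) (k + 1) ((hb _).mpr ⟨by omega, h2⟩)
    rw [Nat.cast_add, Nat.cast_one] at h3
    exact ⟨fun hk => h3.1 (hrow k hk) (boxCol_lt le_rfl (by omega) (Or.inl hk)),
      fun hk hk' => h3.2 (hcol k hk hk') (boxRow_lt le_rfl (by omega) hk)⟩
  · intro h a ha b hb'
    rw [hb] at ha hb'
    constructor
    · intro h1 h2
      have hab : a < b := (boxCol_mono E N).reflect_lt h2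
      -- Between two boxes of one row no row ends, so all steps go to the right.
      refine lt_of_steps hab fun k hk hk' => (h k (by omega) (by omega)).1 fun hkE => ?_
      exact (boxRow_lt hk hk' hkE).ne h1
    · intro h1 h2
      have hab : a < b := (boxRow_mono E).reflect_lt h2
      -- Between two boxes of one column all steps go straight up. The sign turns the decrease into
      -- an increase.
      have h3 := lt_of_steps (p := fun x => -w x) hab fun k hk hk' => by
        have h4 : ¬ (k ∉ E ∨ k ∈ N) := fun hn => (boxCol_lt hk hk' hn).ne h1
        rw [not_or, not_not] at h4
        have := (h k (by omega) (by omega)).2 h4.1 h4.2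
        omega
      omega

/-- Only box number `w⁻¹ x` can contain `x`, so conditions on boxes become inequalities for `w⁻¹`.
-/
theorem exists_nat_apply_eq {n : ℕ} {w : Equiv.Perm ℤ} {x : ℤ} {P : ℕ → Prop} :
    (∃ a ∈ Finset.Icc 1 n, w a = x ∧ P a) ↔
      1 ≤ w⁻¹ x ∧ w⁻¹ x ≤ n ∧ P (w⁻¹ x).toNat := by
  constructor
  · rintro ⟨a, ha, rfl, hP⟩
    rw [Finset.mem_Icc] at ha
    rw [← Equiv.Perm.mul_apply, inv_mul_cancel, Equiv.Perm.one_apply]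
    exact ⟨by omega, by omega, by simpa using hP⟩
  · rintro ⟨h1, h2, h3⟩
    refine ⟨(w⁻¹ x).toNat, Finset.mem_Icc.mpr ⟨by omega, by omega⟩, ?_, h3⟩
    rw [Int.toNat_of_nonneg (by omega), ← Equiv.Perm.mul_apply, mul_inv_cancel,
      Equiv.Perm.one_apply]

theorem appears_iff {n : ℕ} {w : Equiv.Perm ℤ} {x : ℤ} :
    Appears (Finset.Icc 1 n) w x ↔ 1 ≤ w⁻¹ x ∧ w⁻¹ x ≤ n := by
  simpa [Appears] using exists_nat_apply_eq (n := n) (w := w) (x := x) (P := fun _ => True)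

theorem higher_iff {E : Finset ℕ} {n : ℕ} {w : Equiv.Perm ℤ} {x y : ℤ} :
    Higher E (Finset.Icc 1 n) w x y ↔ (1 ≤ w⁻¹ x ∧ w⁻¹ x ≤ n) ∧ (1 ≤ w⁻¹ y ∧ w⁻¹ y ≤ n) ∧
      boxRow E (w⁻¹ y).toNat < boxRow E (w⁻¹ x).toNat := by
  have h : Higher E (Finset.Icc 1 n) w x y ↔ ∃ a ∈ Finset.Icc 1 n, w a = x ∧
      ∃ b ∈ Finset.Icc 1 n, w b = y ∧ boxRow E b < boxRow E a := by
    unfold Higher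
    constructor
    · rintro ⟨a, ha, b, hb, h1, h2, h3⟩
      exact ⟨a, ha, h1, b, hb, h2, h3⟩
    · rintro ⟨a, ha, h1, b, hb, h2, h3⟩
      exact ⟨a, ha, b, hb, h1, h2, h3⟩
  rw [h, exists_nat_apply_eq (P := fun a => ∃ b ∈ Finset.Icc 1 n, w b = y ∧ boxRow E b < boxRow E a),
    exists_nat_apply_eq (P := fun b => boxRow E b < _)]
  tauto

/-- In an increasing filling, `x` is in a higher row than `x + 1` if and only if it comes later in
the reading word. -/
theorem higher_succ_iff {E N boxes : Finset ℕ} {n : ℕ} {w : Equiv.Perm ℤ}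
    (hb : Finset.Icc 1 n ⊆ boxes) (hw : IsIncreasing E N boxes w) {x : ℤ} :
    Higher E (Finset.Icc 1 n) w x (x + 1) ↔ (1 ≤ w⁻¹ x ∧ w⁻¹ x ≤ n) ∧
      (1 ≤ w⁻¹ (x + 1) ∧ w⁻¹ (x + 1) ≤ n) ∧ w⁻¹ (x + 1) < w⁻¹ x := by
  rw [higher_iff]
  refine and_congr_right fun hx => and_congr_right fun hy => ?_
  obtain ⟨a, ha⟩ := Int.eq_ofNat_of_zero_le (show 0 ≤ w⁻¹ x by omega)
  obtain ⟨b, hb'⟩ := Int.eq_ofNat_of_zero_le (show 0 ≤ w⁻¹ (x + 1) by omega)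
  have hwa : w a = x := by
    rw [← ha, ← Equiv.Perm.mul_apply, mul_inv_cancel, Equiv.Perm.one_apply]
  have hwb : w b = x + 1 := by
    rw [← hb', ← Equiv.Perm.mul_apply, mul_inv_cancel, Equiv.Perm.one_apply]
  have ha1 : 1 ≤ a ∧ a ≤ n := by omega
  have hb1 : 1 ≤ b ∧ b ≤ n := by omega
  rw [ha, hb', Int.toNat_natCast, Int.toNat_natCast]
  constructor
  · intro h
    exact_mod_cast (boxRow_mono E).reflect_lt h
  · intro h
    have hba : b < a := by exact_mod_cast h
    -- In a common row `x + 1` would stand to the left of `x`, against the increase along rows.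
    refine lt_of_le_of_ne (boxRow_mono E hba.le) fun heq => ?_
    have h1 : boxCol E N b < boxCol E N a := by
      refine boxCol_lt le_rfl hba (Or.inl fun hE => ?_)
      exact (boxRow_lt le_rfl hba hE).ne heq
    have h2 := (hw b (hb (Finset.mem_Icc.mpr ⟨by omega, by omega⟩)) a
      (hb (Finset.mem_Icc.mpr ⟨by omega, by omega⟩))).1 heq h1
    omega

/-- For `i ≥ 1` the signs of w⁻¹(i) and w⁻¹(i + 1) decide which clause of the definition applies:
both positive, both negative, or positive followed by negative. The fourth pattern is never a
descent. -/
theorem GenPseudoRibbon.isDescent_iff {n : ℕ} (α : GenPseudoRibbon n) {w : signedPerm n}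
    (hw : α.IsTableau w.1) (i : Fin n) :
    α.IsDescent w.1 i ↔ (descentSystemB n).coord w i < 0 := by
  have hsub : Finset.Icc 1 n ⊆ Finset.range (n + 1) := fun k hk => by
    simp only [Finset.mem_Icc, Finset.mem_range] at *
    omega
  have hneg := signedPerm.apply_neg w⁻¹
  have h0 := signedPerm.apply_zero w⁻¹
  have habs : ∀ x : ℤ, |x| ≤ n → |(w⁻¹).1 x| ≤ n := fun x => signedPerm.abs_apply_le w⁻¹
  have hinj : ∀ x : ℤ, x ≠ 0 → (w⁻¹).1 x ≠ 0 := fun x hx h =>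
    hx ((w⁻¹).1.injective (h.trans h0.symm))
  have hi := i.isLt
  change _ ↔ (w⁻¹).1 (i + 1) - (w⁻¹).1 i < 0
  have hinv : w.1⁻¹ = (w⁻¹).1 := rfl
  unfold IsDescent
  split_ifs with hi0
  · rw [appears_iff, hinv, hneg, hi0, Nat.cast_zero, zero_add, h0]
    have h1 := abs_le.mp (habs 1 (by rw [abs_one]; omega))
    have h2 := hinj 1 (by omega)
    omega
  -- The pair -(i + 1), -i consists of consecutive integers, so the same criterion covers it.
  · have h3 := higher_succ_iff hsub hw.2 (x := -(i + 1))
    rw [neg_add, neg_add_cancel_right, ← neg_add] at h3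
    rw [higher_succ_iff hsub hw.2, h3, appears_iff, appears_iff, hinv, hneg, hneg]
    have h1 := abs_le.mp (habs i (by rw [abs_of_nonneg] <;> omega))
    have h2 := abs_le.mp (habs (i + 1) (by rw [abs_of_nonneg] <;> omega))
    have h4 := hinj i (by omega)
    have h5 := hinj (i + 1) (by omega)
    omega

/-! ### Descent sets of sequences -/

theorem notMem_descentSet_singleton (a x : ℕ) : x ∉ descentSet [a] := by
  simp [descentSet]

theorem mem_descentSet_cons {A : List ℕ} (hA : A ≠ []) (a x : ℕ) :
    x ∈ descentSet (a :: A) ↔ x = a ∨ ∃ y ∈ descentSet A, x = a + y := by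
  have hl := List.length_pos_iff.mpr hA
  simp only [descentSet, Finset.mem_image, Finset.mem_Ico, List.length_cons]
  constructor
  · rintro ⟨k, hk, rfl⟩
    obtain ⟨k, rfl⟩ := Nat.exists_eq_add_of_le' hk.1
    rw [List.take_succ_cons, List.sum_cons]
    rcases Nat.eq_zero_or_pos k with rfl | h
    · simp
    · exact Or.inr ⟨_, ⟨k, ⟨h, by omega⟩, rfl⟩, rfl⟩
  · rintro (rfl | ⟨_, ⟨k, hk, rfl⟩, rfl⟩)
    · exact ⟨1, ⟨le_rfl, by omega⟩, by simp⟩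
    · exact ⟨k + 1, ⟨by omega, by omega⟩, by simp⟩

theorem mem_descentSet_append {A B : List ℕ} (hA : A ≠ []) (hB : B ≠ []) (x : ℕ) :
    x ∈ descentSet (A ++ B) ↔
      x ∈ descentSet A ∨ x = A.sum ∨ ∃ y ∈ descentSet B, x = A.sum + y := by
  induction A generalizing x with
  | nil => exact absurd rfl hA
  | cons a A ih =>
    rw [List.cons_append, mem_descentSet_cons (by simp [hB]), List.sum_cons]
    by_cases hA' : A = []
    · subst hA'
      simp [notMem_descentSet_singleton]
    · rw [mem_descentSet_cons hA']
      simp only [ih hA']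
      constructor
      · rintro (rfl | ⟨y, (h | rfl | ⟨z, hz, rfl⟩), rfl⟩)
        · exact Or.inl (Or.inl rfl)
        · exact Or.inl (Or.inr ⟨y, h, rfl⟩)
        · exact Or.inr (Or.inl rfl)
        · exact Or.inr (Or.inr ⟨z, hz, by ring⟩)
      · rintro ((rfl | ⟨y, hy, rfl⟩) | rfl | ⟨z, hz, rfl⟩)
        · exact Or.inl rfl
        · exact Or.inr ⟨y, Or.inl hy, rfl⟩
        · exact Or.inr ⟨_, Or.inr (Or.inl rfl), rfl⟩
        · exact Or.inr ⟨_, Or.inr (Or.inr ⟨z, hz, rfl⟩), by ring⟩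

theorem nearConcat_cons {A : List ℕ} (hA : A ≠ []) (a : ℕ) (B : List ℕ) :
    nearConcat (a :: A) B = a :: nearConcat A B := by
  obtain ⟨b, A, rfl⟩ := List.exists_cons_of_ne_nil hA
  simp [nearConcat, List.getLastD]

theorem nearConcat_ne_nil (A B : List ℕ) : nearConcat A B ≠ [] := by simp [nearConcat]

theorem sum_nearConcat {A B : List ℕ} (hA : A ≠ []) (hB : B ≠ []) :
    (nearConcat A B).sum = A.sum + B.sum := by
  induction A with
  | nil => exact absurd rfl hA
  | cons a A ih =>
    by_cases hA' : A = []
    · subst hA'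
      obtain ⟨b, B, rfl⟩ := List.exists_cons_of_ne_nil hB
      simp [nearConcat, add_assoc]
    · rw [nearConcat_cons hA', List.sum_cons, ih hA', List.sum_cons, add_assoc]

/-- Compared with `mem_descentSet_append`, merging two parts drops just the partial sum at the
joint. -/
theorem mem_descentSet_nearConcat {A B : List ℕ} (hA : A ≠ []) (hB : B ≠ []) (x : ℕ) :
    x ∈ descentSet (nearConcat A B) ↔ x ∈ descentSet A ∨ ∃ y ∈ descentSet B, x = A.sum + y := by
  induction A generalizing x with
  | nil => exact absurd rfl hA
  | cons a A ih =>
    by_cases hA' : A = []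
    · subst hA'
      obtain ⟨b, B, rfl⟩ := List.exists_cons_of_ne_nil hB
      have h : nearConcat [a] (b :: B) = (a + b) :: B := by simp [nearConcat]
      rw [h, or_iff_right (notMem_descentSet_singleton a x), List.sum_singleton]
      by_cases hB' : B = []
      · subst hB'
        simp [notMem_descentSet_singleton]
      · rw [mem_descentSet_cons hB']
        simp only [mem_descentSet_cons hB']
        constructor
        · rintro (rfl | ⟨y, hy, rfl⟩)
          · exact ⟨b, Or.inl rfl, rfl⟩
          · exact ⟨b + y, Or.inr ⟨y, hy, rfl⟩, by ring⟩
        · rintro ⟨_, (rfl | ⟨y, hy, rfl⟩), rfl⟩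
          · exact Or.inl rfl
          · exact Or.inr ⟨y, hy, by ring⟩
    · rw [nearConcat_cons hA', mem_descentSet_cons (nearConcat_ne_nil A B), mem_descentSet_cons hA',
        List.sum_cons]
      simp only [ih hA']
      constructor
      · rintro (rfl | ⟨y, (h | ⟨z, hz, rfl⟩), rfl⟩)
        · exact Or.inl (Or.inl rfl)
        · exact Or.inl (Or.inr ⟨y, h, rfl⟩)
        · exact Or.inr ⟨z, hz, by ring⟩
      · rintro ((rfl | ⟨y, hy, rfl⟩) | ⟨z, hz, rfl⟩)
        · exact Or.inl rfl
        · exact Or.inr ⟨y, Or.inl hy, rfl⟩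
        · exact Or.inr ⟨_, Or.inr ⟨z, hz, rfl⟩, by ring⟩

theorem lt_sum_of_mem_descentSet {A : List ℕ} (hA : ∀ a ∈ A.tail, 0 < a) {x : ℕ}
    (hx : x ∈ descentSet A) : x < A.sum := by
  induction A generalizing x with
  | nil => simp [descentSet] at hx
  | cons a A ih =>
    by_cases hA' : A = []
    · subst hA'
      exact absurd hx (notMem_descentSet_singleton a x)
    · obtain ⟨b, B, rfl⟩ := List.exists_cons_of_ne_nil hA'
      rw [List.sum_cons]
      rcases (mem_descentSet_cons hA' a x).mp hx with rfl | ⟨y, hy, rfl⟩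
      · have := hA b (by simp)
        rw [List.sum_cons]
        omega
      · have := ih (fun c hc => hA c (List.mem_of_mem_tail hc)) hy
        omega

theorem pos_of_mem_descentSet {A : List ℕ} (hA : ∀ a ∈ A, 0 < a) {x : ℕ} (hx : x ∈ descentSet A) :
    0 < x := by
  cases A with
  | nil => simp [descentSet] at hx
  | cons a A =>
    have := hA a (by simp)
    by_cases hA' : A = []
    · subst hA'
      exact absurd hx (notMem_descentSet_singleton a x)
    · rcases (mem_descentSet_cons hA' a x).mp hx with rfl | ⟨y, -, rfl⟩ <;> omega

theorem mem_descentSet_replicate (m x : ℕ) :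
    x ∈ descentSet (List.replicate m 1) ↔ 0 < x ∧ x < m := by
  induction m generalizing x with
  | zero => simp [descentSet]
  | succ m ih =>
    rcases Nat.eq_zero_or_pos m with rfl | hm
    · exact ⟨fun h => absurd h (notMem_descentSet_singleton 1 x), by omega⟩
    · rw [List.replicate_succ, mem_descentSet_cons (by simp [hm.ne'])]
      simp only [ih]
      constructor
      · rintro (rfl | ⟨y, hy, rfl⟩) <;> omega
      · rintro ⟨h1, h2⟩
        by_cases h : x = 1
        · exact Or.inl h
        · exact Or.inr ⟨x - 1, by omega, by omega⟩

/-- The leading 0 contributes the partial sum 0, which puts s_0 into J if the first component has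
positive size. -/
theorem mem_descentSet_zero_replicate (m x : ℕ) :
    x ∈ descentSet (0 :: List.replicate m 1) ↔ x < m := by
  rcases Nat.eq_zero_or_pos m with rfl | hm
  · exact ⟨fun h => absurd h (notMem_descentSet_singleton 0 x), by omega⟩
  · rw [mem_descentSet_cons (by simp [hm.ne'])]
    simp only [mem_descentSet_replicate, zero_add, exists_eq_right']
    omega

/-- The first part is the least descent. Positivity of the later parts keeps the other descents
apart from it, so it can be stripped off. -/
theorem descentSet_injective {A B : List ℕ} (hA : A ≠ []) (hB : B ≠ []) (hA' : ∀ a ∈ A.tail, 0 < a)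
    (hB' : ∀ b ∈ B.tail, 0 < b) (hs : A.sum = B.sum)
    (h : ∀ x, x ∈ descentSet A ↔ x ∈ descentSet B) : A = B := by
  induction A generalizing B with
  | nil => exact absurd rfl hA
  | cons a A ih =>
    obtain ⟨b, B, rfl⟩ := List.exists_cons_of_ne_nil hB
    rw [List.tail_cons] at hA' hB'
    have key : ∀ (c : ℕ) {C : List ℕ}, C ≠ [] → c ∈ descentSet (c :: C) := fun c C hC =>
      (mem_descentSet_cons hC c c).mpr (Or.inl rfl)
    by_cases hAn : A = []
    · subst hAn
      by_cases hBn : B = []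
      · subst hBn
        simpa using hs
      · exact absurd ((h b).mpr (key b hBn)) (notMem_descentSet_singleton a b)
    · have hBn : B ≠ [] := by
        rintro rfl
        exact absurd ((h a).mp (key a hAn)) (notMem_descentSet_singleton b a)
      simp only [mem_descentSet_cons hAn, mem_descentSet_cons hBn] at h
      have hab : a = b := by
        have h1 := (h a).mp (Or.inl rfl)
        have h2 := (h b).mpr (Or.inl rfl)
        rcases h1 with h1 | ⟨y, -, h1⟩ <;> rcases h2 with h2 | ⟨z, -, h2⟩ <;> omega
      subst hab
      congr 1
      refine ih hAn hBn (fun c hc => hA' c (List.mem_of_mem_tail hc))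
        (fun c hc => hB' c (List.mem_of_mem_tail hc)) (by simpa using hs) fun x => ?_
      constructor
      · intro hx
        have h0 := pos_of_mem_descentSet hA' hx
        rcases (h (a + x)).mp (Or.inr ⟨x, hx, rfl⟩) with h1 | ⟨y, hy, h1⟩
        · omega
        · rwa [Nat.add_left_cancel h1]
      · intro hx
        have h0 := pos_of_mem_descentSet hB' hx
        rcases (h (a + x)).mpr (Or.inr ⟨x, hx, rfl⟩) with h1 | ⟨y, hy, h1⟩
        · omega
        · rwa [Nat.add_left_cancel h1]

/-! ### Descent sets of iterated concatenations -/

theorem exists_fin_length_cons {X : Type*} (a : X) (t : List X) (P : Fin (a :: t).length → Prop) :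
    (∃ i, P i) ↔ P ⟨0, by simp⟩ ∨ ∃ i : Fin t.length, P ⟨i + 1, by simp⟩ :=
  Fin.exists_fin_succ (P := P)

section Fold

variable {X : Type*} (f : X → List ℕ) (size : X → ℕ)

theorem mem_descentSet_foldl_nearConcat (t : List X) (hf : ∀ β ∈ t, f β ≠ [])
    (hs : ∀ β ∈ t, (f β).sum = size β) (γ : List ℕ) (hγ : γ ≠ []) (x : ℕ) :
    x ∈ descentSet (t.foldl (fun γ β => nearConcat γ (f β)) γ) ↔ x ∈ descentSet γ ∨
      ∃ i : Fin t.length, ∃ y ∈ descentSet (f (t.get i)),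
        x = γ.sum + ((t.take i).map size).sum + y := by
  induction t generalizing γ with
  | nil => simp
  | cons β t ih =>
    have hβ := hf β (by simp)
    rw [List.foldl_cons, ih (fun b hb => hf b (by simp [hb])) (fun b hb => hs b (by simp [hb])) _
      (nearConcat_ne_nil _ _), mem_descentSet_nearConcat hγ hβ, sum_nearConcat hγ hβ,
      exists_fin_length_cons, hs β (by simp), or_assoc]
    simp [add_assoc]

theorem mem_descentSet_append_flatMap (t : List X) (hf : ∀ β ∈ t, f β ≠ [])
    (hs : ∀ β ∈ t, (f β).sum = size β) (γ : List ℕ) (hγ : γ ≠ []) (x : ℕ) :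
    x ∈ descentSet (γ ++ t.flatMap f) ↔ x ∈ descentSet γ ∨
      ∃ i : Fin t.length, x = γ.sum + ((t.take i).map size).sum ∨
        ∃ y ∈ descentSet (f (t.get i)), x = γ.sum + ((t.take i).map size).sum + y := by
  induction t generalizing γ with
  | nil => simp
  | cons β t ih =>
    have hβ := hf β (by simp)
    rw [List.flatMap_cons, ← List.append_assoc, ih (fun b hb => hf b (by simp [hb]))
      (fun b hb => hs b (by simp [hb])) _ (by simp [hγ]), mem_descentSet_append hγ hβ,
      List.sum_append, exists_fin_length_cons, hs β (by simp), or_assoc]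
    simp [add_assoc]

/-- The sets of sequences that arise by joining the members of `S` and the members of a list in all
possible ways. -/
def joins (t : List X) (S : Set (List ℕ)) : Set (List ℕ) :=
  t.foldl (fun S γ => {δ | ∃ β ∈ S, δ = β ++ f γ ∨ δ = nearConcat β (f γ)}) S

variable {f}

theorem tail_append_pos {A B : List ℕ} (hA : ∀ a ∈ A.tail, 0 < a) (hB : ∀ b ∈ B, 0 < b) :
    ∀ a ∈ (A ++ B).tail, 0 < a := by
  cases A with
  | nil => exact fun a ha => hB a (List.mem_of_mem_tail ha)
  | cons c A =>
    intro a ha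
    rw [List.cons_append, List.tail_cons, List.mem_append] at ha
    exact ha.elim (hA a) (hB a)

theorem tail_nearConcat_pos {A B : List ℕ} (hA : ∀ a ∈ A.tail, 0 < a) (hB : ∀ b ∈ B, 0 < b) :
    ∀ a ∈ (nearConcat A B).tail, 0 < a := by
  have hB' : ∀ b ∈ B.tail, 0 < b := fun b hb => hB b (List.mem_of_mem_tail hb)
  induction A with
  | nil => simpa [nearConcat] using hB'
  | cons c A ih =>
    by_cases hA' : A = []
    · subst hA'
      simpa [nearConcat] using hB'
    · obtain ⟨d, A, rfl⟩ := List.exists_cons_of_ne_nil hA'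
      rw [nearConcat_cons hA', List.tail_cons]
      intro a ha
      have h1 := ih fun a ha => hA a (List.mem_of_mem_tail ha)
      by_cases hA'' : A = []
      · subst hA''
        have hd := hA d (by simp)
        simp only [nearConcat, List.dropLast_singleton, List.nil_append, List.mem_cons] at ha
        rcases ha with rfl | ha
        · simp only [List.getLastD_cons, List.getLastD_nil]
          omega
        · exact hB' a ha
      · rw [nearConcat_cons hA''] at ha h1
        rcases List.mem_cons.mp ha with rfl | ha
        · exact hA a (by simp)
        · exact h1 a ha

variable (S : Set (List ℕ))

/-- Descents inside the pieces survive every way of joining; only the joints are optional. The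
starting set is arbitrary because the fold replaces it at each step. -/
theorem of_mem_joins (t : List X) (hf : ∀ β ∈ t, f β ≠ [] ∧ ∀ b ∈ f β, 0 < b)
    (hs : ∀ β ∈ t, (f β).sum = size β) (hS : ∀ γ ∈ S, γ ≠ [] ∧ ∀ c ∈ γ.tail, 0 < c) {δ : List ℕ}
    (hδ : δ ∈ joins f t S) : δ ≠ [] ∧ (∀ c ∈ δ.tail, 0 < c) ∧ ∃ γ ∈ S,
      δ.sum = γ.sum + (t.map size).sum ∧ (∀ x, x ∈ descentSet δ → x ∈ descentSet γ ∨
        ∃ i : Fin t.length, x = γ.sum + ((t.take i).map size).sum ∨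
          ∃ y ∈ descentSet (f (t.get i)), x = γ.sum + ((t.take i).map size).sum + y) ∧
      ∀ x, (x ∈ descentSet γ ∨ ∃ i : Fin t.length, 
          ∃ y ∈ descentSet (f (t.get i)), x = γ.sum + ((t.take i).map size).sum + y) →
        x ∈ descentSet δ := by
  induction t generalizing S with
  | nil => exact ⟨(hS δ hδ).1, (hS δ hδ).2, δ, hδ, by simp, by simp, by simp⟩
  | cons β t ih =>
    obtain ⟨hβ, hβ'⟩ := hf β (by simp)
    obtain ⟨h1, h2, γ', ⟨γ, hγ, hγ'⟩, h3, h4, h5⟩ := ih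
      {δ | ∃ γ ∈ S, δ = γ ++ f β ∨ δ = nearConcat γ (f β)}
      (fun b hb => hf b (by simp [hb])) (fun b hb => hs b (by simp [hb])) (by
        rintro _ ⟨γ, hγ, rfl | rfl⟩
        · exact ⟨by simp [(hS γ hγ).1], tail_append_pos (hS γ hγ).2 hβ'⟩
        · exact ⟨nearConcat_ne_nil _ _, tail_nearConcat_pos (hS γ hγ).2 hβ'⟩) hδ
    have hsum : γ'.sum = γ.sum + size β := by
      rcases hγ' with rfl | rfl
      · rw [List.sum_append, hs β (by simp)]
      · rw [sum_nearConcat (hS γ hγ).1 hβ, hs β (by simp)]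
    have h6 : ∀ x, x ∈ descentSet γ' → x ∈ descentSet γ ∨ x = γ.sum ∨
        ∃ y ∈ descentSet (f β), x = γ.sum + y := by
      intro x hx
      rcases hγ' with rfl | rfl
      · exact (mem_descentSet_append (hS γ hγ).1 hβ x).mp hx
      · rcases (mem_descentSet_nearConcat (hS γ hγ).1 hβ x).mp hx with h | h
        · exact Or.inl h
        · exact Or.inr (Or.inr h)
    have h7 : ∀ x, (x ∈ descentSet γ ∨ ∃ y ∈ descentSet (f β), x = γ.sum + y) →
        x ∈ descentSet γ' := by
      intro x hx
      rcases hγ' with rfl | rfl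
      · refine (mem_descentSet_append (hS γ hγ).1 hβ x).mpr (hx.imp id Or.inr)
      · exact (mem_descentSet_nearConcat (hS γ hγ).1 hβ x).mpr hx
    rw [hsum] at h3
    simp only [hsum, add_assoc] at h4 h5
    refine ⟨h1, h2, γ, hγ, by simp [h3, add_assoc], fun x hx => ?_, fun x hx => h5 x ?_⟩
    · rw [exists_fin_length_cons]
      rcases h4 x hx with h | h
      · rcases h6 x h with h | h
        · exact Or.inl h
        · exact Or.inr (Or.inl (by simpa using h))
      · exact Or.inr (Or.inr (by simpa [add_assoc] using h))
    · rw [exists_fin_length_cons] at hx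
      rcases hx with h | h | h
      · exact Or.inl (h7 x (Or.inl h))
      · exact Or.inl (h7 x (Or.inr (by simpa using h)))
      · exact Or.inr (by simpa [add_assoc] using h)

/-- Use · at the joints in `C` and ▷ at the others. Later joins do not touch positions below the
current sum, so earlier choices persist. -/
theorem exists_mem_joins (t : List X) (hf : ∀ β ∈ t, f β ≠ [] ∧ ∀ b ∈ f β, 0 < b)
    (hs : ∀ β ∈ t, (f β).sum = size β) (C : Set ℕ) {γ : List ℕ} (hS : γ ∈ S) (hγ : γ ≠ [])
    (hγ' : ∀ c ∈ γ.tail, 0 < c) : ∃ δ ∈ joins f t S,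
      (∀ x < γ.sum, x ∈ descentSet δ ↔ x ∈ descentSet γ) ∧ ∀ i : Fin t.length,
        γ.sum + ((t.take i).map size).sum ∈ descentSet δ ↔
          γ.sum + ((t.take i).map size).sum ∈ C := by
  induction t generalizing S γ with
  | nil => exact ⟨γ, hS, fun _ _ => Iff.rfl, fun i => i.elim0⟩
  | cons β t ih =>
    obtain ⟨hβ, hβ'⟩ := hf β (by simp)
    -- A nonempty piece puts the current joint strictly below the new sum, where it is protected by
    -- the induction hypothesis.
    have hpos : 0 < size β := by
      obtain ⟨b, B, hb⟩ := List.exists_cons_of_ne_nil hβ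
      have := hβ' b (by simp [hb])
      rw [← hs β (by simp), hb, List.sum_cons]
      omega
    obtain ⟨γ', hγS, hne, htail, hsum, hlt, hC⟩ : ∃ γ', (γ' = γ ++ f β ∨ γ' = nearConcat γ (f β)) ∧
        γ' ≠ [] ∧ (∀ c ∈ γ'.tail, 0 < c) ∧ γ'.sum = γ.sum + size β ∧
        (∀ x < γ.sum, x ∈ descentSet γ' ↔ x ∈ descentSet γ) ∧
        (γ.sum ∈ descentSet γ' ↔ γ.sum ∈ C) := by
      have hγlt : γ.sum ∉ descentSet γ := fun h => (lt_sum_of_mem_descentSet hγ' h).ne rfl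
      by_cases h : γ.sum ∈ C
      · refine ⟨_, Or.inl rfl, by simp [hγ], tail_append_pos hγ' hβ', ?_, fun x hx => ?_, ?_⟩
        · rw [List.sum_append, hs β (by simp)]
        · rw [mem_descentSet_append hγ hβ, or_iff_left]
          rintro (rfl | ⟨y, -, rfl⟩) <;> omega
        · rw [mem_descentSet_append hγ hβ]
          simp [h]
      · refine ⟨_, Or.inr rfl, nearConcat_ne_nil _ _, tail_nearConcat_pos hγ' hβ', ?_,
          fun x hx => ?_, ?_⟩
        · rw [sum_nearConcat hγ hβ, hs β (by simp)]
        · rw [mem_descentSet_nearConcat hγ hβ, or_iff_left]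
          rintro ⟨y, -, rfl⟩
          omega
        · rw [mem_descentSet_nearConcat hγ hβ, iff_false_right h, not_or]
          refine ⟨hγlt, ?_⟩
          rintro ⟨y, hy, h⟩
          have := pos_of_mem_descentSet hβ' hy
          omega
    obtain ⟨δ, hδ, h1, h2⟩ := ih {δ | ∃ γ ∈ S, δ = γ ++ f β ∨ δ = nearConcat γ (f β)}
      (fun b hb => hf b (by simp [hb])) (fun b hb => hs b (by simp [hb])) ⟨γ, hS, hγS⟩ hne htail
    refine ⟨δ, hδ, fun x hx => ?_, fun i => ?_⟩
    · rw [h1 x (by omega), hlt x hx]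
    · obtain ⟨i, hi⟩ := i
      cases i with
      | zero => simpa [h1 γ.sum (by omega)] using hC
      | succ i => simpa [hsum, add_assoc] using h2 ⟨i, by simpa using hi⟩

end Fold

/-! ### Positions in a generalized pseudo-ribbon -/

namespace GenPseudoRibbon

variable {n : ℕ} (α : GenPseudoRibbon n)

theorem offset_zero : α.offset 0 = α.headSize := by simp [offset]

theorem offset_succ (i : Fin α.numTail) : α.offset (i + 1) = α.offset i + α.tailSize i := by
  have h : α.tail.take (i + 1) = α.tail.take i ++ [α.tail.get i] := by
    rw [List.take_add_one]
    simp
  simp only [offset, h, List.map_append, List.sum_append]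
  simp [tailSize, add_assoc]

theorem tailSize_pos (i : Fin α.numTail) : 0 < α.tailSize i :=
  α.tail_pos _ (List.get_mem _ _)

theorem exists_position {k : ℕ} (hk : k < n) :
    k < α.headSize ∨ ∃ i : Fin α.numTail, ∃ y < α.tailSize i, k = α.offset i + y := by
  have h : ∀ m ≤ α.numTail, k < α.offset m →
      k < α.headSize ∨ ∃ i : Fin α.numTail, ∃ y < α.tailSize i, k = α.offset i + y := by
    intro m hm
    induction m with
    | zero => exact fun h => Or.inl (α.offset_zero ▸ h)
    | succ m ih =>
      intro h
      by_cases h' : k < α.offset m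
      · exact ih (by omega) h'
      · have := α.offset_succ ⟨m, by omega⟩
        exact Or.inr ⟨⟨m, by omega⟩, k - α.offset m, by simp only at this; omega,
          by simp only; omega⟩
  exact h _ le_rfl (by rwa [α.offset_numTail])

theorem offset_add_inj {i j : Fin α.numTail} {y z : ℕ} (hy : y < α.tailSize i)
    (hz : z < α.tailSize j) (h : α.offset i + y = α.offset j + z) : i = j := by
  rcases lt_trichotomy i j with hij | hij | hij
  · have := α.offset_add_le i hij
    omega
  · exact hij
  · have := α.offset_add_le j hij
    omega

theorem head_sum : α.head.blocks.sum = α.headSize := α.head.blocks_sum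

theorem tail_blocks (β : (m : ℕ) × Composition m) (hβ : β ∈ α.tail) :
    β.2.blocks ≠ [] ∧ ∀ b ∈ β.2.blocks, 0 < b := by
  refine ⟨fun h => ?_, fun b hb => β.2.blocks_pos hb⟩
  have h1 := β.2.blocks_sum
  have h2 := α.tail_pos β hβ
  rw [h, List.sum_nil] at h1
  omega

theorem lt_of_mem_head {x : ℕ} (hx : x ∈ descentSet α.head.blocks) : x < α.headSize :=
  α.head_sum ▸ lt_sum_of_mem_descentSet α.head.tail_pos hx

theorem _root_.Composition.lt_of_mem_descentSet {m : ℕ} (β : Composition m) {x : ℕ}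
    (hx : x ∈ descentSet β.blocks) : 0 < x ∧ x < m := by
  refine ⟨pos_of_mem_descentSet (fun b hb => β.blocks_pos hb) hx, ?_⟩
  have := lt_sum_of_mem_descentSet (fun b hb => β.blocks_pos (List.mem_of_mem_tail hb)) hx
  rwa [β.blocks_sum] at this

theorem mem_compEnds {x : ℕ} : x ∈ α.compEnds ↔ ∃ i : Fin α.numTail, x = α.offset i := by
  simp only [compEnds, Finset.mem_image, Finset.mem_range]
  exact ⟨fun ⟨i, hi, h⟩ => ⟨⟨i, hi⟩, h.symm⟩, fun ⟨i, h⟩ => ⟨i, i.isLt, h.symm⟩⟩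

theorem mem_rowEnds {x : ℕ} : x ∈ α.rowEnds ↔ x ∈ descentSet α.head.blocks ∨
    ∃ i : Fin α.numTail, x = α.offset i ∨
      ∃ y ∈ descentSet (α.tailComp i).blocks, x = α.offset i + y := by
  have := mem_descentSet_append_flatMap (fun β : (m : ℕ) × Composition m => β.2.blocks) Sigma.fst
    α.tail (fun β hβ => (α.tail_blocks β hβ).1) (fun β _ => β.2.blocks_sum) α.head.blocks
    α.head.blocks_ne_nil x
  rwa [head_sum] at this

theorem mem_nearConcatAll {x : ℕ} : x ∈ descentSet α.nearConcatAll ↔ x ∈ descentSet α.head.blocks ∨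
    ∃ i : Fin α.numTail, ∃ y ∈ descentSet (α.tailComp i).blocks, x = α.offset i + y := by
  have := mem_descentSet_foldl_nearConcat (fun β : (m : ℕ) × Composition m => β.2.blocks) Sigma.fst
    α.tail (fun β hβ => (α.tail_blocks β hβ).1) (fun β _ => β.2.blocks_sum) α.head.blocks
    α.head.blocks_ne_nil x
  rwa [head_sum] at this

theorem mem_nearConcatOnes {x : ℕ} : x ∈ descentSet α.nearConcatOnes ↔ x < α.headSize ∨
    ∃ i : Fin α.numTail, ∃ y, (0 < y ∧ y < α.tailSize i) ∧ x = α.offset i + y := by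
  have := mem_descentSet_foldl_nearConcat
    (fun β : (m : ℕ) × Composition m => List.replicate β.1 1) Sigma.fst
    α.tail (fun β hβ => by simp [(α.tail_pos β hβ).ne']) (fun β _ => by simp)
    (0 :: List.replicate α.headSize 1) (by simp) x
  simp only [mem_descentSet_zero_replicate, mem_descentSet_replicate, List.sum_cons,
    List.sum_replicate, smul_eq_mul, mul_one, zero_add] at this
  exact this

theorem offset_add_mem_compEnds {i : Fin α.numTail} {y : ℕ} (hy : y < α.tailSize i) :
    α.offset i + y ∈ α.compEnds ↔ y = 0 := by
  rw [mem_compEnds]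
  constructor
  · rintro ⟨j, hj⟩
    have := α.offset_add_inj hy (α.tailSize_pos j) hj
    subst this
    omega
  · rintro rfl
    exact ⟨i, rfl⟩

theorem notMem_compEnds_of_lt {x : ℕ} (hx : x < α.headSize) : x ∉ α.compEnds := by
  rw [mem_compEnds]
  rintro ⟨i, rfl⟩
  have := α.headSize_le_offset i
  omega

theorem compEnds_subset_rowEnds {x : ℕ} (hx : x ∈ α.compEnds) : x ∈ α.rowEnds := by
  obtain ⟨i, hi⟩ := α.mem_compEnds.mp hx
  exact α.mem_rowEnds.mpr (Or.inr ⟨i, Or.inl hi⟩)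

theorem mem_setJ {k : Fin n} : k ∈ α.setJ ↔ (k : ℕ) ∉ α.compEnds := by
  simp only [setJ, Finset.mem_filter, Finset.mem_univ, true_and, mem_nearConcatOnes]
  constructor
  · rintro (h | ⟨i, y, hy, h⟩)
    · exact α.notMem_compEnds_of_lt h
    · rw [h, α.offset_add_mem_compEnds hy.2]
      omega
  · intro h
    rcases α.exists_position k.isLt with h' | ⟨i, y, hy, h'⟩
    · exact Or.inl h'
    · rw [h', α.offset_add_mem_compEnds hy] at h
      exact Or.inr ⟨i, y, ⟨by omega, hy⟩, h'⟩

/-- The generator `k` belongs to the step from box `k` to box `k + 1`. J omits the steps between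
components, and I consists of the upward steps inside components. -/
theorem mem_setI {k : Fin n} : k ∈ α.setI ↔ (k : ℕ) ∈ α.rowEnds ∧ (k : ℕ) ∉ α.compEnds := by
  simp only [setI, Finset.mem_filter, Finset.mem_univ, true_and, mem_nearConcatAll, mem_rowEnds]
  constructor
  · rintro (h | ⟨i, y, hy, h⟩)
    · exact ⟨Or.inl h, α.notMem_compEnds_of_lt (α.lt_of_mem_head h)⟩
    · have hy' := (α.tailComp i).lt_of_mem_descentSet hy
      refine ⟨Or.inr ⟨i, Or.inr ⟨y, hy, h⟩⟩, ?_⟩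
      rw [h, α.offset_add_mem_compEnds hy'.2]
      omega
  · rintro ⟨h | ⟨i, h | h⟩, h'⟩
    · exact Or.inl h
    · exact absurd (α.mem_compEnds.mpr ⟨i, h⟩) h'
    · exact Or.inr ⟨i, h⟩

theorem setI_subset_setJ : α.setI ⊆ α.setJ := fun _ hk => α.mem_setJ.mpr (α.mem_setI.mp hk).2

theorem castLE_mem_setJ (s : Fin α.headSize) : Fin.castLE α.headSize_le s ∈ α.setJ :=
  α.mem_setJ.mpr (α.notMem_compEnds_of_lt s.isLt)

theorem tailIndex_mem_setJ (i : Fin α.numTail) (j : Fin (α.tailSize i - 1)) :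
    α.tailIndex i j ∈ α.setJ := by
  have := j.isLt
  rw [mem_setJ]
  change α.offset i + (j + 1) ∉ _
  rw [α.offset_add_mem_compEnds (by omega)]
  omega

theorem castLE_mem_setI (s : Fin α.headSize) :
    Fin.castLE α.headSize_le s ∈ α.setI ↔ (s : ℕ) ∈ descentSet α.head.blocks := by
  simp only [setI, Finset.mem_filter, Finset.mem_univ, true_and, mem_nearConcatAll, Fin.val_castLE]
  refine or_iff_left ?_
  rintro ⟨i, y, -, h⟩
  have := α.headSize_le_offset i
  have := s.isLt
  omega

theorem tailIndex_mem_setI (i : Fin α.numTail) (j : Fin (α.tailSize i - 1)) :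
    α.tailIndex i j ∈ α.setI ↔ (j : ℕ) + 1 ∈ descentSet (α.tailComp i).blocks := by
  have hj := j.isLt
  simp only [setI, Finset.mem_filter, Finset.mem_univ, true_and, mem_nearConcatAll, tailIndex]
  constructor
  · rintro (h | ⟨i', y, hy, h⟩)
    · have := α.lt_of_mem_head h
      have := α.headSize_le_offset i
      omega
    · have h1 := α.offset_add_inj (by omega) ((α.tailComp i').lt_of_mem_descentSet hy).2 h
      subst h1
      rwa [Nat.add_left_cancel h]
  · exact fun h => Or.inr ⟨i, _, h, rfl⟩

theorem exists_of_mem_setJ {k : Fin n} (hk : k ∈ α.setJ) :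
    (∃ s, k = Fin.castLE α.headSize_le s) ∨ ∃ i j, k = α.tailIndex i j := by
  rw [mem_setJ] at hk
  rcases α.exists_position k.isLt with h | ⟨i, y, hy, h⟩
  · exact Or.inl ⟨⟨k, h⟩, rfl⟩
  · rw [h, α.offset_add_mem_compEnds hy] at hk
    refine Or.inr ⟨i, ⟨y - 1, by omega⟩, Fin.ext ?_⟩
    change (k : ℕ) = α.offset i + (y - 1 + 1)
    omega

end GenPseudoRibbon

theorem PseudoComp.setJ_toGen {n : ℕ} (α : PseudoComp n) : α.toGen.setJ = Finset.univ :=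
  Finset.eq_univ_of_forall fun k => α.toGen.mem_setJ.mpr
    (α.toGen.notMem_compEnds_of_lt k.isLt)

theorem PseudoComp.setI_toGen {n : ℕ} (α : PseudoComp n) :
    α.toGen.setI = Finset.univ.filter fun i : Fin n => (i : ℕ) ∈ descentSet α.blocks := rfl

/-! ### Descent sets of the members of [α] -/

namespace GenPseudoRibbon

variable {n : ℕ} (α : GenPseudoRibbon n)

/-- Members of [α] differ only at the joints, and these are what J omits. -/
theorem bracket_descentSet {β : PseudoComp n} (hβ : β.blocks ∈ α.bracket) {k : Fin n}
    (hk : k ∈ α.setJ) : (k : ℕ) ∈ descentSet β.blocks ↔ k ∈ α.setI := by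
  obtain ⟨-, -, γ, rfl, -, h1, h2⟩ := of_mem_joins Sigma.fst {α.head.blocks} α.tail α.tail_blocks
    (fun β _ => β.2.blocks_sum) (by
      rintro _ rfl
      exact ⟨α.head.blocks_ne_nil, α.head.tail_pos⟩) hβ
  rw [head_sum] at h1 h2
  rw [mem_setJ] at hk
  rw [α.mem_setI, and_iff_left hk]
  constructor
  · exact fun h => α.mem_rowEnds.mpr (h1 _ h)
  · intro h
    refine h2 _ ?_
    rcases α.mem_rowEnds.mp h with h | ⟨i, h | h⟩
    · exact Or.inl h
    · exact absurd (α.mem_compEnds.mpr ⟨i, h⟩) hk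
    · exact Or.inr ⟨i, h⟩

/-- Outside J the set `C` prescribes the choices at the joints; inside J there is no choice.
Together with `bracket_descentSet` this matches [α] with the sets that meet J in I. -/
theorem exists_mem_bracket {C : Set (Fin n)} (hC : ∀ k ∈ α.setJ, k ∈ C ↔ k ∈ α.setI) :
    ∃ β : PseudoComp n, β.blocks ∈ α.bracket ∧
      ∀ k : Fin n, (k : ℕ) ∈ descentSet β.blocks ↔ k ∈ C := by
  obtain ⟨δ, hδ, -, h1⟩ := exists_mem_joins Sigma.fst {α.head.blocks} α.tail α.tail_blocks
    (fun β _ => β.2.blocks_sum) (Fin.val '' C) rfl α.head.blocks_ne_nil α.head.tail_pos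
  obtain ⟨h2, h3, γ, rfl, h4, -⟩ := of_mem_joins Sigma.fst {α.head.blocks} α.tail α.tail_blocks
    (fun β _ => β.2.blocks_sum) (by
      rintro _ rfl
      exact ⟨α.head.blocks_ne_nil, α.head.tail_pos⟩) hδ
  rw [head_sum] at h1 h4
  refine ⟨⟨δ, h2, h3, h4.trans α.size_eq⟩, hδ, fun k => ?_⟩
  by_cases hk : k ∈ α.setJ
  · rw [hC k hk]
    exact α.bracket_descentSet (β := ⟨δ, h2, h3, h4.trans α.size_eq⟩) hδ hk
  · rw [mem_setJ, not_not, mem_compEnds] at hk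
    obtain ⟨i, hi⟩ := hk
    have h := h1 i
    change α.offset i ∈ _ ↔ α.offset i ∈ _ at h
    rw [← hi] at h
    rw [h, Fin.val_injective.mem_set_image]

end GenPseudoRibbon

theorem PseudoComp.blocks_injective {n : ℕ} : Function.Injective (PseudoComp.blocks (n := n)) := by
  rintro ⟨_, _, _, _⟩ ⟨_, _, _, _⟩ rfl
  rfl

/-- A pseudo-composition is determined by its descents. -/
theorem PseudoComp.descents_injective {n : ℕ} :
    Function.Injective fun β : PseudoComp n => {k : Fin n | (k : ℕ) ∈ descentSet β.blocks} := by
  intro β γ h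
  refine PseudoComp.blocks_injective (descentSet_injective β.blocks_ne_nil γ.blocks_ne_nil
    β.tail_pos γ.tail_pos (β.blocks_sum.trans γ.blocks_sum.symm) fun x => ?_)
  by_cases hx : x < n
  · exact Set.ext_iff.mp h ⟨x, hx⟩
  · constructor
    · exact fun h' => absurd (β.blocks_sum ▸ lt_sum_of_mem_descentSet β.tail_pos h') hx
    · exact fun h' => absurd (γ.blocks_sum ▸ lt_sum_of_mem_descentSet γ.tail_pos h') hx

/-! ### Transport of representations -/

section Conj

variable {F R V V' : Type*} [Field F] [Ring R] [Algebra F R] [AddCommGroup V] [Module F V]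
  [AddCommGroup V'] [Module F V']

/-- The transport of a representation along an isomorphism of vector spaces. -/
def conjRep (e : V ≃ₗ[F] V') (ρ : R →ₐ[F] Module.End F V) : R →ₐ[F] Module.End F V' :=
  (e.conjAlgEquiv F).toAlgHom.comp ρ

theorem conjRep_apply (e : V ≃ₗ[F] V') (ρ : R →ₐ[F] Module.End F V) (h : R) (v : V') :
    conjRep e ρ h v = e (ρ h (e.symm v)) := rfl

/-- A representation is isomorphic to each of its transports. -/
def conjRepEquiv (e : V ≃ₗ[F] V') (ρ : R →ₐ[F] Module.End F V) :
    ModuleOf (conjRep e ρ) ≃ₗ[R] ModuleOf ρ where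
  toFun := e.symm
  invFun := e
  left_inv := e.apply_symm_apply
  right_inv := e.symm_apply_apply
  map_add' := e.symm.map_add
  map_smul' h v := e.symm_apply_apply (ρ h (e.symm v))

/-- The transport of a split model. -/
def SplitModel.conj {ρ : R →ₐ[F] Module.End F V} {g : R} (m : SplitModel ρ g) (e : V ≃ₗ[F] V') :
    SplitModel (conjRep e ρ) g where
  emb := m.emb ∘ₗ e.symm.toLinearMap
  emb_rep h v := (congrArg m.emb (e.symm_apply_apply (ρ h (e.symm v)))).trans (m.emb_rep h _)
  emb_mem v := m.emb_mem _
  gen := e m.gen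
  emb_gen := (congrArg m.emb (e.symm_apply_apply m.gen)).trans m.emb_gen
  unit := e m.unit
  rep_emb v := by
    rw [conjRep_apply, e.symm_apply_apply]
    exact (congrArg e (m.rep_emb (e.symm v))).trans (e.apply_symm_apply v)

end Conj

namespace DescentSystem

open ZeroHecke

variable (F : Type*) [Field F] {B : Type*} {M : CoxeterMatrix B} {W : Type*} [Group W]
  {𝒟 : DescentSystem M W} [Finite W] {I J : Set B} {T : Type*} (e : 𝒟.descClass I J ≃ T)

/-- The representation on the space with a basis that is indexed by a descent class. -/
def indexedRep : ZeroHecke F M →ₐ[F] Module.End F (T →₀ F) :=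
  conjRep (Finsupp.domLCongr e) (𝒟.descRep (F := F) I J)

variable {τ : T} {i : B}

theorem indexedRep_apply_single (h : ZeroHecke F M) :
    indexedRep F e h (Finsupp.single τ 1) =
      Finsupp.domLCongr (M := F) (R := F) e (𝒟.descRep (F := F) I J h (Finsupp.single (e.symm τ) 1)) := by
  rw [indexedRep, conjRep_apply, Finsupp.domLCongr_symm, Finsupp.domLCongr_single]

theorem indexedRep_of_neg (h : 𝒟.coord (e.symm τ) i < 0) :
    indexedRep F e (pibar F M i) (Finsupp.single τ 1) = -Finsupp.single τ 1 := by
  rw [indexedRep_apply_single, descRep, convRep_of_neg F _ _ h, map_neg, Finsupp.domLCongr_single,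
    e.apply_symm_apply]

theorem indexedRep_of_eq (h : ¬ 𝒟.coord (e.symm τ) i < 0) {σ : T}
    (hm : 𝒟.gen i * (e.symm τ).1 = (e.symm σ).1) :
    indexedRep F e (pibar F M i) (Finsupp.single τ 1) = Finsupp.single σ 1 := by
  have hm' : 𝒟.gen i * (e.symm τ).1 ∈ 𝒟.descClass I J := hm ▸ (e.symm σ).2
  have h1 : (⟨_, hm'⟩ : 𝒟.descClass I J) = e.symm σ := Subtype.ext hm
  rw [indexedRep_apply_single, descRep, convRep_of_mem F _ _ h hm', h1, Finsupp.domLCongr_single,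
    e.apply_symm_apply]

theorem indexedRep_of_notMem (h : ¬ 𝒟.coord (e.symm τ) i < 0)
    (hm : 𝒟.gen i * (e.symm τ).1 ∉ 𝒟.descClass I J) :
    indexedRep F e (pibar F M i) (Finsupp.single τ 1) = 0 := by
  rw [indexedRep_apply_single, descRep, convRep_of_notMem F _ _ h hm, map_zero]

end DescentSystem

/-! ### Tableaux of type B -/

namespace GenPseudoRibbon

variable {n : ℕ} (α : GenPseudoRibbon n)

/-- By `isIncreasing_iff` standardness is a condition on each pair of consecutive boxes: a right
descent of the reading word at an upward step, an ascent inside a row, nothing at a component break.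
-/
theorem isTableau_iff (w : signedPerm n) :
    α.IsTableau w.1 ↔ w ∈ (descentSystemB n).descClass (α.setI : Set (Fin n)) α.setJ := by
  have hr : ∀ i : Fin n, (descentSystemB n).rdesc w i ↔ w.1 (i + 1) < w.1 i := fun i => sub_neg
  rw [DescentSystem.mem_descClass (Finset.coe_subset.mpr α.setI_subset_setJ), IsTableau,
    and_iff_right w.2, isIncreasing_iff (lo := 0) (hi := n) (fun k => by simp)]
  simp only [hr, Finset.mem_coe, mem_setI, mem_setJ]
  constructor
  · intro h j hj
    have h1 := h j (Nat.zero_le _) j.isLt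
    exact ⟨fun h2 => ⟨by_contra fun h3 => (h1.1 h3).not_gt h2, hj⟩, fun h2 => h1.2 h2.1 hj⟩
  · intro h k _ hk
    have h1 := h ⟨k, hk⟩
    constructor
    · intro h2
      have h3 := (h1 fun h3 => h2 (α.compEnds_subset_rowEnds h3)).not.mpr fun h4 => h2 h4.1
      refine lt_of_le_of_ne (not_lt.mp h3) fun h4 => ?_
      have := w.1.injective h4
      omega
    · exact fun h2 h3 => (h1 h3).mpr ⟨h2, h3⟩

/-- Tableaux of type B as the elements of a descent class. -/
def tableauEquiv :
    (descentSystemB n).descClass (α.setI : Set (Fin n)) α.setJ ≃ α.Tableau where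
  toFun w := ⟨w.1.1, (α.isTableau_iff w.1).mpr w.2⟩
  invFun τ := ⟨⟨τ.1, τ.2.1⟩, (α.isTableau_iff ⟨τ.1, τ.2.1⟩).mp τ.2⟩
  left_inv _ := rfl
  right_inv _ := rfl

/-- The representation on the space of tableaux. -/
def tableauRep (F : Type*) [Field F] : HeckeB F n →ₐ[F] Module.End F (α.Space F) :=
  DescentSystem.indexedRep F α.tableauEquiv

/-- Applying s_i to all entries is left multiplication of the reading word, so the branches of the
operator are those of the action on the descent class. -/
theorem tableauRep_pibar (F : Type*) [Field F] (i : Fin n) :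
    α.tableauRep F (ZeroHecke.pibar F (coxeterB n) i) = α.op F i := by
  refine Finsupp.lhom_ext' fun τ => LinearMap.ext_ring ?_
  have hdesc := α.isDescent_iff (w := ⟨τ.1, τ.2.1⟩) τ.2 i
  have htab := α.isTableau_iff ((descentSystemB n).gen i * ⟨τ.1, τ.2.1⟩)
  rw [LinearMap.comp_apply, LinearMap.comp_apply, Finsupp.lsingle_apply, op,
    Finsupp.linearCombination_single, one_smul, tableauRep]
  split_ifs with h1 h2
  · exact DescentSystem.indexedRep_of_neg F _ (hdesc.mp h1)
  · exact DescentSystem.indexedRep_of_eq F _ (hdesc.not.mp h1) rfl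
  · exact DescentSystem.indexedRep_of_notMem F _ (hdesc.not.mp h1) (htab.not.mp h2)

end GenPseudoRibbon

/-! ### Tableaux of type A -/

theorem IsIncreasing.lt_of_boxRow_eq {E N boxes : Finset ℕ} {w : ℤ → ℤ}
    (hw : IsIncreasing E N boxes w) {a b : ℕ} (ha : a ∈ boxes) (hb : b ∈ boxes) (hab : a < b)
    (h : boxRow E a = boxRow E b) : w a < w b :=
  (hw a ha b hb).1 h (boxCol_lt le_rfl hab (Or.inl fun hE => (boxRow_lt le_rfl hab hE).ne h))

section TypeA

variable {m : ℕ} (β : Composition m)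

/-- The descents of a composition, as a set of indices of generators. -/
def Composition.descents : Set (Fin (m - 1)) := {j | (j : ℕ) + 1 ∈ descentSet β.blocks}

theorem isTableauA_iff (w : symPerm m) :
    IsTableauA β w.1 ↔ w ∈ (descentSystemA m).descClass β.descents Set.univ := by
  have hr : ∀ i : Fin (m - 1), (descentSystemA m).rdesc w i ↔ w.1 (i + 2) < w.1 (i + 1) :=
    fun i => sub_neg
  rw [DescentSystem.mem_descClass (Set.subset_univ _), IsTableauA,
    and_iff_right w.2, isIncreasing_iff (lo := 1) (hi := m) (fun k => by simp)]
  simp only [hr, Set.mem_univ, true_imp_iff, Composition.descents, Set.mem_ofPred_eq]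
  constructor
  · intro h j
    have hj := j.isLt
    have h1 := h (j + 1) (by omega) (by omega)
    rw [Nat.cast_add, Nat.cast_one, add_assoc, one_add_one_eq_two] at h1
    exact ⟨fun h2 => by_contra fun h3 => (h1.1 h3).not_gt h2, fun h2 => h1.2 h2 (by simp)⟩
  · intro h k hk1 hk
    obtain ⟨k, rfl⟩ := Nat.exists_eq_add_of_le' hk1
    have h1 := h ⟨k, by omega⟩
    rw [Nat.cast_add, Nat.cast_one, add_assoc, one_add_one_eq_two]
    refine ⟨fun h2 => lt_of_le_of_ne (not_lt.mp (h1.not.mpr h2)) fun h3 => ?_, fun h2 _ => h1.mpr h2⟩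
    have := w.1.injective h3
    omega

/-- Tableaux of type A as the elements of a descent class. -/
def tableauEquivA : (descentSystemA m).descClass β.descents Set.univ ≃ TableauA β where
  toFun w := ⟨w.1.1, (isTableauA_iff β w.1).mpr w.2⟩
  invFun τ := ⟨⟨τ.1, τ.2.1⟩, (isTableauA_iff β ⟨τ.1, τ.2.1⟩).mp τ.2⟩
  left_inv _ := rfl
  right_inv _ := rfl

/-- The representation on the space of tableaux. -/
def tableauRepA (F : Type*) [Field F] : HeckeA F m →ₐ[F] Module.End F (SpaceA F β) :=
  DescentSystem.indexedRep F (tableauEquivA β)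

theorem tableauRepA_pibar (F : Type*) [Field F] (i : Fin (m - 1)) :
    tableauRepA β F (ZeroHecke.pibar F (CoxeterMatrix.A (m - 1)) i) = opA F β (i + 1) := by
  refine Finsupp.lhom_ext' fun τ => LinearMap.ext_ring ?_
  have hi := i.isLt
  have hx := symPerm.apply_mem (⟨τ.1, τ.2.1⟩⁻¹ : symPerm m) (x := ((i + 1 : ℕ) : ℤ)) (by omega)
  have hy := symPerm.apply_mem (⟨τ.1, τ.2.1⟩⁻¹ : symPerm m) (x := ((i + 1 : ℕ) : ℤ) + 1) (by omega)
  have hcoord : (descentSystemA m).coord ⟨τ.1, τ.2.1⟩ i =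
    (⟨τ.1, τ.2.1⟩⁻¹ : symPerm m).1 (((i + 1 : ℕ) : ℤ) + 1) - (⟨τ.1, τ.2.1⟩⁻¹ : symPerm m).1 ((i + 1 : ℕ) : ℤ) := by
    rw [Nat.cast_add, Nat.cast_one, add_assoc]
    rfl
  have hgen : ((descentSystemA m).gen i).1 = Equiv.swap ((i + 1 : ℕ) : ℤ) (((i + 1 : ℕ) : ℤ) + 1) := by
    rw [Nat.cast_add, Nat.cast_one, add_assoc]
    rfl
  have hdesc : Higher (descentSet β.blocks) (Finset.Icc 1 m) τ.1 ((i + 1 : ℕ) : ℤ) (((i + 1 : ℕ) : ℤ) + 1) ↔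
      (descentSystemA m).coord ⟨τ.1, τ.2.1⟩ i < 0 := by
    rw [higher_succ_iff subset_rfl τ.2.2, hcoord, sub_neg]
    exact (and_iff_right hx).trans (and_iff_right hy)
  have htab := isTableauA_iff β ((descentSystemA m).gen i * ⟨τ.1, τ.2.1⟩)
  rw [Subgroup.coe_mul, hgen] at htab
  rw [LinearMap.comp_apply, LinearMap.comp_apply, Finsupp.lsingle_apply, opA,
    Finsupp.linearCombination_single, one_smul, tableauRepA]
  split_ifs with h1 h2
  · exact DescentSystem.indexedRep_of_neg F _ (hdesc.mp h1)
  · exact DescentSystem.indexedRep_of_eq F _ (hdesc.not.mp h1)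
      (Subtype.ext (congrArg (· * τ.1) hgen))
  -- If the exchanged filling were standard, the two entries could not share a row, since the
  -- exchange would make that row decrease. Not being a descent, they would then satisfy the
  -- condition of the previous branch.
  · refine DescentSystem.indexedRep_of_notMem F _ (hdesc.not.mp h1) fun hm => h2 ⟨?_, htab.mpr hm⟩
    have h3 := htab.mpr hm
    rw [hdesc, hcoord, sub_neg] at h1
    rw [higher_iff]
    refine ⟨hy, hx, ?_⟩
    obtain ⟨a, ha⟩ := Int.eq_ofNat_of_zero_le (show 0 ≤ (⟨τ.1, τ.2.1⟩⁻¹ : symPerm m).1 ((i + 1 : ℕ) : ℤ) by omega)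
    obtain ⟨b, hb⟩ :=
      Int.eq_ofNat_of_zero_le (show 0 ≤ (⟨τ.1, τ.2.1⟩⁻¹ : symPerm m).1 (((i + 1 : ℕ) : ℤ) + 1) by omega)
    have ha' : τ.1⁻¹ ((i + 1 : ℕ) : ℤ) = a := ha
    have hb' : τ.1⁻¹ (((i + 1 : ℕ) : ℤ) + 1) = b := hb
    have hwa : τ.1 a = ((i + 1 : ℕ) : ℤ) := by
      rw [← ha', ← Equiv.Perm.mul_apply, mul_inv_cancel, Equiv.Perm.one_apply]
    have hwb : τ.1 b = ((i + 1 : ℕ) : ℤ) + 1 := by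
      rw [← hb', ← Equiv.Perm.mul_apply, mul_inv_cancel, Equiv.Perm.one_apply]
    rw [ha', hb', Int.toNat_natCast, Int.toNat_natCast]
    have hab : a < b := by
      rcases lt_trichotomy a b with h | rfl | h
      · exact h
      · omega
      · omega
    refine lt_of_le_of_ne (boxRow_mono _ hab.le) fun heq => ?_
    have h4 := h3.2.lt_of_boxRow_eq (Finset.mem_Icc.mpr ⟨by omega, by omega⟩)
      (Finset.mem_Icc.mpr ⟨by omega, by omega⟩) hab heq
    rw [Equiv.Perm.mul_apply, Equiv.Perm.mul_apply, hwa, hwb, Equiv.swap_apply_left,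
      Equiv.swap_apply_right] at h4
    omega

end TypeA

/-! ### Longest elements of the hyperoctahedral group -/

section Longest

variable {n : ℕ}

theorem wordProd_eq (u : List (Fin n)) :
    wordProd n u = ((u.map (descentSystemB n).gen).prod : signedPerm n).1 := by
  rw [wordProd, SubmonoidClass.coe_list_prod, List.map_map]
  rfl

theorem lengthB_eq (w : signedPerm n) : lengthB n w.1 = (descentSystemB n).len w := by
  apply le_antisymm
  · refine Nat.sInf_le ⟨(descentSystemB n).word w, rfl, ?_⟩
    rw [wordProd_eq, (descentSystemB n).word_prod]
  · refine le_csInf ⟨_, (descentSystemB n).word w, rfl, ?_⟩ ?_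
    · rw [wordProd_eq, (descentSystemB n).word_prod]
    · rintro _ ⟨u, rfl, hu⟩
      rw [wordProd_eq] at hu
      rw [← Subtype.ext hu]
      exact (descentSystemB n).len_prod_le u

theorem mem_par_iff (I : Finset (Fin n)) (w : signedPerm n) :
    w ∈ (descentSystemB n).par (I : Set (Fin n)) ↔ w.1 ∈ parabolic n I := by
  have h : parabolic n I =
      ((descentSystemB n).par (I : Set (Fin n))).map (signedPerm n).subtype := by
    rw [DescentSystem.par, MonoidHom.map_closure, ← Set.image_comp]
    rfl
  rw [h]
  exact (Subgroup.mem_map_iff_mem (signedPerm n).subtype_injective).symm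

/-- The chosen word is reduced, so products along it depend only on its element. The monoid is
arbitrary because both π and π̄ are multiplied along this word. -/
theorem exists_isLongest_longestWord (I : Finset (Fin n)) :
    ∃ w, (descentSystemB n).IsLongest (I : Set (Fin n)) w ∧
      ∀ {A : Type*} [Monoid A] {a : Fin n → A}, SatisfiesBraid (coxeterB n) a →
        ((longestWord n I).map a).prod = (descentSystemB n).along a w := by
  obtain ⟨h1, h2⟩ := (exists_reduced n I (longest n I) (exists_longest n I).choose_spec.1).choose_spec
  obtain ⟨h3, h4⟩ := (exists_longest n I).choose_spec
  change wordProd n (longestWord n I) = _ at h1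
  change (longestWord n I).length = _ at h2
  change longest n I ∈ _ at h3
  change ∀ v ∈ _, _ ≤ lengthB n (longest n I) at h4
  rw [wordProd_eq] at h1
  rw [← h1] at h2 h3 h4
  refine ⟨_, ⟨(mem_par_iff I _).mpr h3, fun v hv => ?_⟩, fun ha => ?_⟩
  · rw [← lengthB_eq, ← lengthB_eq]
    exact h4 _ ((mem_par_iff I v).mp hv)
  · refine DescentSystem.IsReduced.prod_eq_along _ ha ?_
    rw [DescentSystem.IsReduced, h2, lengthB_eq]

end Longest

namespace DescentSystem

open ZeroHecke

variable {F : Type*} [Field F] {B : Type*} {M : CoxeterMatrix B} {W : Type*} [Group W]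
  {𝒟 : DescentSystem M W} [Finite W] {I J : Set B} {T : Type*} (e : 𝒟.descClass I J ≃ T)

variable (F) in
/-- The representation on a space with an indexed basis is isomorphic to the one on the descent
class. -/
def indexedRepEquiv {I' J' : Set B} (hI : I = I') (hJ : J = J') :
    ModuleOf (indexedRep F e) ≃ₗ[ZeroHecke F M] ModuleOf (𝒟.descRep (F := F) I' J') := by
  subst hI hJ
  exact conjRepEquiv _ _

theorem nonempty_splitModel (hJ : J = Set.univ) {w₀ : W} {p : ZeroHecke F M}
    (hw₀ : 𝒟.IsLongest I w₀) (hp : IsPiTop Iᶜ p) :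
    Nonempty (SplitModel (indexedRep F e) (𝒟.pibarOf F w₀ * p)) := by
  subst hJ
  rw [Set.compl_eq_univ_sdiff] at hp
  exact ⟨(descSplitModel hw₀ hp).conj _⟩

end DescentSystem

section Longest

variable (F : Type*) [Field F] {n : ℕ}

theorem exists_pibarLongest_eq (I : Finset (Fin n)) :
    ∃ w, (descentSystemB n).IsLongest (I : Set (Fin n)) w ∧
      pibarLongest F n I = (descentSystemB n).pibarOf F w := by
  obtain ⟨w, hw, h⟩ := exists_isLongest_longestWord I
  exact ⟨w, hw, h ((descentSystemB n).satisfiesBraid_pibar F)⟩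

theorem isPiTop_piLongest (K : Finset (Fin n)) :
    ZeroHecke.IsPiTop (K : Set (Fin n)) (piLongest F n K) := by
  obtain ⟨w, hw, h⟩ := exists_isLongest_longestWord K
  rw [piLongest, h ZeroHecke.satisfiesBraid_pi]
  exact hw.isPiTop

theorem isPibarTop_pibarLongest (I : Finset (Fin n)) :
    ZeroHecke.IsPibarTop (I : Set (Fin n)) (pibarLongest F n I) := by
  obtain ⟨w, hw, h⟩ := exists_pibarLongest_eq F I
  rw [h]
  exact hw.isPibarTop

end Longest

/-! ### The isomorphisms for tableau modules -/

namespace GenPseudoRibbon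

variable (F : Type*) [Field F] {n : ℕ} (α : GenPseudoRibbon n)

theorem nonempty_equiv_moduleIJ :
    Nonempty (ModuleOf (α.tableauRep F) ≃ₗ[HeckeB F n] moduleIJ F n α.setI α.setJ) := by
  obtain ⟨w, hw, h⟩ := exists_pibarLongest_eq F α.setI
  have hp := isPiTop_piLongest F (α.setJ \ α.setI)
  rw [Finset.coe_sdiff] at hp
  rw [moduleIJ, h]
  exact ⟨(conjRepEquiv _ _).trans
    ((DescentSystem.descModel hw hp).equiv (DescentSystem.descModel_injective hw hp))⟩

theorem nonempty_equiv_directSum :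
    Nonempty (ModuleOf (α.tableauRep F) ≃ₗ[HeckeB F n]
      ⨁ β : {β : PseudoComp n // β.blocks ∈ α.bracket}, ModuleOf (β.1.toGen.tableauRep F)) := by
  classical
  -- Descent sets index [α] bijectively by the sets that meet J in I, which is the index set
  -- required by `directSumEquiv`.
  let D : {β : PseudoComp n // β.blocks ∈ α.bracket} → Set (Fin n) :=
    fun β => {k | (k : ℕ) ∈ descentSet β.1.blocks}
  have hD : Function.Injective D := fun β γ h => Subtype.ext (PseudoComp.descents_injective h)
  have hD' : ∀ C, C ∈ Set.range D ↔ ∀ j ∈ (α.setJ : Set (Fin n)), j ∈ C ↔ j ∈ (α.setI : Set _) := by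
    intro C
    constructor
    · rintro ⟨β, rfl⟩ j hj
      exact α.bracket_descentSet β.2 hj
    · intro h
      obtain ⟨β, hβ, hβ'⟩ := α.exists_mem_bracket h
      exact ⟨⟨β, hβ⟩, Set.ext hβ'⟩
  refine ⟨(conjRepEquiv _ _).trans ((DescentSystem.directSumEquiv
    (Finset.coe_subset.mpr α.setI_subset_setJ) hD hD').symm.trans
      (DFinsupp.mapRange.linearEquiv fun β => ?_))⟩
  refine (DescentSystem.indexedRepEquiv F _ ?_ ?_).symm
  · rw [PseudoComp.setI_toGen]
    simp [D]
  · rw [PseudoComp.setJ_toGen, Finset.coe_univ]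

end GenPseudoRibbon

namespace PseudoComp

variable (F : Type*) [Field F] {n : ℕ} (α : PseudoComp n)

theorem nonempty_splitModel : ∃ z p, ZeroHecke.IsPibarTop (α.toGen.setI : Set (Fin n)) z ∧
    ZeroHecke.IsPiTop (α.toGen.setI : Set (Fin n))ᶜ p ∧
    Nonempty (SplitModel (α.toGen.tableauRep F) (z * p)) := by
  obtain ⟨w, hw, h⟩ := exists_pibarLongest_eq F α.toGen.setI
  have hp := isPiTop_piLongest F α.toGen.setIᶜ
  rw [Finset.coe_compl] at hp
  refine ⟨_, _, hw.isPibarTop, hp, DescentSystem.nonempty_splitModel _ ?_ hw hp⟩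
  rw [setJ_toGen, Finset.coe_univ]

theorem nonempty_equiv_moduleI :
    Nonempty (ModuleOf (α.toGen.tableauRep F) ≃ₗ[HeckeB F n]
      moduleI F n (Finset.univ.filter fun i : Fin n => (i : ℕ) ∈ descentSet α.blocks)) := by
  have h := α.toGen.nonempty_equiv_moduleIJ F
  rwa [setJ_toGen, setI_toGen] at h

theorem projective : Module.Projective (HeckeB F n) (ModuleOf (α.toGen.tableauRep F)) := by
  obtain ⟨z, p, -, -, ⟨m⟩⟩ := α.nonempty_splitModel F
  exact m.projective

theorem isIndecomposable : IsIndecomposable (HeckeB F n) (ModuleOf (α.toGen.tableauRep F)) := by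
  obtain ⟨w, hw, h⟩ := exists_pibarLongest_eq F α.toGen.setI
  have hp := isPiTop_piLongest F α.toGen.setIᶜ
  rw [Finset.coe_compl, Set.compl_eq_univ_sdiff] at hp
  refine IsIndecomposable.of_equiv (DescentSystem.indexedRepEquiv F _ rfl ?_).symm
    (DescentSystem.isIndecomposable_descRep hw hp)
  rw [setJ_toGen, Finset.coe_univ]

end PseudoComp

theorem Composition.nonempty_splitModel (F : Type*) [Field F] {m : ℕ} (β : Composition m) :
    ∃ z p, ZeroHecke.IsPibarTop β.descents z ∧ ZeroHecke.IsPiTop β.descentsᶜ p ∧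
      Nonempty (SplitModel (tableauRepA β F) (z * p)) := by
  have hw := (descentSystemA m).isLongest_longestOf β.descents
  have hp := (descentSystemA m).isPiTop_piTop F β.descentsᶜ
  exact ⟨_, _, hw.isPibarTop, hp, DescentSystem.nonempty_splitModel _ rfl hw hp⟩

/-! ### Tensor products and induction of split models -/

section Tensor

variable {F : Type*} [Field F]

theorem tensorRep_tmul {A₁ A₂ V₁ V₂ : Type*} [Ring A₁] [Algebra F A₁] [Ring A₂] [Algebra F A₂]
    [AddCommGroup V₁] [Module F V₁] [AddCommGroup V₂] [Module F V₂]
    (ρ₁ : A₁ →ₐ[F] Module.End F V₁) (ρ₂ : A₂ →ₐ[F] Module.End F V₂) (a : A₁) (b : A₂) (v : V₁)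
    (w : V₂) : tensorRep ρ₁ ρ₂ (a ⊗ₜ b) (v ⊗ₜ w) = ρ₁ a v ⊗ₜ[F] ρ₂ b w := rfl

/-- The outer tensor product of two split models. -/
def SplitModel.tensor {A₁ A₂ V₁ V₂ : Type*} [Ring A₁] [Algebra F A₁] [Ring A₂] [Algebra F A₂]
    [AddCommGroup V₁] [Module F V₁] [AddCommGroup V₂] [Module F V₂]
    {ρ₁ : A₁ →ₐ[F] Module.End F V₁} {ρ₂ : A₂ →ₐ[F] Module.End F V₂} {g₁ : A₁} {g₂ : A₂}
    (m₁ : SplitModel ρ₁ g₁) (m₂ : SplitModel ρ₂ g₂) :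
    SplitModel (tensorRep ρ₁ ρ₂) (g₁ ⊗ₜ[F] g₂) where
  emb := TensorProduct.map m₁.emb m₂.emb
  emb_rep h v := by
    induction h with
    | zero => simp
    | add a b ha hb => rw [map_add, LinearMap.add_apply, map_add, ha, hb, add_mul]
    | tmul a b =>
      induction v with
      | zero => simp
      | add v w hv hw => rw [map_add, map_add, hv, hw, map_add, mul_add]
      | tmul v w =>
        rw [tensorRep_tmul, TensorProduct.map_tmul, TensorProduct.map_tmul, m₁.emb_rep, m₂.emb_rep,
          Algebra.TensorProduct.tmul_mul_tmul]
  emb_mem v := by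
    induction v with
    | zero => exact ⟨0, by simp⟩
    | add v w hv hw =>
      obtain ⟨a, ha⟩ := hv
      obtain ⟨b, hb⟩ := hw
      exact ⟨a + b, by rw [map_add, ha, hb, add_mul]⟩
    | tmul v w =>
      obtain ⟨a, ha⟩ := m₁.emb_mem v
      obtain ⟨b, hb⟩ := m₂.emb_mem w
      exact ⟨a ⊗ₜ b, by rw [TensorProduct.map_tmul, ha, hb, Algebra.TensorProduct.tmul_mul_tmul]⟩
  gen := m₁.gen ⊗ₜ m₂.gen
  emb_gen := by rw [TensorProduct.map_tmul, m₁.emb_gen, m₂.emb_gen]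
  unit := m₁.unit ⊗ₜ m₂.unit
  rep_emb v := by
    induction v with
    | zero => simp
    | add v w hv hw => rw [map_add, map_add, LinearMap.add_apply, hv, hw]
    | tmul v w => rw [TensorProduct.map_tmul, tensorRep_tmul, m₁.rep_emb, m₂.rep_emb]

section Pi

variable {k : ℕ} {A V : Fin k → Type*} [∀ i, Ring (A i)]
  [∀ i, Algebra F (A i)] [∀ i, AddCommGroup (V i)] [∀ i, Module F (V i)]

theorem piTensorRep_tprod (ρ : ∀ i, A i →ₐ[F] Module.End F (V i)) (a : ∀ i, A i) (v : ∀ i, V i) :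
    piTensorRep ρ (PiTensorProduct.tprod F a) (PiTensorProduct.tprod F v) =
      PiTensorProduct.tprod F fun i => ρ i (a i) (v i) := by
  simp [piTensorRep]

/-- The outer tensor product of a finite family of split models. -/
def SplitModel.piTensor {ρ : ∀ i, A i →ₐ[F] Module.End F (V i)} {g : ∀ i, A i}
    (m : ∀ i, SplitModel (ρ i) (g i)) :
    SplitModel (piTensorRep ρ) (PiTensorProduct.tprod F g) where
  emb := PiTensorProduct.map fun i => (m i).emb
  emb_rep h v := by
    induction h using PiTensorProduct.induction_on with
    | smul_tprod r a =>
      induction v using PiTensorProduct.induction_on with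
      | smul_tprod s v =>
        simp only [map_smul, LinearMap.smul_apply, smul_mul_assoc, mul_smul_comm,
          piTensorRep_tprod, PiTensorProduct.map_tprod, PiTensorProduct.tprod_mul_tprod]
        congr 3
        funext i
        exact (m i).emb_rep _ _
      | add v w hv hw => rw [map_add, map_add, hv, hw, map_add, mul_add]
    | add a b ha hb => rw [map_add, LinearMap.add_apply, map_add, ha, hb, add_mul]
  emb_mem v := by
    induction v using PiTensorProduct.induction_on with
    | smul_tprod r v =>
      choose a ha using fun i => (m i).emb_mem (v i)
      refine ⟨r • PiTensorProduct.tprod F a, ?_⟩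
      rw [map_smul, PiTensorProduct.map_tprod, smul_mul_assoc, PiTensorProduct.tprod_mul_tprod,
        funext ha]
      rfl
    | add v w hv hw =>
      obtain ⟨a, ha⟩ := hv
      obtain ⟨b, hb⟩ := hw
      exact ⟨a + b, by rw [map_add, ha, hb, add_mul]⟩
  gen := PiTensorProduct.tprod F fun i => (m i).gen
  emb_gen := by
    rw [PiTensorProduct.map_tprod]
    simp only [(m _).emb_gen]
  unit := PiTensorProduct.tprod F fun i => (m i).unit
  rep_emb v := by
    induction v using PiTensorProduct.induction_on with
    | smul_tprod r v =>
      simp only [map_smul, LinearMap.smul_apply, PiTensorProduct.map_tprod, piTensorRep_tprod,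
        (m _).rep_emb]
    | add v w hv hw => rw [map_add, map_add, LinearMap.add_apply, hv, hw]

end Pi

section Induced

variable {A B V : Type*} [Ring A] [Algebra F A] [Ring B] [Algebra F B]
  [AddCommGroup V] [Module F V] (φ : A →ₐ[F] B) {ρ : A →ₐ[F] Module.End F V} {g : A}
  (m : SplitModel ρ g)

namespace SplitModel

/-- The map `b ⊗ v ↦ b φ(ι v)` for the embedding `ι` of a split model. -/
def tensorHom : B ⊗[F] V →ₗ[B] B :=
  TensorProduct.AlgebraTensorModule.lift
    (LinearMap.toSpanSingleton B (V →ₗ[F] B) (φ.toLinearMap ∘ₗ m.emb))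

theorem tensorHom_tmul (b : B) (v : V) : m.tensorHom φ (b ⊗ₜ v) = b * φ (m.emb v) := rfl

/-- The homomorphism from the induced module that belongs to the embedding of a split model. -/
def inducedHom : InducedModule φ ρ →ₗ[B] B :=
  Submodule.liftQ _ (m.tensorHom φ) (by
    rw [Submodule.span_le]
    rintro _ ⟨b, a, v, rfl⟩
    rw [SetLike.mem_coe, LinearMap.mem_ker, map_sub, tensorHom_tmul, tensorHom_tmul, m.emb_rep,
      map_mul, mul_assoc, sub_self])

theorem inducedHom_mk (x : B ⊗[F] V) :
    m.inducedHom φ (Submodule.Quotient.mk x) = m.tensorHom φ x := rfl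

/-- The class of `b ⊗ unit` inverts the map: `φ (emb v)` moves across the tensor sign and `ρ (emb v)
unit = v`. Neither freeness of `B` over `A` nor injectivity of `φ` plays a role. -/
theorem inducedHom_injective : Function.Injective (m.inducedHom φ) := by
  refine Function.LeftInverse.injective
    (g := fun b => (Submodule.Quotient.mk (b ⊗ₜ m.unit) : InducedModule φ ρ)) fun x => ?_
  obtain ⟨x, rfl⟩ := Submodule.Quotient.mk_surjective _ x
  rw [inducedHom_mk]
  beta_reduce
  induction x with
  | zero => rw [map_zero, TensorProduct.zero_tmul]
  | add x y hx hy => rw [map_add, TensorProduct.add_tmul, Submodule.Quotient.mk_add,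
      Submodule.Quotient.mk_add, hx, hy]
  | tmul b v =>
    rw [tensorHom_tmul, Submodule.Quotient.eq]
    refine Submodule.subset_span ⟨b, m.emb v, m.unit, ?_⟩
    rw [m.rep_emb]

theorem range_inducedHom : LinearMap.range (m.inducedHom φ) = Submodule.span B {φ g} := by
  apply le_antisymm
  · rintro _ ⟨x, rfl⟩
    obtain ⟨x, rfl⟩ := Submodule.Quotient.mk_surjective _ x
    rw [inducedHom_mk]
    induction x with
    | zero => rw [map_zero]; exact zero_mem _
    | add x y hx hy => rw [map_add]; exact add_mem hx hy
    | tmul b v =>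
      obtain ⟨a, ha⟩ := m.emb_mem v
      exact Submodule.mem_span_singleton.mpr ⟨b * φ a, by
        rw [tensorHom_tmul, ha, map_mul, smul_eq_mul, mul_assoc]⟩
  · rw [Submodule.span_singleton_le_iff_mem]
    exact ⟨Submodule.Quotient.mk (1 ⊗ₜ m.gen), by
      rw [inducedHom_mk, tensorHom_tmul, m.emb_gen, one_mul]⟩

/-- The module induced from a left ideal that is a retract of the algebra. -/
def inducedEquiv : InducedModule φ ρ ≃ₗ[B] Submodule.span B {φ g} :=
  (LinearEquiv.ofInjective _ (m.inducedHom_injective φ)).trans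
    (LinearEquiv.ofEq _ _ (m.range_inducedHom φ))

end SplitModel

end Induced

end Tensor

/-! ### The parabolic subalgebra -/

theorem prod_ofFn_mulSingle {H : Type*} [Monoid H] {k : ℕ} (i : Fin k) (x : H) :
    (List.ofFn (Pi.mulSingle i x : Fin k → H)).prod = x := by
  induction k with
  | zero => exact i.elim0
  | succ k ih =>
    rw [List.ofFn_succ, List.prod_cons]
    induction i using Fin.cases with
    | zero =>
      have h : (fun j : Fin k => (Pi.mulSingle 0 x : Fin (k + 1) → H) j.succ) = fun _ => 1 :=
        funext fun j => Pi.mulSingle_eq_of_ne (Fin.succ_ne_zero j) x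
      rw [h, List.ofFn_const, List.prod_replicate, one_pow, mul_one, Pi.mulSingle_eq_same]
    | succ i =>
      have h : (fun j : Fin k => (Pi.mulSingle i.succ x : Fin (k + 1) → H) j.succ) =
          Pi.mulSingle i x := by
        funext j
        simp [Pi.mulSingle_apply]
      rw [h, ih, Pi.mulSingle_eq_of_ne (Fin.succ_ne_zero i).symm, one_mul]

section PiTensor

variable {F : Type*} [Field F] {k : ℕ} {A : Fin k → Type*} [∀ i, Ring (A i)] [∀ i, Algebra F (A i)]

theorem piTensorLift_tprod {H : Type*} [Ring H] [Algebra F H] (φ : ∀ i, A i →ₐ[F] H) (hcomm)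
    (a : ∀ i, A i) : piTensorLift φ hcomm (PiTensorProduct.tprod F a) =
      (List.ofFn fun i => φ i (a i)).prod := by
  simp [piTensorLift]

theorem piTensorLift_single {H : Type*} [Ring H] [Algebra F H] (φ : ∀ i, A i →ₐ[F] H) (hcomm)
    (i : Fin k) (a : A i) :
    piTensorLift φ hcomm (PiTensorProduct.tprod F (Pi.mulSingle i a)) = φ i a := by
  rw [piTensorLift_tprod]
  have h : (fun j => φ j ((Pi.mulSingle i a : ∀ j, A j) j)) = Pi.mulSingle i (φ i a) := by
    funext j
    exact Pi.apply_mulSingle (fun j => φ j) (fun j => map_one (φ j)) i a j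
  rw [h, prod_ofFn_mulSingle]

variable (F) in
theorem tprod_single_mul (i : Fin k) (a : A i) (z : ∀ i, A i) :
    PiTensorProduct.tprod F (Pi.mulSingle i a) * PiTensorProduct.tprod F z =
      PiTensorProduct.tprod F (Function.update z i (a * z i)) := by
  rw [PiTensorProduct.tprod_mul_tprod]
  congr 1
  funext j
  rcases eq_or_ne j i with rfl | h
  · simp
  · simp [h]

variable (F) in
theorem tprod_mul_single (i : Fin k) (a : A i) (z : ∀ i, A i) :
    PiTensorProduct.tprod F z * PiTensorProduct.tprod F (Pi.mulSingle i a) =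
      PiTensorProduct.tprod F (Function.update z i (z i * a)) := by
  rw [PiTensorProduct.tprod_mul_tprod]
  congr 1
  funext j
  rcases eq_or_ne j i with rfl | h
  · simp
  · simp [h]

variable (F) in
theorem tprod_update_neg (i : Fin k) (z : ∀ i, A i) :
    PiTensorProduct.tprod F (Function.update z i (-z i)) = -PiTensorProduct.tprod F z := by
  rw [MultilinearMap.map_update_neg, Function.update_eq_self]

end PiTensor

theorem map_mem_submonoid_closure {M N : Type*} [Monoid M] [Monoid N] (f : M →* N) {s : Set M} {t : Set N}
    (h : ∀ x ∈ s, f x ∈ t) {x : M} (hx : x ∈ Submonoid.closure s) : f x ∈ Submonoid.closure t :=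
  (Submonoid.closure_le.mpr fun y hy => Submonoid.subset_closure (h y hy) :
    Submonoid.closure s ≤ (Submonoid.closure t).comap f) hx

namespace GenPseudoRibbon

open ZeroHecke

variable {F : Type*} [Field F] {n : ℕ} (α : GenPseudoRibbon n)

theorem parabolicHom_tmul_tprod (a : HeckeB F α.headSize) (b : ∀ i, HeckeA F (α.tailSize i)) :
    α.parabolicHom F (a ⊗ₜ PiTensorProduct.tprod F b) =
      α.headHom F a * (List.ofFn fun i => α.tailHom F i (b i)).prod := by
  rw [parabolicHom, Algebra.TensorProduct.lift_tmul, piTensorLift_tprod]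

theorem parabolicHom_head (a : HeckeB F α.headSize) :
    α.parabolicHom F (a ⊗ₜ 1) = α.headHom F a := by
  rw [parabolicHom, Algebra.TensorProduct.lift_tmul, map_one, mul_one]

theorem parabolicHom_tail (i : Fin α.numTail) (a : HeckeA F (α.tailSize i)) :
    α.parabolicHom F (1 ⊗ₜ PiTensorProduct.tprod F (Pi.mulSingle i a)) = α.tailHom F i a := by
  rw [parabolicHom, Algebra.TensorProduct.lift_tmul, map_one, one_mul, piTensorLift_single]

theorem headHom_pi (s : Fin α.headSize) :
    α.headHom F (pi F _ s) = pi F _ (Fin.castLE α.headSize_le s) := map_pi _ _ _ _ _ _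

theorem headHom_pibar (s : Fin α.headSize) :
    α.headHom F (pibar F _ s) = pibar F _ (Fin.castLE α.headSize_le s) := by
  rw [pibar, map_sub, map_one, headHom_pi, pibar]

theorem tailHom_pi (i : Fin α.numTail) (j : Fin (α.tailSize i - 1)) :
    α.tailHom F i (pi F _ j) = pi F _ (α.tailIndex i j) := map_pi _ _ _ _ _ _

theorem tailHom_pibar (i : Fin α.numTail) (j : Fin (α.tailSize i - 1)) :
    α.tailHom F i (pibar F _ j) = pibar F _ (α.tailIndex i j) := by
  rw [pibar, map_sub, map_one, tailHom_pi, pibar]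

variable {K₁ : Set (Fin α.headSize)} {K : ∀ i, Set (Fin (α.tailSize i - 1))} {L : Set (Fin n)}
  {z₁ : HeckeB F α.headSize} {z : ∀ i, HeckeA F (α.tailSize i)}

/-- The longest-element property is inherited from the factors of a parabolic subalgebra. -/
theorem isPibarTop_parabolicHom (h₁ : ∀ s, Fin.castLE α.headSize_le s ∈ L ↔ s ∈ K₁)
    (h₂ : ∀ i j, α.tailIndex i j ∈ L ↔ j ∈ K i) (hL : L ⊆ α.setJ) (hz₁ : IsPibarTop K₁ z₁)
    (hz : ∀ i, IsPibarTop (K i) (z i)) :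
    IsPibarTop L (α.parabolicHom F (z₁ ⊗ₜ PiTensorProduct.tprod F z)) where
  mem := by
    rw [parabolicHom_tmul_tprod]
    refine mul_mem (map_mem_submonoid_closure (α.headHom F).toMonoidHom ?_ hz₁.mem)
      (Submonoid.list_prod_mem _ fun x hx => ?_)
    · rintro _ ⟨s, hs, rfl⟩
      exact ⟨_, (h₁ s).mpr hs, (α.headHom_pibar s).symm⟩
    · obtain ⟨i, rfl⟩ := (List.mem_ofFn' _ _).mp hx
      refine map_mem_submonoid_closure (α.tailHom F i).toMonoidHom ?_ (hz i).mem
      rintro _ ⟨j, hj, rfl⟩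
      exact ⟨_, (h₂ i j).mpr hj, (α.tailHom_pibar i j).symm⟩
  left k hk := by
    -- Each generator in J comes from a tensor factor, and it is absorbed there.
    rcases α.exists_of_mem_setJ (hL hk) with ⟨s, rfl⟩ | ⟨i, j, rfl⟩
    · rw [← headHom_pibar, ← parabolicHom_head, ← map_mul, Algebra.TensorProduct.tmul_mul_tmul,
        hz₁.left s ((h₁ s).mp hk), one_mul, TensorProduct.neg_tmul, map_neg]
    · rw [← tailHom_pibar, ← parabolicHom_tail, ← map_mul, Algebra.TensorProduct.tmul_mul_tmul,
        tprod_single_mul, (hz i).left j ((h₂ i j).mp hk), one_mul, tprod_update_neg,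
        TensorProduct.tmul_neg, map_neg]
  right k hk := by
    rcases α.exists_of_mem_setJ (hL hk) with ⟨s, rfl⟩ | ⟨i, j, rfl⟩
    · rw [← headHom_pibar, ← parabolicHom_head, ← map_mul, Algebra.TensorProduct.tmul_mul_tmul,
        hz₁.right s ((h₁ s).mp hk), mul_one, TensorProduct.neg_tmul, map_neg]
    · rw [← tailHom_pibar, ← parabolicHom_tail, ← map_mul, Algebra.TensorProduct.tmul_mul_tmul,
        tprod_mul_single, (hz i).right j ((h₂ i j).mp hk), mul_one, tprod_update_neg,
        TensorProduct.tmul_neg, map_neg]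

/-- The longest-element property is inherited from the factors of a parabolic subalgebra. -/
theorem isPiTop_parabolicHom (h₁ : ∀ s, Fin.castLE α.headSize_le s ∈ L ↔ s ∈ K₁)
    (h₂ : ∀ i j, α.tailIndex i j ∈ L ↔ j ∈ K i) (hL : L ⊆ α.setJ) (hz₁ : IsPiTop K₁ z₁)
    (hz : ∀ i, IsPiTop (K i) (z i)) :
    IsPiTop L (α.parabolicHom F (z₁ ⊗ₜ PiTensorProduct.tprod F z)) where
  mem := by
    rw [parabolicHom_tmul_tprod]
    refine mul_mem (map_mem_submonoid_closure (α.headHom F).toMonoidHom ?_ hz₁.mem)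
      (Submonoid.list_prod_mem _ fun x hx => ?_)
    · rintro _ ⟨s, hs, rfl⟩
      exact ⟨_, (h₁ s).mpr hs, (α.headHom_pi s).symm⟩
    · obtain ⟨i, rfl⟩ := (List.mem_ofFn' _ _).mp hx
      refine map_mem_submonoid_closure (α.tailHom F i).toMonoidHom ?_ (hz i).mem
      rintro _ ⟨j, hj, rfl⟩
      exact ⟨_, (h₂ i j).mpr hj, (α.tailHom_pi i j).symm⟩
  left k hk := by
    rcases α.exists_of_mem_setJ (hL hk) with ⟨s, rfl⟩ | ⟨i, j, rfl⟩
    · rw [← headHom_pi, ← parabolicHom_head, ← map_mul, Algebra.TensorProduct.tmul_mul_tmul,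
        hz₁.left s ((h₁ s).mp hk), one_mul]
    · rw [← tailHom_pi, ← parabolicHom_tail, ← map_mul, Algebra.TensorProduct.tmul_mul_tmul,
        tprod_single_mul, (hz i).left j ((h₂ i j).mp hk), one_mul, Function.update_eq_self]
  right k hk := by
    rcases α.exists_of_mem_setJ (hL hk) with ⟨s, rfl⟩ | ⟨i, j, rfl⟩
    · rw [← headHom_pi, ← parabolicHom_head, ← map_mul, Algebra.TensorProduct.tmul_mul_tmul,
        hz₁.right s ((h₁ s).mp hk), mul_one]
    · rw [← tailHom_pi, ← parabolicHom_tail, ← map_mul, Algebra.TensorProduct.tmul_mul_tmul,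
        tprod_mul_single, (hz i).right j ((h₂ i j).mp hk), mul_one, Function.update_eq_self]

variable (F)

/-- The generator of the tensor product of the ideals maps to a product of two elements that absorb
the generators in I and in J \ I. By uniqueness it is, up to sign, the generator of P_{I,J}. -/
theorem nonempty_induced_equiv_moduleIJ :
    Nonempty (InducedModule (α.parabolicHom F)
      (tensorRep (α.head.toGen.tableauRep F)
        (piTensorRep fun i : Fin α.numTail => tableauRepA (α.tailComp i) F)) ≃ₗ[HeckeB F n]
      moduleIJ F n α.setI α.setJ) := by
  obtain ⟨z₁, p₁, hz₁, hp₁, ⟨m₁⟩⟩ := α.head.nonempty_splitModel F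
  choose z p hz hp hm using fun i => (α.tailComp i).nonempty_splitModel F
  have e := (m₁.tensor (SplitModel.piTensor fun i => (hm i).some)).inducedEquiv (α.parabolicHom F)
  have hg : α.parabolicHom F ((z₁ * p₁) ⊗ₜ PiTensorProduct.tprod F fun i => z i * p i) =
      α.parabolicHom F (z₁ ⊗ₜ PiTensorProduct.tprod F z) *
        α.parabolicHom F (p₁ ⊗ₜ PiTensorProduct.tprod F p) := by
    rw [← map_mul, Algebra.TensorProduct.tmul_mul_tmul, PiTensorProduct.tprod_mul_tprod]
    rfl
  have hhead : ∀ s, Fin.castLE α.headSize_le s ∈ α.setI ↔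
      s ∈ (α.head.toGen.setI : Set (Fin α.headSize)) := fun s => by
    rw [castLE_mem_setI, PseudoComp.setI_toGen]
    simp
  have hZ := α.isPibarTop_parabolicHom (L := α.setI) hhead α.tailIndex_mem_setI
    (Finset.coe_subset.mpr α.setI_subset_setJ) hz₁ hz
  have hP := α.isPiTop_parabolicHom (L := (α.setJ \ α.setI : Finset (Fin n)))
    (fun s => by
      rw [Finset.mem_coe, Finset.mem_sdiff, and_iff_right (α.castLE_mem_setJ s), hhead]
      rfl)
    (fun i j => by
      rw [Finset.mem_coe, Finset.mem_sdiff, and_iff_right (α.tailIndex_mem_setJ i j),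
        α.tailIndex_mem_setI]
      rfl)
    (Finset.coe_subset.mpr Finset.sdiff_subset) hp₁ hp
  rw [hg, hP.eq (isPiTop_piLongest F _)] at e
  rw [moduleIJ]
  rcases hZ.eq_or_eq_neg (isPibarTop_pibarLongest F α.setI) with h | h
  · rw [h] at e
    exact ⟨e⟩
  · rw [h, neg_mul, ← Set.neg_singleton, Submodule.span_neg] at e
    exact ⟨e⟩

end GenPseudoRibbon

end

theorem mainTheorem4 (F : Type*) [Field F] :
    ∃ (ρA : ∀ (m : ℕ) (β : Composition m), HeckeA F m →ₐ[F] Module.End F (SpaceA F β))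
      (ρB : ∀ (n : ℕ) (α : GenPseudoRibbon n), HeckeB F n →ₐ[F] Module.End F (α.Space F)),
      -- the tableau actions are well defined module structures, in type A and in type B
      (∀ (m : ℕ) (β : Composition m) (i : Fin (m - 1)),
        ρA m β (ZeroHecke.pibar F (CoxeterMatrix.A (m - 1)) i) = opA F β (i + 1)) ∧
      (∀ (n : ℕ) (α : GenPseudoRibbon n) (i : Fin n),
        ρB n α (ZeroHecke.pibar F (coxeterB n) i) = α.op F i) ∧
      -- (i) pseudo-ribbons
      (∀ (n : ℕ) (α : PseudoComp n),
        Nonempty (ModuleOf (ρB n α.toGen) ≃ₗ[HeckeB F n]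
          moduleI F n (Finset.univ.filter fun i : Fin n => (i : ℕ) ∈ descentSet α.blocks)) ∧
        Module.Projective (HeckeB F n) (ModuleOf (ρB n α.toGen)) ∧
        IsIndecomposable (HeckeB F n) (ModuleOf (ρB n α.toGen))) ∧
      -- (ii) generalized pseudo-ribbons
      (∀ (n : ℕ) (α : GenPseudoRibbon n),
        Nonempty (ModuleOf (ρB n α) ≃ₗ[HeckeB F n] moduleIJ F n α.setI α.setJ) ∧
        Nonempty (ModuleOf (ρB n α) ≃ₗ[HeckeB F n]
          InducedModule (α.parabolicHom F)
            (tensorRep (ρB α.headSize α.head.toGen)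
              (piTensorRep fun i : Fin α.numTail => ρA (α.tailSize i) (α.tailComp i)))) ∧
        Nonempty (ModuleOf (ρB n α) ≃ₗ[HeckeB F n]
          ⨁ β : {β : PseudoComp n // β.blocks ∈ α.bracket}, ModuleOf (ρB n β.1.toGen))) := by
  refine ⟨fun m β => tableauRepA β F, fun n α => α.tableauRep F,
    fun m β i => tableauRepA_pibar β F i, fun n α i => α.tableauRep_pibar F i,
    fun n α => ⟨α.nonempty_equiv_moduleI F, α.projective F, α.isIndecomposable F⟩,
    fun n α => ⟨α.nonempty_equiv_moduleIJ F, ?_, α.nonempty_equiv_directSum F⟩⟩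
  -- The tableau module and the induced module are compared through the left ideal P_{I,J}.
  obtain ⟨e⟩ := α.nonempty_equiv_moduleIJ F
  obtain ⟨e'⟩ := α.nonempty_induced_equiv_moduleIJ F
  exact ⟨e.trans e'.symm⟩
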